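/- **Theorem 4.2.** The following five statements are equivalent in $\mathbf{ZF}$ (Zermelo–Fraenkel set theory without the axiom of choice); that is, every equivalence between two of them is a theorem of $\mathbf{ZF}$, or, what amounts to the same, in every model of $\mathbf{ZF}$ the five statements, interpreted inside the model, are either all true or all false: 1. every second-countable compact Hausdorff space is sequential; 2. the Hilbert cube $[0,1]^{\omega}$ (with the product topology) is sequential; 3. the interval $[0,1]$ (as a subspace of $\mathbb{R}$) is sequential; 4. the Cantor cube $\{0,1\}^{\omega}$ (with the product topology, $\{0,1\}$ being discrete) is sequential; 5. the real line $\mathbb{R}$ (with its usual topology) is sequential. Here a subset $A$ of a topological space $X$ is called *sequentially closed* if every limit in $X$ of a convergent sequence $(x_n)_{n\in\omega}$ of points of $A$ belongs to $A$, and $X$ is called *sequential* if its sequentially closed subsets are exactly its closed subsets. A space is compact if each of its open covers has a finite subcover, and second-countable if its topology has a countable (finite or countably infinite) base. -/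

import Mathlib

/-!
# Topology inside an arbitrary model of ZF

The theorem is about provability in ZF without choice.  By soundness and completeness, a sentence is
a theorem of ZF iff it holds in every model of ZF, so we work in an arbitrary first-order
structure `M` for the language with one binary relation symbol.  The axiom schemas of separation and
replacement range over first-order formulas with parameters in `M`.  All other notions are
written out as set-theoretic formulas and interpreted in `M`: every quantifier in them ranges over
elements of `M` only, so that "function", "sequence", "topology", "natural number", "real number",
"finite", "compact" always mean what they mean inside `M`.
-/

namespace InternalZF

/-- The only non-logical symbol of set theory is a binary relation symbol. -/
inductive SetRel : ℕ → Type
  | mem : SetRel 2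

/-- The first-order language of set theory. -/
def setLang : FirstOrder.Language.{0, 0} := ⟨fun _ => Empty, SetRel⟩

universe u

variable {M : Type u} [setLang.Structure M]

/-- Membership of the structure `M`. -/
def Mem (x y : M) : Prop :=
  FirstOrder.Language.Structure.RelMap (L := setLang) (M := M) (n := 2) SetRel.mem ![x, y]

infix:50 " ∈ᴹ " => Mem

/-! ### Elementary set theory -/

/-- `x ⊆ y` -/
def Sub (x y : M) : Prop := ∀ z : M, z ∈ᴹ x → z ∈ᴹ y

/-- `e = ∅` -/
def IsEmp (e : M) : Prop := ∀ z : M, ¬ z ∈ᴹ e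

/-- `p = {x, y}` -/
def IsUPair (p x y : M) : Prop := ∀ z : M, z ∈ᴹ p ↔ z = x ∨ z = y

/-- `p = ⟨x, y⟩ = {{x}, {x, y}}` -/
def IsOPair (p x y : M) : Prop := ∃ a b : M, IsUPair a x x ∧ IsUPair b x y ∧ IsUPair p a b

/-- `u = ⋃ s` -/
def IsUnion (u s : M) : Prop := ∀ z : M, z ∈ᴹ u ↔ ∃ y : M, y ∈ᴹ s ∧ z ∈ᴹ y

/-- `i = x ∩ y` -/
def IsInter (i x y : M) : Prop := ∀ z : M, z ∈ᴹ i ↔ z ∈ᴹ x ∧ z ∈ᴹ y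

/-- `d = x \ y` -/
def IsDiff (d x y : M) : Prop := ∀ z : M, z ∈ᴹ d ↔ z ∈ᴹ x ∧ ¬ z ∈ᴹ y

/-- `y` is the power set of `x`. -/
def IsPow (y x : M) : Prop := ∀ z : M, z ∈ᴹ y ↔ Sub z x

/-- `y = x ∪ {x}` -/
def IsSucc (y x : M) : Prop := ∀ z : M, z ∈ᴹ y ↔ z ∈ᴹ x ∨ z = x

/-- `w` contains `∅` and is closed under `x ↦ x ∪ {x}`. -/
def IsInductive (w : M) : Prop :=
  (∃ e : M, IsEmp e ∧ e ∈ᴹ w) ∧ ∀ x : M, x ∈ᴹ w → ∃ y : M, IsSucc y x ∧ y ∈ᴹ w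

/-- `M` is a model of the Zermelo-Fraenkel axioms (without choice).  `Set.univ.Definable₁ setLang D`
says that `D` is the class given by a first-order formula with parameters from `M`, and
`Set.Definable₂` is the same for formulas in two variables. -/
structure IsZFModel (M : Type u) [setLang.Structure M] : Prop where
  extensionality : ∀ x y : M, (∀ z : M, z ∈ᴹ x ↔ z ∈ᴹ y) → x = y
  foundation : ∀ x : M, (∃ y : M, y ∈ᴹ x) → ∃ y : M, y ∈ᴹ x ∧ ∀ z : M, z ∈ᴹ y → ¬ z ∈ᴹ x
  pairing : ∀ x y : M, ∃ p : M, IsUPair p x y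
  union : ∀ s : M, ∃ u : M, IsUnion u s
  powerset : ∀ x : M, ∃ y : M, IsPow y x
  infinity : ∃ w : M, IsInductive w
  separation : ∀ D : Set M, (Set.univ : Set M).Definable₁ setLang D →
    ∀ a : M, ∃ b : M, ∀ z : M, z ∈ᴹ b ↔ z ∈ᴹ a ∧ z ∈ D
  replacement : ∀ F : Set (M × M), (Set.univ : Set M).Definable₂ setLang F →
    ∀ a : M, (∀ x : M, x ∈ᴹ a → ∀ y y' : M, (x, y) ∈ F → (x, y') ∈ F → y = y') →
      ∃ b : M, ∀ y : M, y ∈ᴹ b ↔ ∃ x : M, x ∈ᴹ a ∧ (x, y) ∈ F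

/-- `p = a × b` -/
def IsProd (p a b : M) : Prop :=
  ∀ z : M, z ∈ᴹ p ↔ ∃ x y : M, x ∈ᴹ a ∧ y ∈ᴹ b ∧ IsOPair z x y

/-- `⟨x, y⟩ ∈ f`, that is, `f(x) = y` when `f` is a function. -/
def App (f x y : M) : Prop := ∃ p : M, IsOPair p x y ∧ p ∈ᴹ f

/-- `f` is a function from `a` to `b`. -/
def IsFun (f a b : M) : Prop :=
  (∀ p : M, p ∈ᴹ f → ∃ x y : M, x ∈ᴹ a ∧ y ∈ᴹ b ∧ IsOPair p x y) ∧
    ∀ x : M, x ∈ᴹ a → ∃! y : M, App f x y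

/-- `f` is an injective function from `a` to `b`. -/
def IsInj (f a b : M) : Prop :=
  IsFun f a b ∧ ∀ x x' y : M, App f x y → App f x' y → x = x'

/-- `f` is a bijection from `a` onto `b`. -/
def IsBij (f a b : M) : Prop :=
  IsInj f a b ∧ ∀ y : M, y ∈ᴹ b → ∃ x : M, x ∈ᴹ a ∧ App f x y

/-! ### Natural numbers, finite and countable sets -/

/-- `w = ω`, the least inductive set. -/
def IsOmega (w : M) : Prop := IsInductive w ∧ ∀ v : M, IsInductive v → Sub w v

/-- `n ∈ ω` -/
def IsNat (n : M) : Prop := ∃ w : M, IsOmega w ∧ n ∈ᴹ w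

/-- `m ≤ n` for natural numbers. -/
def NatLe (m n : M) : Prop := m ∈ᴹ n ∨ m = n

/-- `s` is equipotent with a natural number. -/
def IsFinite (s : M) : Prop := ∃ n f : M, IsNat n ∧ IsBij f n s

/-- `s` is finite or countably infinite: it injects into `ω`. -/
def IsCountable (s : M) : Prop := ∃ w f : M, IsOmega w ∧ IsInj f s w

/-- `f(x, y) = z` -/
def App₂ (f x y z : M) : Prop := ∃ p : M, IsOPair p x y ∧ App f p z

/-- `f : ω × ω → ω` is addition, given by `m + 0 = m` and `m + (n + 1) = (m + n) + 1`. -/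
def IsAddition (f : M) : Prop :=
  ∃ w p : M, IsOmega w ∧ IsProd p w w ∧ IsFun f p w ∧
    (∀ m e : M, m ∈ᴹ w → IsEmp e → App₂ f m e m) ∧
    ∀ m n n' k k' : M, m ∈ᴹ w → n ∈ᴹ w → IsSucc n' n → App₂ f m n k → IsSucc k' k →
      App₂ f m n' k'

/-- `m + n = k` for natural numbers. -/
def Plus (m n k : M) : Prop := ∃ f : M, IsAddition f ∧ App₂ f m n k

/-- `f : ω × ω → ω` is multiplication, given by `m * 0 = 0` and `m * (n + 1) = m * n + m`. -/
def IsMultiplication (f : M) : Prop :=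
  ∃ w p : M, IsOmega w ∧ IsProd p w w ∧ IsFun f p w ∧
    (∀ m e : M, m ∈ᴹ w → IsEmp e → App₂ f m e e) ∧
    ∀ m n n' k k' : M, m ∈ᴹ w → n ∈ᴹ w → IsSucc n' n → App₂ f m n k → Plus k m k' →
      App₂ f m n' k'

/-- `m * n = k` for natural numbers. -/
def Times (m n k : M) : Prop := ∃ f : M, IsMultiplication f ∧ App₂ f m n k

/-! ### Topological spaces

A space is a pair of elements `X` (the points) and `T` (the open sets) of `M`. -/

/-- `T` is a topology on `X`; as usual `⋃ ∅ = ∅`, so `∅` is open by closure under unions. -/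
def IsTopology (X T : M) : Prop :=
  (∀ U : M, U ∈ᴹ T → Sub U X) ∧ X ∈ᴹ T ∧
    (∀ S U : M, Sub S T → IsUnion U S → U ∈ᴹ T) ∧
    ∀ U V W : M, U ∈ᴹ T → V ∈ᴹ T → IsInter W U V → W ∈ᴹ T

/-- `A` is a closed subset of `(X, T)`. -/
def IsClosedIn (X T A : M) : Prop := Sub A X ∧ ∃ U : M, IsDiff U X A ∧ U ∈ᴹ T

/-- The sequence `s : ω → X` converges to `x` in `(X, T)`. -/
def ConvergesTo (T s x : M) : Prop :=
  ∀ U : M, U ∈ᴹ T → x ∈ᴹ U → ∃ n : M, IsNat n ∧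
    ∀ m y : M, IsNat m → NatLe n m → App s m y → y ∈ᴹ U

/-- `A ⊆ X` contains all limits in `(X, T)` of sequences of points of `A`. -/
def IsSeqClosedIn (X T A : M) : Prop :=
  Sub A X ∧ ∀ w s x : M, IsOmega w → IsFun s w A → x ∈ᴹ X → ConvergesTo T s x → x ∈ᴹ A

/-- The space `(X, T)` is sequential: its sequentially closed sets are its closed sets. -/
def IsSequential (X T : M) : Prop :=
  IsTopology X T ∧ ∀ A : M, IsSeqClosedIn X T A ↔ IsClosedIn X T A

/-- `B` is a base of the topology `T`. -/
def IsBase (T B : M) : Prop :=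
  Sub B T ∧ ∀ U x : M, U ∈ᴹ T → x ∈ᴹ U → ∃ V : M, V ∈ᴹ B ∧ x ∈ᴹ V ∧ Sub V U

/-- The topology `T` has a countable base. -/
def IsSecondCountable (T : M) : Prop := ∃ B : M, IsBase T B ∧ IsCountable B

/-- `(X, T)` is a Hausdorff space. -/
def IsHausdorff (X T : M) : Prop :=
  ∀ x y : M, x ∈ᴹ X → y ∈ᴹ X → x ≠ y →
    ∃ U V : M, U ∈ᴹ T ∧ V ∈ᴹ T ∧ x ∈ᴹ U ∧ y ∈ᴹ V ∧ ∀ z : M, ¬ (z ∈ᴹ U ∧ z ∈ᴹ V)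

/-- `c` covers `X`. -/
def Covers (c X : M) : Prop := ∀ x : M, x ∈ᴹ X → ∃ U : M, U ∈ᴹ c ∧ x ∈ᴹ U

/-- Every open cover of `(X, T)` has a finite subcover. -/
def IsCompactSpace (X T : M) : Prop :=
  ∀ c : M, Sub c T → Covers c X → ∃ d : M, Sub d c ∧ IsFinite d ∧ Covers d X

/-- `S` is the subspace topology on `Y ⊆ X` inherited from the topology `T` on `X`. -/
def IsSubspaceTopology (S Y T : M) : Prop :=
  ∀ U : M, U ∈ᴹ S ↔ ∃ V : M, V ∈ᴹ T ∧ IsInter U V Y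

/-- `V` is a sequence of open sets of `(X, T)`, all but finitely many of them equal to `X`. -/
def IsBox (X T V : M) : Prop :=
  (∃ w : M, IsOmega w ∧ IsFun V w T) ∧
    ∃ k : M, IsNat k ∧ ∀ n : M, IsNat n → NatLe k n → App V n X

/-- `g(n) ∈ V(n)` for all `n ∈ ω`. -/
def InBox (g V : M) : Prop :=
  ∀ n y U : M, IsNat n → App g n y → App V n U → y ∈ᴹ U

/-- `(P, S)` is the countable power `(X, T)^ω`: the set of all functions `ω → X` with the
product topology. -/
def IsOmegaPower (P S X T : M) : Prop :=
  (∃ w : M, IsOmega w ∧ ∀ g : M, g ∈ᴹ P ↔ IsFun g w X) ∧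
    ∀ U : M, U ∈ᴹ S ↔ Sub U P ∧ ∀ g : M, g ∈ᴹ U →
      ∃ V : M, IsBox X T V ∧ InBox g V ∧ ∀ h : M, h ∈ᴹ P → InBox h V → h ∈ᴹ U

/-! ### The real line

A rational number `(a - b) / c` is represented by the triples `⟨⟨a, b⟩, c⟩` of natural numbers with
`c ≠ 0`.  Real numbers are Dedekind cuts.  A cut contains with a triple all triples that
represent the same rational number, so it amounts to a cut in the set of rational numbers. -/

/-- `q` is the triple `⟨⟨a, b⟩, c⟩` of natural numbers, with `c ≠ 0`. -/
def IsFrac (q a b c : M) : Prop :=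
  IsNat a ∧ IsNat b ∧ IsNat c ∧ ¬ IsEmp c ∧ ∃ p : M, IsOPair p a b ∧ IsOPair q p c

/-- `q` represents a rational number. -/
def IsRat (q : M) : Prop := ∃ a b c : M, IsFrac q a b c

/-- `(a - b) / c < (a' - b') / c'`, that is, `a * c' + b' * c < a' * c + b * c'`. -/
def RatLt (q q' : M) : Prop :=
  ∃ a b c a' b' c' : M, IsFrac q a b c ∧ IsFrac q' a' b' c' ∧
    ∃ m₁ m₂ m₃ m₄ s t : M, Times a c' m₁ ∧ Times b' c m₂ ∧ Times a' c m₃ ∧ Times b c' m₄ ∧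
      Plus m₁ m₂ s ∧ Plus m₃ m₄ t ∧ s ∈ᴹ t

/-- `x` is a Dedekind cut: a non-empty proper initial segment of the rationals without a
greatest element. -/
def IsCut (x : M) : Prop :=
  (∀ q : M, q ∈ᴹ x → IsRat q) ∧ (∃ q : M, q ∈ᴹ x) ∧ (∃ q : M, IsRat q ∧ ¬ q ∈ᴹ x) ∧
    (∀ q r : M, RatLt q r → r ∈ᴹ x → q ∈ᴹ x) ∧
    ∀ q : M, q ∈ᴹ x → ∃ r : M, r ∈ᴹ x ∧ RatLt q r

/-- `x < y` for real numbers. -/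
def RealLt (x y : M) : Prop := Sub x y ∧ x ≠ y

/-- `R` is the set of real numbers and `T` is its usual topology, generated by the open
intervals. -/
def IsRealLine (R T : M) : Prop :=
  (∀ x : M, x ∈ᴹ R ↔ IsCut x) ∧
    ∀ U : M, U ∈ᴹ T ↔ Sub U R ∧ ∀ x : M, x ∈ᴹ U →
      ∃ a b : M, a ∈ᴹ R ∧ b ∈ᴹ R ∧ RealLt a x ∧ RealLt x b ∧
        ∀ y : M, y ∈ᴹ R → RealLt a y → RealLt y b → y ∈ᴹ U

/-- `x` is the real number given by the rational number `r`. -/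
def IsRatCut (x r : M) : Prop := ∀ q : M, q ∈ᴹ x ↔ RatLt q r

/-- `e` is the natural number `0` and `o` is the natural number `1`. -/
def IsZeroOne (e o : M) : Prop := IsEmp e ∧ IsSucc o e

/-- `x` is the real number `0 = (0 - 0) / 1`. -/
def IsRealZero (x : M) : Prop := ∃ e o r : M, IsZeroOne e o ∧ IsFrac r e e o ∧ IsRatCut x r

/-- `x` is the real number `1 = (1 - 0) / 1`. -/
def IsRealOne (x : M) : Prop := ∃ e o r : M, IsZeroOne e o ∧ IsFrac r o e o ∧ IsRatCut x r

/-- `(I, S)` is the interval `[0, 1]` as a subspace of the real line. -/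
def IsUnitInterval (I S : M) : Prop :=
  ∃ R T z o : M, IsRealLine R T ∧ IsRealZero z ∧ IsRealOne o ∧
    (∀ x : M, x ∈ᴹ I ↔ x ∈ᴹ R ∧ Sub z x ∧ Sub x o) ∧ IsSubspaceTopology S I T

/-- `(P, S)` is the Hilbert cube `[0, 1]^ω`. -/
def IsHilbertCube (P S : M) : Prop :=
  ∃ I T : M, IsUnitInterval I T ∧ IsOmegaPower P S I T

/-- `(D, T)` is the two-point set `{0, 1}` with the discrete topology. -/
def IsDiscreteTwo (D T : M) : Prop :=
  (∃ e o : M, IsZeroOne e o ∧ IsUPair D e o) ∧ IsPow T D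

/-- `(P, S)` is the Cantor cube `{0, 1}^ω`. -/
def IsCantorCube (P S : M) : Prop :=
  ∃ D T : M, IsDiscreteTwo D T ∧ IsOmegaPower P S D T

/-! ### The five sentences, interpreted in `M`

Each of the four particular spaces is defined by a formula that is satisfied in a model of ZF by
exactly one pair, so "the space is sequential" is expressed by a definite description. -/

/-- In `M`, every second-countable compact Hausdorff space is sequential. -/
def SecondCountableCompactHausdorffSequential (M : Type u) [setLang.Structure M] : Prop :=
  ∀ X T : M, IsTopology X T → IsSecondCountable T → IsCompactSpace X T → IsHausdorff X T →
    IsSequential X T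

/-- In `M`, the Hilbert cube is sequential. -/
def HilbertCubeSequential (M : Type u) [setLang.Structure M] : Prop :=
  ∃ P S : M, IsHilbertCube P S ∧ IsSequential P S

/-- In `M`, the interval `[0, 1]` is sequential. -/
def UnitIntervalSequential (M : Type u) [setLang.Structure M] : Prop :=
  ∃ I S : M, IsUnitInterval I S ∧ IsSequential I S

/-- In `M`, the Cantor cube is sequential. -/
def CantorCubeSequential (M : Type u) [setLang.Structure M] : Prop :=
  ∃ P S : M, IsCantorCube P S ∧ IsSequential P S

/-- In `M`, the real line is sequential. -/
def RealLineSequential (M : Type u) [setLang.Structure M] : Prop :=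
  ∃ R T : M, IsRealLine R T ∧ IsSequential R T

end InternalZF

/-!
The equivalences are proved inside an arbitrary model `M` of ZF.  Separation and replacement hold in
`M` for first-order formulas only, so the predicates `Def` and `DefF` record that a property or an
operation is definable with parameters, and `fun_prop` derives definability from the way an
expression is built.  On this basis the set operations, recursion on `ω`, arithmetic, Dedekind cuts
and the topologies of the theorem are available as elements of `M`.  Induction, too, is restricted to
definable properties, as the natural numbers of `M` (the ordered semiring `N M`) may be non-standard.

Without choice, products and images of sequential spaces cannot be handled by picking points from
infinitely many sets.  What replaces the choices is that the Cantor cube is a space of binary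
sequences: a finitely branching tree of initial segments without dead ends has a definable leftmost
branch (`exists_branch`).  Hence continuous images of closed subsets of the Cantor cube in Hausdorff
spaces are closed (`closed_image`).  This has two consequences.

* If the Cantor cube is sequential, then so is every Hausdorff space `X` that is a continuous image of a
  closed subset `K` of it (`IsSequential.of_image`).  Indeed, the preimage in `K` of a sequentially
  closed set is sequentially closed, hence closed, and its image is closed again.
* If a sequential Hausdorff space contains a copy of the Cantor cube, then the Cantor cube is
  sequential (`IsSequential.of_embedding`), since this copy is a closed subspace.

All spaces in question are such images.  A compact Hausdorff space with a countable base is an image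
of a closed subset of the Cantor cube, where a binary sequence chooses a member of each of the closed
covers `{X \ U, X \ V}` given by disjoint basic open sets `U` and `V` (`IsSequential.of_compact`).
Explicit codings by decisions on rational numbers give the same for `[a, b]^ω` (`powTop_interval`).
A space is an image of its power `X^ω` under a projection with an explicit section, so `[a, b]` is
sequential if `[a, b]^ω` is (`IsSequential.of_powTop`), and then so is the real line, since it is locally
an interval (`realLine_of_intervals`).  Conversely, `[0, 1]` is closed in the real line, it contains the
Cantor set (`cantor_of_unitInterval`), and the Cantor cube is itself a compact Hausdorff space with a
countable base.
-/

namespace InternalZF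

universe u

/-! ### Definability -/

/-- A type of finite tuples of elements of `M`: these serve as the contexts of free variables of
definable predicates.  Contexts are built from `M` by binary products, so that binding a variable
`x : M` of a predicate on `Γ` means passing to `Γ × M`, the shape in which `fun_prop` handles functions
of several arguments. -/
class Ctx (M : outParam (Type u)) (Γ : Type u) where
  /-- the index type of the coordinates -/
  ι : Type
  finite : Finite ι
  /-- the coordinates of a tuple -/
  equiv : Γ ≃ (ι → M)

instance Ctx.self (M : Type u) : Ctx M M where
  ι := Unit
  finite := inferInstance
  equiv := (Equiv.funUnique Unit M).symm

instance Ctx.prod {M : Type u} (Γ Δ : Type u) [a : Ctx M Γ] [b : Ctx M Δ] : Ctx M (Γ × Δ) where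
  ι := a.ι ⊕ b.ι
  finite := by have := a.finite; have := b.finite; infer_instance
  equiv := (a.equiv.prodCongr b.equiv).trans (Equiv.sumArrowEquivProdArrow _ _ _).symm

section Definability

variable {M : Type u} [setLang.Structure M] {Γ Δ E : Type u} [Ctx M Γ] [Ctx M Δ] [Ctx M E]

/-- `P` is given by a first-order formula with parameters from `M`, so that the axiom schemas of
separation and replacement apply to it.  The rules below let `fun_prop` prove definability. -/
@[fun_prop]
def Def (P : Γ → Prop) : Prop :=
  (Set.univ : Set M).Definable setLang {v : Ctx.ι Γ → M | P (Ctx.equiv.symm v)}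

/-- The graph of `t` is given by a first-order formula with parameters from `M`. -/
@[fun_prop]
def DefF (t : Γ → Δ) : Prop := Def (fun p : Γ × Δ => p.2 = t p.1)

theorem Def.congr {P Q : Γ → Prop} (h : Def P) (e : ∀ g, Q g ↔ P g) : Def Q := by
  rwa [show Q = P from funext fun g => propext (e g)]

@[fun_prop]
theorem Def.and {P Q : Γ → Prop} (hP : Def P) (hQ : Def Q) : Def (fun g => P g ∧ Q g) :=
  Set.Definable.inter hP hQ

@[fun_prop]
theorem Def.not {P : Γ → Prop} (hP : Def P) : Def (fun g => ¬ P g) := Set.Definable.compl hP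

@[fun_prop]
theorem Def.or {P Q : Γ → Prop} (hP : Def P) (hQ : Def Q) : Def (fun g => P g ∨ Q g) :=
  Set.Definable.union hP hQ

@[fun_prop]
theorem Def.imp {P Q : Γ → Prop} (hP : Def P) (hQ : Def Q) : Def (fun g => P g → Q g) :=
  (hP.not.or hQ).congr fun _ => imp_iff_not_or

@[fun_prop]
theorem Def.iff {P Q : Γ → Prop} (hP : Def P) (hQ : Def Q) : Def (fun g => P g ↔ Q g) :=
  ((hP.imp hQ).and (hQ.imp hP)).congr fun _ => iff_iff_implies_and_implies

@[fun_prop]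
theorem Def.exists {P : Γ → Δ → Prop} (hP : Def (fun p : Γ × Δ => P p.1 p.2)) :
    Def (fun g => ∃ d, P g d) := by
  have := (inferInstance : Ctx M Γ).finite
  have := (inferInstance : Ctx M (Γ × Δ)).finite
  unfold Def at hP ⊢
  convert Set.Definable.image_comp hP (Sum.inl : Ctx.ι Γ → _) using 1
  ext v
  constructor
  · rintro ⟨d, hd⟩
    refine ⟨Sum.elim v (Ctx.equiv d), ?_, by ext; rfl⟩
    have : (Ctx.equiv (M := M) (Γ := Γ × Δ)).symm (Sum.elim v (Ctx.equiv d))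
        = (Ctx.equiv.symm v, d) := by
      rw [Equiv.symm_apply_eq]
      ext i
      rcases i with i | i <;> simp [Ctx.equiv, Equiv.sumArrowEquivProdArrow]
    simpa only [Set.mem_ofPred_eq, this] using hd
  · rintro ⟨w, hw, rfl⟩
    exact ⟨_, hw⟩

@[fun_prop]
theorem Def.forall {P : Γ → Δ → Prop} (hP : Def (fun p : Γ × Δ => P p.1 p.2)) :
    Def (fun g => ∀ d, P g d) :=
  (Def.not (Def.exists (P := fun g d => ¬ P g d) hP.not)).congr fun _ => by simp

/-- Reindexing of the coordinates preserves definability. -/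
theorem Def.reindex {P : Δ → Prop} (hP : Def P) (t : Γ → Δ) (r : Ctx.ι Δ → Ctx.ι Γ)
    (h : ∀ g i, Ctx.equiv (t g) i = Ctx.equiv g (r i)) : Def (fun g => P (t g)) := by
  unfold Def at hP ⊢
  convert Set.Definable.preimage_comp r hP using 1
  ext v
  simp only [Set.mem_ofPred_eq, Set.mem_preimage]
  rw [show t (Ctx.equiv.symm v) = Ctx.equiv.symm (v ∘ r) from ?_]
  rw [Equiv.eq_symm_apply]
  ext i
  simp [h]

theorem Def.snd {P : Δ → Prop} (hP : Def P) : Def (fun p : Γ × Δ => P p.2) :=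
  hP.reindex _ Sum.inr fun _ _ => rfl

theorem Def.coord_eq (i j : Ctx.ι Γ) : Def (fun g : Γ => Ctx.equiv g i = Ctx.equiv g j) := by
  unfold Def
  refine ⟨(FirstOrder.Language.Term.var i).equal (FirstOrder.Language.Term.var j), ?_⟩
  ext v
  simp [FirstOrder.Language.Formula.realize_equal]

theorem Def.coord_eq_const (i : Ctx.ι Γ) (c : M) : Def (fun g : Γ => Ctx.equiv g i = c) := by
  unfold Def
  refine ⟨(FirstOrder.Language.Term.var i).equal
    (FirstOrder.Language.Constants.term (setLang.con (⟨c, trivial⟩ : (Set.univ : Set M)))), ?_⟩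
  ext v
  simp [FirstOrder.Language.Formula.realize_equal]

theorem Def.coord_mem (i j : Ctx.ι Γ) : Def (fun g : Γ => Ctx.equiv g i ∈ᴹ Ctx.equiv g j) := by
  suffices h : (∅ : Set M).Definable setLang {v : Ctx.ι Γ → M | v i ∈ᴹ v j} by
    unfold Def
    simpa only [Equiv.apply_symm_apply] using h.mono (Set.subset_univ _)
  have key (R : setLang.Relations 2) (v : Ctx.ι Γ → M) :
      FirstOrder.Language.Structure.RelMap R ![v i, v j] ↔ (R.formula₂
        (FirstOrder.Language.Term.var i) (FirstOrder.Language.Term.var j)).Realize v := by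
    rw [FirstOrder.Language.Formula.realize_rel₂]
    rfl
  rw [Set.empty_definable_iff]
  refine ⟨FirstOrder.Language.Relations.formula₂ (L := setLang) SetRel.mem
    (FirstOrder.Language.Term.var i) (FirstOrder.Language.Term.var j), ?_⟩
  ext v
  exact key SetRel.mem v

theorem Def.all_finite {ι : Type*} [Finite ι] {P : ι → Γ → Prop} (h : ∀ i, Def (P i)) :
    Def (fun g => ∀ i, P i g) := by
  unfold Def at h ⊢
  convert Set.definable_iInter_of_finite h using 1
  ext v; simp

theorem Def.eq_vars : Def (fun p : Γ × Γ => p.1 = p.2) := by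
  have := (inferInstance : Ctx M Γ).finite
  refine (Def.all_finite (ι := Ctx.ι Γ) fun i =>
    Def.coord_eq (Γ := Γ × Γ) (Sum.inl i) (Sum.inr i)).congr fun p => ?_
  rw [← (Ctx.equiv (Γ := Γ)).injective.eq_iff, funext_iff]
  rfl

theorem Def.eq_const (c : Γ) : Def (fun p : Γ => p = c) := by
  have := (inferInstance : Ctx M Γ).finite
  refine (Def.all_finite (ι := Ctx.ι Γ) fun i =>
    Def.coord_eq_const i (Ctx.equiv c i)).congr fun p => ?_
  rw [← (Ctx.equiv (Γ := Γ)).injective.eq_iff, funext_iff]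

@[fun_prop]
theorem DefF.id : DefF (fun g : Γ => g) :=
  Def.eq_vars.congr fun _ => eq_comm

@[fun_prop]
theorem DefF.const (d : Δ) : DefF (fun _ : Γ => d) :=
  (Def.eq_const d).snd

@[fun_prop]
theorem Def.comp {P : Δ → Prop} {t : Γ → Δ} (hP : Def P) (ht : DefF t) :
    Def (fun g => P (t g)) :=
  (Def.exists (P := fun g d => d = t g ∧ P d) (ht.and hP.snd)).congr fun g => by simp

@[fun_prop]
theorem DefF.fst : DefF (fun p : Γ × Δ => p.1) := by
  refine (Def.eq_vars (Γ := Γ)).reindex (fun p : (Γ × Δ) × Γ => (p.2, p.1.1))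
    (Sum.elim Sum.inr (fun i => Sum.inl (Sum.inl i))) ?_
  rintro g (i | i) <;> rfl

@[fun_prop]
theorem DefF.snd : DefF (fun p : Γ × Δ => p.2) := by
  refine (Def.eq_vars (Γ := Δ)).reindex (fun p : (Γ × Δ) × Δ => (p.2, p.1.2))
    (Sum.elim Sum.inr (fun i => Sum.inl (Sum.inr i))) ?_
  rintro g (i | i) <;> rfl

@[fun_prop]
theorem DefF.comp {s : Δ → E} {t : Γ → Δ} (hs : DefF s) (ht : DefF t) :
    DefF (fun g => s (t g)) := by
  have h1 : Def (fun q : (Γ × E) × Δ => q.2 = t q.1.1) :=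
    Def.reindex (Δ := Γ × Δ) ht (fun q : (Γ × E) × Δ => (q.1.1, q.2))
      (Sum.elim (fun i => Sum.inl (Sum.inl i)) Sum.inr) (by rintro g (i | i) <;> rfl)
  have h2 : Def (fun q : (Γ × E) × Δ => q.1.2 = s q.2) :=
    Def.reindex (Δ := Δ × E) hs (fun q : (Γ × E) × Δ => (q.2, q.1.2))
      (Sum.elim Sum.inr (fun i => Sum.inl (Sum.inr i))) (by rintro g (i | i) <;> rfl)
  exact (Def.exists (P := fun (p : Γ × E) d => d = t p.1 ∧ p.2 = s d) (h1.and h2)).congr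
    fun g => by simp

@[fun_prop]
theorem DefF.prodMk {s : Γ → Δ} {t : Γ → E} (hs : DefF s) (ht : DefF t) :
    DefF (fun g => (s g, t g)) := by
  have h1 : Def (fun q : Γ × (Δ × E) => q.2.1 = s q.1) :=
    Def.reindex (Δ := Γ × Δ) hs (fun q : Γ × (Δ × E) => (q.1, q.2.1))
      (Sum.elim Sum.inl (fun i => Sum.inr (Sum.inl i))) (by rintro g (i | i) <;> rfl)
  have h2 : Def (fun q : Γ × (Δ × E) => q.2.2 = t q.1) :=
    Def.reindex (Δ := Γ × E) ht (fun q : Γ × (Δ × E) => (q.1, q.2.2))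
      (Sum.elim Sum.inl (fun i => Sum.inr (Sum.inr i))) (by rintro g (i | i) <;> rfl)
  exact (h1.and h2).congr fun g => by simp [Prod.ext_iff]

@[fun_prop]
theorem Def.eq {s t : Γ → Δ} (hs : DefF s) (ht : DefF t) : Def (fun g => s g = t g) :=
  Def.comp (P := fun p : Δ × Δ => p.1 = p.2) Def.eq_vars (hs.prodMk ht)

@[fun_prop]
theorem Def.ne {s t : Γ → Δ} (hs : DefF s) (ht : DefF t) : Def (fun g => s g ≠ t g) :=
  (Def.eq hs ht).not

@[fun_prop]
theorem Def.mem {s t : Γ → M} (hs : DefF s) (ht : DefF t) : Def (fun g => s g ∈ᴹ t g) :=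
  Def.comp (P := fun p : M × M => p.1 ∈ᴹ p.2)
    (Def.coord_mem (Γ := M × M) (Sum.inl ()) (Sum.inr ())) (hs.prodMk ht)

@[fun_prop]
theorem Def.existsUnique {P : Γ → Δ → Prop} (hP : Def (fun p : Γ × Δ => P p.1 p.2)) :
    Def (fun g => ∃! d, P g d) := by
  unfold ExistsUnique
  fun_prop

/-- The graph of `t` may be described by any definable relation; in this way definability carries over
to set operations, whose values are singled out by formulas. -/
theorem DefF.of_graph {t : Γ → M} {Q : Γ → M → Prop} (hQ : Def (fun p : Γ × M => Q p.1 p.2))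
    (h : ∀ g y, y = t g ↔ Q g y) : DefF t :=
  hQ.congr fun p => h p.1 p.2

theorem definable₁_of_def {P : M → Prop} (h : Def P) :
    (Set.univ : Set M).Definable₁ setLang {x | P x} := by
  unfold Set.Definable₁
  convert Set.Definable.preimage_comp (fun _ : Unit => (0 : Fin 1)) h using 1
  ext; rfl

theorem definable₂_of_def {P : M × M → Prop} (h : Def P) :
    (Set.univ : Set M).Definable₂ setLang {x | P x} := by
  unfold Set.Definable₂
  convert Set.Definable.preimage_comp
    (Sum.elim (fun _ : Unit => (0 : Fin 2)) (fun _ : Unit => (1 : Fin 2))) h using 1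
  ext; rfl

end Definability

/-! ### Set operations -/

section SetOperations

variable {M : Type u} [setLang.Structure M] {Γ : Type u} [Ctx M Γ]

/-- `{x ∈ a | P x}`, for definable `P`; an arbitrary element of `M` if that set does not exist. -/
noncomputable def sep (a : M) (P : M → Prop) : M :=
  haveI : Nonempty M := ⟨a⟩
  Classical.epsilon fun b => ∀ z, z ∈ᴹ b ↔ z ∈ᴹ a ∧ P z

/-- `{t x | x ∈ a}`, for definable `t`; an arbitrary element of `M` if that set does not exist. -/
noncomputable def image (a : M) (t : M → M) : M :=
  haveI : Nonempty M := ⟨a⟩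
  Classical.epsilon fun b => ∀ y, y ∈ᴹ b ↔ ∃ x, x ∈ᴹ a ∧ y = t x

/-- `{x, y}` -/
noncomputable def upair (x y : M) : M :=
  haveI : Nonempty M := ⟨x⟩
  Classical.epsilon fun p => IsUPair p x y

/-- `⋃ s` -/
noncomputable def sUnion (s : M) : M :=
  haveI : Nonempty M := ⟨s⟩
  Classical.epsilon fun p => IsUnion p s

/-- the power set of `x` -/
noncomputable def pow (x : M) : M :=
  haveI : Nonempty M := ⟨x⟩
  Classical.epsilon fun p => IsPow p x

/-- `⟨x, y⟩` -/
noncomputable def pair (x y : M) : M := upair (upair x x) (upair x y)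

/-- `x ∪ y` -/
noncomputable def cup (x y : M) : M := sUnion (upair x y)

/-- `x ∩ y` -/
noncomputable def inter (x y : M) : M := sep x (fun z => z ∈ᴹ y)

/-- `x \ y` -/
noncomputable def diff (x y : M) : M := sep x (fun z => ¬ z ∈ᴹ y)

/-- `x ∪ {x}` -/
noncomputable def succ (x : M) : M := cup x (upair x x)

/-- `a × b` -/
noncomputable def prod (a b : M) : M :=
  sep (pow (pow (cup a b))) (fun p => ∃ x y, x ∈ᴹ a ∧ y ∈ᴹ b ∧ p = pair x y)

/-- `f(x)`, written as `⋃ {y | ⟨x, y⟩ ∈ f}`, which makes sense for all `f` and `x`. -/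
noncomputable def app (f x : M) : M :=
  sUnion (sep (sUnion (sUnion f)) (fun y => pair x y ∈ᴹ f))

/-- The function `x ↦ t x` on `a`, for definable `t`. -/
noncomputable def lam (a : M) (t : M → M) : M := image a (fun x => pair x (t x))

/-- The set of all functions from `a` to `b`. -/
noncomputable def funs (a b : M) : M := sep (pow (prod a b)) (fun f => IsFun f a b)

@[fun_prop] theorem Def.sub {x y : Γ → M} (hx : DefF x) (hy : DefF y) :
    Def (fun g => Sub (x g) (y g)) := by unfold Sub; fun_prop

/-- The unique `x ∈ a` with `P x`, for definable `P`. -/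
noncomputable def the (a : M) (P : M → Prop) : M := sUnion (sep a P)

variable [hM : Fact (IsZFModel M)]

theorem ext {x y : M} (h : ∀ z, z ∈ᴹ x ↔ z ∈ᴹ y) : x = y := hM.out.extensionality x y h

theorem mem_sep {P : M → Prop} (hP : Def P) {a z : M} : z ∈ᴹ sep a P ↔ z ∈ᴹ a ∧ P z :=
  Classical.epsilon_spec (hM.out.separation {x | P x} (definable₁_of_def hP) a) z

theorem mem_image {t : M → M} (ht : DefF t) {a y : M} :
    y ∈ᴹ image a t ↔ ∃ x, x ∈ᴹ a ∧ y = t x :=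
  Classical.epsilon_spec (p := fun b => ∀ y, y ∈ᴹ b ↔ ∃ x, x ∈ᴹ a ∧ y = t x)
    (hM.out.replacement {p | p.2 = t p.1} (definable₂_of_def (by fun_prop)) a
      (by rintro x - y y' (rfl : y = t x) (rfl : y' = t x); rfl)) y

@[simp] theorem mem_upair {x y z : M} : z ∈ᴹ upair x y ↔ z = x ∨ z = y :=
  Classical.epsilon_spec (hM.out.pairing x y) z

@[simp] theorem mem_sUnion {s z : M} : z ∈ᴹ sUnion s ↔ ∃ y, y ∈ᴹ s ∧ z ∈ᴹ y :=
  Classical.epsilon_spec (hM.out.union s) z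

@[simp] theorem mem_pow {x z : M} : z ∈ᴹ pow x ↔ Sub z x :=
  Classical.epsilon_spec (hM.out.powerset x) z

@[simp] theorem mem_cup {x y z : M} : z ∈ᴹ cup x y ↔ z ∈ᴹ x ∨ z ∈ᴹ y := by simp [cup]

@[simp] theorem mem_inter {x y z : M} : z ∈ᴹ inter x y ↔ z ∈ᴹ x ∧ z ∈ᴹ y :=
  mem_sep (by fun_prop)

@[simp] theorem mem_diff {x y z : M} : z ∈ᴹ diff x y ↔ z ∈ᴹ x ∧ ¬ z ∈ᴹ y :=
  mem_sep (by fun_prop)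

@[simp] theorem mem_succ {x z : M} : z ∈ᴹ succ x ↔ z ∈ᴹ x ∨ z = x := by simp [succ]

@[fun_prop] theorem DefF.sep {a : Γ → M} {P : Γ → M → Prop} (ha : DefF a)
    (hP : Def (fun p : Γ × M => P p.1 p.2)) : DefF (fun g => sep (a g) (fun x => P g x)) := by
  refine .of_graph (Q := fun g y => ∀ z, z ∈ᴹ y ↔ z ∈ᴹ a g ∧ P g z) (by fun_prop) fun g y => ?_
  have : Def (P g) := Def.comp (P := fun p : Γ × M => P p.1 p.2) (t := fun x => (g, x)) hP
    (by fun_prop)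
  constructor
  · rintro rfl z; exact mem_sep this
  · intro h; apply ext; intro z; rw [h, mem_sep this]

@[fun_prop] theorem DefF.image {a : Γ → M} {t : Γ → M → M} (ha : DefF a)
    (ht : DefF (fun p : Γ × M => t p.1 p.2)) : DefF (fun g => image (a g) (fun x => t g x)) := by
  refine .of_graph (Q := fun g y => ∀ z, z ∈ᴹ y ↔ ∃ x, x ∈ᴹ a g ∧ z = t g x)
    (by fun_prop) fun g y => ?_
  have : DefF (t g) := DefF.comp (s := fun p : Γ × M => t p.1 p.2) (t := fun x => (g, x)) ht
    (by fun_prop)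
  constructor
  · rintro rfl z; exact mem_image this
  · intro h; apply ext; intro z; rw [h, mem_image this]

@[fun_prop] theorem DefF.upair {x y : Γ → M} (hx : DefF x) (hy : DefF y) :
    DefF (fun g => upair (x g) (y g)) := by
  refine .of_graph (Q := fun g p => ∀ z, z ∈ᴹ p ↔ z = x g ∨ z = y g) (by fun_prop) fun g p => ?_
  exact ⟨by rintro rfl z; simp, fun h => ext fun z => by simp [h]⟩

@[fun_prop] theorem DefF.sUnion {s : Γ → M} (hs : DefF s) : DefF (fun g => sUnion (s g)) := by
  refine .of_graph (Q := fun g p => ∀ z, z ∈ᴹ p ↔ ∃ y, y ∈ᴹ s g ∧ z ∈ᴹ y) (by fun_prop)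
    fun g p => ?_
  exact ⟨by rintro rfl z; simp, fun h => ext fun z => by simp [h]⟩

@[fun_prop] theorem DefF.pow {s : Γ → M} (hs : DefF s) : DefF (fun g => pow (s g)) := by
  refine .of_graph (Q := fun g p => ∀ z, z ∈ᴹ p ↔ Sub z (s g)) (by fun_prop) fun g p => ?_
  exact ⟨by rintro rfl z; simp, fun h => ext fun z => by simp [h]⟩

@[fun_prop] theorem DefF.pair {x y : Γ → M} (hx : DefF x) (hy : DefF y) :
    DefF (fun g => pair (x g) (y g)) := by unfold InternalZF.pair; fun_prop

@[fun_prop] theorem DefF.cup {x y : Γ → M} (hx : DefF x) (hy : DefF y) :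
    DefF (fun g => cup (x g) (y g)) := by unfold InternalZF.cup; fun_prop

@[fun_prop] theorem DefF.inter {x y : Γ → M} (hx : DefF x) (hy : DefF y) :
    DefF (fun g => inter (x g) (y g)) := by unfold InternalZF.inter; fun_prop

@[fun_prop] theorem DefF.succ {x : Γ → M} (hx : DefF x) : DefF (fun g => succ (x g)) := by
  unfold InternalZF.succ; fun_prop

@[fun_prop] theorem DefF.prod {x y : Γ → M} (hx : DefF x) (hy : DefF y) :
    DefF (fun g => prod (x g) (y g)) := by unfold InternalZF.prod; fun_prop

@[fun_prop] theorem DefF.app {x y : Γ → M} (hx : DefF x) (hy : DefF y) :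
    DefF (fun g => app (x g) (y g)) := by unfold InternalZF.app; fun_prop

@[fun_prop] theorem DefF.lam {a : Γ → M} {t : Γ → M → M} (ha : DefF a)
    (ht : DefF (fun p : Γ × M => t p.1 p.2)) : DefF (fun g => lam (a g) (fun x => t g x)) := by
  unfold InternalZF.lam; fun_prop

@[fun_prop] theorem DefF.the {a : Γ → M} {P : Γ → M → Prop} (ha : DefF a)
    (hP : Def (fun p : Γ × M => P p.1 p.2)) : DefF (fun g => the (a g) (fun x => P g x)) := by
  unfold InternalZF.the; fun_prop

theorem the_eq {P : M → Prop} (hP : Def P) {a x : M} (hx : x ∈ᴹ a) (hPx : P x)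
    (hu : ∀ y, y ∈ᴹ a → P y → y = x) : the a P = x := by
  refine ext fun z => ?_
  simp only [the, mem_sUnion, mem_sep hP]
  constructor
  · rintro ⟨y, ⟨hy, hPy⟩, hz⟩; rwa [← hu y hy hPy]
  · intro hz; exact ⟨x, ⟨hx, hPx⟩, hz⟩

theorem isUPair_iff {p x y : M} : IsUPair p x y ↔ p = upair x y :=
  ⟨fun h => ext fun z => by simp [h z], by rintro rfl z; simp⟩

theorem isOPair_iff {p x y : M} : IsOPair p x y ↔ p = pair x y := by
  simp [IsOPair, isUPair_iff, pair]

theorem isUnion_iff {u s : M} : IsUnion u s ↔ u = sUnion s :=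
  ⟨fun h => ext fun z => by simp [h z], by rintro rfl z; simp⟩

theorem isInter_iff {i x y : M} : IsInter i x y ↔ i = inter x y :=
  ⟨fun h => ext fun z => by simp [h z], by rintro rfl z; simp⟩

theorem isDiff_iff {i x y : M} : IsDiff i x y ↔ i = diff x y :=
  ⟨fun h => ext fun z => by simp [h z], by rintro rfl z; simp⟩

theorem isPow_iff {y x : M} : IsPow y x ↔ y = pow x :=
  ⟨fun h => ext fun z => by simp [h z], by rintro rfl z; simp⟩

theorem isSucc_iff {y x : M} : IsSucc y x ↔ y = succ x :=
  ⟨fun h => ext fun z => by simp [h z], by rintro rfl z; simp⟩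

theorem upair_self_inj {x y : M} : upair x x = upair y y ↔ x = y :=
  ⟨fun h => by simpa using (show x ∈ᴹ upair y y by simp [← h]), by rintro rfl; rfl⟩

@[simp] theorem pair_inj {x y x' y' : M} : pair x y = pair x' y' ↔ x = x' ∧ y = y' := by
  constructor
  · intro h
    have hm : ∀ z, z ∈ᴹ pair x y ↔ z ∈ᴹ pair x' y' := fun z => by rw [h]
    simp only [pair, mem_upair] at hm
    have e1 : x = x' := by
      rcases (hm (upair x x)).1 (Or.inl rfl) with e | e
      · exact upair_self_inj.1 e
      · have : x' ∈ᴹ upair x x := by simp [e]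
        exact (by simpa using this : x' = x).symm
    subst e1
    refine ⟨rfl, ?_⟩
    have k1 : y ∈ᴹ upair x y := by simp
    have k2 : y' ∈ᴹ upair x y' := by simp
    rcases (hm (upair x y)).1 (Or.inr rfl) with e | e
    · rw [e] at k1
      rcases (hm (upair x y')).2 (Or.inr rfl) with e' | e'
      · rw [e'] at k2; simp at k1 k2; simp [k1, k2]
      · rw [e', e] at k2; simp at k1 k2; simp [k1, k2]
    · rw [e] at k1
      rcases (hm (upair x y')).2 (Or.inr rfl) with e' | e'
      · rw [e'] at k2; simp at k1 k2; rcases k1 with k1 | k1 <;> simp [k1, k2]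
      · simp at k1
        rw [e'] at k2
        simp at k2
        grind
  · rintro ⟨rfl, rfl⟩; rfl

theorem app_iff {f x y : M} : App f x y ↔ pair x y ∈ᴹ f := by
  simp [App, isOPair_iff]

theorem mem_prod {a b z : M} : z ∈ᴹ prod a b ↔ ∃ x y, x ∈ᴹ a ∧ y ∈ᴹ b ∧ z = pair x y := by
  rw [prod, mem_sep (by fun_prop), and_iff_right_iff_imp]
  rintro ⟨x, y, hx, hy, rfl⟩
  simp only [mem_pow, pair]
  intro w hw
  simp only [mem_upair, mem_pow] at hw ⊢
  intro v hv
  have hv' : v = x ∨ v = y := by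
    rcases hw with rfl | rfl
    · left; simpa using hv
    · simpa using hv
  rcases hv' with rfl | rfl <;> simp only [mem_cup, hx, hy, true_or, or_true]

@[simp] theorem pair_mem_prod {a b x y : M} : pair x y ∈ᴹ prod a b ↔ x ∈ᴹ a ∧ y ∈ᴹ b := by
  simp only [mem_prod, pair_inj]
  constructor
  · rintro ⟨x', y', h1, h2, rfl, rfl⟩; exact ⟨h1, h2⟩
  · rintro ⟨h1, h2⟩; exact ⟨x, y, h1, h2, rfl, rfl⟩

theorem isProd_iff {p a b : M} : IsProd p a b ↔ p = prod a b := by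
  refine ⟨fun h => ext fun z => ?_, ?_⟩
  · rw [h z, mem_prod]; simp [isOPair_iff]
  · rintro rfl z; rw [mem_prod]; simp [isOPair_iff]

@[fun_prop] theorem Def.app {f x y : Γ → M} (hf : DefF f) (hx : DefF x) (hy : DefF y) :
    Def (fun g => App (f g) (x g) (y g)) := by
  simp only [app_iff]; fun_prop

@[fun_prop] theorem Def.isFun {f x y : Γ → M} (hf : DefF f) (hx : DefF x) (hy : DefF y) :
    Def (fun g => IsFun (f g) (x g) (y g)) := by
  simp only [IsFun, isOPair_iff]; fun_prop

/-! ### Functions -/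

theorem IsFun.app_eq {f a b x y : M} (hf : IsFun f a b) (h : pair x y ∈ᴹ f) : app f x = y := by
  obtain ⟨x', y', hx, hy, e⟩ := hf.1 _ h
  rw [isOPair_iff, pair_inj] at e
  obtain ⟨rfl, rfl⟩ := e
  apply ext
  intro z
  simp only [app, mem_sUnion]
  constructor
  · rintro ⟨w, hw, hz⟩
    rw [mem_sep (by fun_prop)] at hw
    rwa [(hf.2 x hx).unique (app_iff.2 h) (app_iff.2 hw.2)]
  · intro hz
    refine ⟨y, (mem_sep (by fun_prop)).2 ⟨?_, h⟩, hz⟩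
    simp only [mem_sUnion]
    exact ⟨upair x y, ⟨pair x y, h, by simp [pair]⟩, by simp⟩

theorem IsFun.pair_app_mem {f a b x : M} (hf : IsFun f a b) (hx : x ∈ᴹ a) :
    pair x (app f x) ∈ᴹ f := by
  obtain ⟨y, hy, -⟩ := hf.2 x hx
  rw [app_iff] at hy
  rwa [hf.app_eq hy]

theorem IsFun.app_mem {f a b x : M} (hf : IsFun f a b) (hx : x ∈ᴹ a) : app f x ∈ᴹ b := by
  obtain ⟨x', y', hx, hy, e⟩ := hf.1 _ (hf.pair_app_mem hx)
  rw [isOPair_iff, pair_inj] at e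
  rwa [e.2]

theorem IsFun.app_iff {f a b x y : M} (hf : IsFun f a b) :
    App f x y ↔ x ∈ᴹ a ∧ y = app f x := by
  rw [InternalZF.app_iff]
  constructor
  · intro h
    obtain ⟨x', y', hx, hy, e⟩ := hf.1 _ h
    rw [isOPair_iff, pair_inj] at e
    exact ⟨by rw [e.1]; exact hx, (hf.app_eq h).symm⟩
  · rintro ⟨hx, rfl⟩; exact hf.pair_app_mem hx

theorem IsFun.ext {f g a b b' : M} (hf : IsFun f a b) (hg : IsFun g a b')
    (h : ∀ x, x ∈ᴹ a → app f x = app g x) : f = g := by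
  apply InternalZF.ext
  intro z
  constructor
  · intro hz
    obtain ⟨x, y, hx, hy, e⟩ := hf.1 _ hz
    rw [isOPair_iff] at e
    subst e
    rw [← hf.app_eq hz, h x hx]
    exact hg.pair_app_mem hx
  · intro hz
    obtain ⟨x, y, hx, hy, e⟩ := hg.1 _ hz
    rw [isOPair_iff] at e
    subst e
    rw [← hg.app_eq hz, ← h x hx]
    exact hf.pair_app_mem hx

theorem IsFun.mono {f a b b' : M} (hf : IsFun f a b) (h : ∀ x, x ∈ᴹ a → app f x ∈ᴹ b') :
    IsFun f a b' := by
  refine ⟨fun p hp => ?_, hf.2⟩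
  obtain ⟨x, y, hx, hy, e⟩ := hf.1 _ hp
  refine ⟨x, y, hx, ?_, e⟩
  rw [isOPair_iff] at e
  subst e
  rw [← hf.app_eq hp]
  exact h x hx

theorem pair_mem_lam {a x y : M} {t : M → M} (ht : DefF t) :
    pair x y ∈ᴹ lam a t ↔ x ∈ᴹ a ∧ y = t x := by
  rw [lam, mem_image (by fun_prop)]
  simp only [pair_inj]
  constructor
  · rintro ⟨x', hx, rfl, rfl⟩; exact ⟨hx, rfl⟩
  · rintro ⟨hx, rfl⟩; exact ⟨x, hx, rfl, rfl⟩

theorem isFun_lam {a b : M} {t : M → M} (ht : DefF t) (h : ∀ x, x ∈ᴹ a → t x ∈ᴹ b) :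
    IsFun (lam a t) a b := by
  constructor
  · intro p hp
    have hp' := hp
    rw [lam, mem_image (by fun_prop)] at hp'
    obtain ⟨x, hx, rfl⟩ := hp'
    exact ⟨x, t x, hx, h x hx, isOPair_iff.2 rfl⟩
  · intro x hx
    refine ⟨t x, by simp [app_iff, pair_mem_lam ht, hx], fun y hy => ?_⟩
    exact ((pair_mem_lam ht).1 (app_iff.1 hy)).2

theorem app_lam {a x : M} {t : M → M} (ht : DefF t) (hx : x ∈ᴹ a) : app (lam a t) x = t x :=
  (isFun_lam (b := image a t) ht (fun y hy => (mem_image ht).2 ⟨y, hy, rfl⟩)).app_eq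
    ((pair_mem_lam ht).2 ⟨hx, rfl⟩)

@[simp] theorem mem_funs {f a b : M} : f ∈ᴹ funs a b ↔ IsFun f a b := by
  rw [funs, mem_sep (by fun_prop), and_iff_right_iff_imp, mem_pow]
  intro hf p hp
  obtain ⟨x, y, hx, hy, e⟩ := hf.1 _ hp
  rw [isOPair_iff] at e
  subst e
  simp [hx, hy]

end SetOperations

/-! ### Natural numbers: induction and recursion -/

section Nat

variable {M : Type u} [setLang.Structure M] {Γ : Type u} [Ctx M Γ] [hM : Fact (IsZFModel M)]

theorem not_mem_self (x : M) : ¬ x ∈ᴹ x := by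
  intro h
  obtain ⟨y, hy, hy'⟩ := hM.out.foundation (upair x x) ⟨x, by simp⟩
  simp only [mem_upair, or_self] at hy hy'
  subst hy
  exact hy' y h rfl

theorem exists_isEmp : ∃ e : M, IsEmp e := by
  obtain ⟨w, ⟨e, he, -⟩, -⟩ := hM.out.infinity
  exact ⟨e, he⟩

/-- The empty set, which is also the number `0`. -/
noncomputable def zero : M := Classical.choose (exists_isEmp (M := M))

@[simp] theorem not_mem_zero (x : M) : ¬ x ∈ᴹ zero := Classical.choose_spec (exists_isEmp (M := M)) x

theorem isEmp_iff {e : M} : IsEmp e ↔ e = zero :=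
  ⟨fun h => ext fun z => by simp [h z], by rintro rfl z; simp⟩

theorem isInductive_iff {w : M} :
    IsInductive w ↔ zero ∈ᴹ w ∧ ∀ x, x ∈ᴹ w → succ x ∈ᴹ w := by
  simp [IsInductive, isEmp_iff, isSucc_iff]

theorem exists_isOmega : ∃ w : M, IsOmega w := by
  obtain ⟨w, hw⟩ := hM.out.infinity
  have hd : Def (fun x : M => ∀ v, (zero ∈ᴹ v ∧ ∀ x, x ∈ᴹ v → succ x ∈ᴹ v) → x ∈ᴹ v) := by fun_prop
  refine ⟨sep w (fun x => ∀ v, (zero ∈ᴹ v ∧ ∀ x, x ∈ᴹ v → succ x ∈ᴹ v) → x ∈ᴹ v), ?_, ?_⟩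
  · rw [isInductive_iff] at hw ⊢
    simp only [mem_sep hd]
    exact ⟨⟨hw.1, fun v hv => hv.1⟩, fun x hx => ⟨hw.2 x hx.1, fun v hv => hv.2 x (hx.2 v hv)⟩⟩
  · intro v hv x hx
    rw [mem_sep hd] at hx
    exact hx.2 v (isInductive_iff.1 hv)

/-- The set of natural numbers. -/
noncomputable def nats : M := Classical.choose (exists_isOmega (M := M))

theorem isOmega_nats : IsOmega (nats : M) := Classical.choose_spec (exists_isOmega (M := M))

theorem isOmega_iff {w : M} : IsOmega w ↔ w = nats :=
  ⟨fun h => ext fun z => ⟨h.2 _ isOmega_nats.1 z, isOmega_nats.2 _ h.1 z⟩,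
    by rintro rfl; exact isOmega_nats⟩

theorem isNat_iff {n : M} : IsNat n ↔ n ∈ᴹ nats := by simp [IsNat, isOmega_iff]

@[simp] theorem zero_mem_nats : (zero : M) ∈ᴹ nats := (isInductive_iff.1 isOmega_nats.1).1

theorem succ_mem_nats {n : M} (hn : n ∈ᴹ nats) : succ n ∈ᴹ nats :=
  (isInductive_iff.1 isOmega_nats.1).2 n hn

theorem nat_induction {P : M → Prop} (hP : Def P) (h0 : P zero)
    (hs : ∀ n, n ∈ᴹ nats → P n → P (succ n)) : ∀ n, n ∈ᴹ nats → P n := by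
  intro n hn
  refine ((mem_sep hP).1 (isOmega_nats.2 (sep nats P) ?_ n hn)).2
  rw [isInductive_iff]
  simp only [mem_sep hP]
  exact ⟨⟨zero_mem_nats, h0⟩, fun x hx => ⟨succ_mem_nats hx.1, hs x hx.1 hx.2⟩⟩

theorem mem_nats_of_mem {m n : M} (h : m ∈ᴹ n) (hn : n ∈ᴹ nats) : m ∈ᴹ nats := by
  refine nat_induction (P := fun n => ∀ m, m ∈ᴹ n → m ∈ᴹ nats) (by fun_prop) (by simp) ?_ n hn m h
  intro n hn ih m hm
  rcases mem_succ.1 hm with h | rfl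
  exacts [ih m h, hn]

theorem nat_trans {k m n : M} (hkm : k ∈ᴹ m) (hmn : m ∈ᴹ n) (hn : n ∈ᴹ nats) : k ∈ᴹ n := by
  refine nat_induction (P := fun n => ∀ m, m ∈ᴹ n → ∀ k, k ∈ᴹ m → k ∈ᴹ n) (by fun_prop) (by simp)
    ?_ n hn m hmn k hkm
  intro n hn ih m hm k hk
  rw [mem_succ] at hm ⊢
  rcases hm with h | rfl
  exacts [.inl (ih m h k hk), .inl hk]

theorem zero_eq_or_mem {n : M} (hn : n ∈ᴹ nats) : n = zero ∨ zero ∈ᴹ n := by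
  refine nat_induction (P := fun n => n = zero ∨ zero ∈ᴹ n) (by fun_prop) (by simp) ?_ n hn
  intro n hn ih
  rcases ih with rfl | h <;> simp [*]

theorem succ_eq_or_mem {m n : M} (h : m ∈ᴹ n) (hn : n ∈ᴹ nats) : succ m = n ∨ succ m ∈ᴹ n := by
  refine nat_induction (P := fun n => ∀ m, m ∈ᴹ n → succ m = n ∨ succ m ∈ᴹ n) (by fun_prop)
    (by simp) ?_ n hn m h
  intro n hn ih m hm
  rcases mem_succ.1 hm with h | rfl
  · rcases ih m h with rfl | h <;> simp [*]
  · exact .inl rfl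

theorem nat_trichotomy {m n : M} (hm : m ∈ᴹ nats) (hn : n ∈ᴹ nats) :
    m ∈ᴹ n ∨ m = n ∨ n ∈ᴹ m := by
  refine nat_induction (P := fun n => m ∈ᴹ n ∨ m = n ∨ n ∈ᴹ m) (by fun_prop) ?_ ?_ n hn
  · rcases zero_eq_or_mem hm with h | h <;> simp [h]
  · intro n hn ih
    simp only [mem_succ]
    rcases ih with h | h | h
    · exact .inl (.inl h)
    · exact .inl (.inr h)
    · rcases succ_eq_or_mem h hm with h | h
      exacts [.inr (.inl h.symm), .inr (.inr h)]

theorem succ_inj {m n : M} (hm : m ∈ᴹ nats) (h : succ m = succ n) : m = n := by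
  have h1 : m ∈ᴹ succ n := by simp [← h]
  have h2 : n ∈ᴹ succ m := by simp [h]
  rw [mem_succ] at h1 h2
  rcases h1 with h1 | h1
  · rcases h2 with h2 | h2
    · exact absurd (nat_trans h1 h2 hm) (not_mem_self _)
    · exact h2.symm
  · exact h1

@[simp] theorem succ_ne_zero (n : M) : succ n ≠ zero := fun h => by
  have : n ∈ᴹ (zero : M) := by simp [← h]
  simp at this

theorem nat_cases {n : M} (hn : n ∈ᴹ nats) : n = zero ∨ ∃ m, m ∈ᴹ nats ∧ n = succ m := by
  refine nat_induction (P := fun n => n = zero ∨ ∃ m, m ∈ᴹ nats ∧ n = succ m) (by fun_prop)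
    (.inl rfl) (fun n hn _ => .inr ⟨n, hn, rfl⟩) n hn

theorem exists_least {P : M → Prop} (hP : Def P) {n : M} (hn : n ∈ᴹ nats) (h : P n) :
    ∃ m, m ∈ᴹ nats ∧ P m ∧ ∀ k, k ∈ᴹ m → ¬ P k := by
  obtain ⟨m, hm, hm'⟩ := hM.out.foundation (sep nats P) ⟨n, (mem_sep hP).2 ⟨hn, h⟩⟩
  rw [mem_sep hP] at hm
  refine ⟨m, hm.1, hm.2, fun k hk hPk => hm' k hk ((mem_sep hP).2 ⟨mem_nats_of_mem hk hm.1, hPk⟩)⟩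

/-- The sequence in `X` with `f(0) = x₀` and `f(n + 1) = G n (f(n))`, as the least set of pairs that
contains `⟨0, x₀⟩` and is closed under `⟨n, x⟩ ↦ ⟨n + 1, G n x⟩`. -/
noncomputable def natRec (X x₀ : M) (G : M → M → M) : M :=
  sep (prod nats X) fun p => ∀ s, (pair zero x₀ ∈ᴹ s ∧ ∀ n x, n ∈ᴹ nats → x ∈ᴹ X →
    pair n x ∈ᴹ s → pair (succ n) (G n x) ∈ᴹ s) → p ∈ᴹ s

@[fun_prop] theorem DefF.natRec {X x₀ : Γ → M} {G : Γ → M → M → M} (hX : DefF X) (hx₀ : DefF x₀)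
    (hG : DefF (fun p : (Γ × M) × M => G p.1.1 p.1.2 p.2)) :
    DefF (fun g => natRec (X g) (x₀ g) (fun n x => G g n x)) := by
  obtain ⟨G', rfl⟩ : ∃ G' : (Γ × M) × M → M, G = fun g n x => G' ((g, n), x) :=
    ⟨fun p => G p.1.1 p.1.2 p.2, rfl⟩
  replace hG : DefF G' := hG
  unfold InternalZF.natRec
  fun_prop

theorem natRec_spec {X x₀ : M} {G : M → M → M} (hG : DefF (fun p : M × M => G p.1 p.2))
    (h0 : x₀ ∈ᴹ X) (hs : ∀ n x, n ∈ᴹ nats → x ∈ᴹ X → G n x ∈ᴹ X) :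
    IsFun (natRec X x₀ G) nats X ∧ app (natRec X x₀ G) zero = x₀ ∧
      ∀ n, n ∈ᴹ nats → app (natRec X x₀ G) (succ n) = G n (app (natRec X x₀ G) n) := by
  have hd : Def (fun p : M => ∀ s, (pair zero x₀ ∈ᴹ s ∧ ∀ n x, n ∈ᴹ nats → x ∈ᴹ X →
    pair n x ∈ᴹ s → pair (succ n) (G n x) ∈ᴹ s) → p ∈ᴹ s) := by fun_prop
  set f := natRec X x₀ G with hf
  have hmem : ∀ p, p ∈ᴹ f ↔ _ := fun p => mem_sep hd
  have f0 : pair zero x₀ ∈ᴹ f := (hmem _).2 ⟨by simp [h0], fun s hs => hs.1⟩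
  have fs : ∀ n x, n ∈ᴹ nats → x ∈ᴹ X → pair n x ∈ᴹ f → pair (succ n) (G n x) ∈ᴹ f := by
    intro n x hn hx h
    rw [hmem] at h ⊢
    exact ⟨by simp [succ_mem_nats hn, hs n x hn hx], fun s hs => hs.2 n x hn hx (h.2 s hs)⟩
  have hprod : ∀ p, p ∈ᴹ f → ∃ n x, n ∈ᴹ nats ∧ x ∈ᴹ X ∧ p = pair n x := fun p hp =>
    mem_prod.1 ((hmem p).1 hp).1
  have hX : ∀ n x, pair n x ∈ᴹ f → x ∈ᴹ X := fun n x h => by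
    have := ((hmem _).1 h).1
    rw [pair_mem_prod] at this
    exact this.2
  have u0 : ∀ y, pair zero y ∈ᴹ f → y = x₀ := by
    intro y hy
    by_contra hne
    have hd' : Def (fun p : M => p ≠ pair zero y) := by fun_prop
    refine ((mem_sep hd').1 (((hmem _).1 hy).2 (sep f (fun p => p ≠ pair zero y)) ⟨?_, ?_⟩)).2 rfl
    · rw [mem_sep hd']; exact ⟨f0, by simp [Ne.symm hne]⟩
    · intro n x hn hx h
      rw [mem_sep hd'] at h ⊢
      exact ⟨fs n x hn hx h.1, by simp⟩
  have us : ∀ n, n ∈ᴹ nats → ∀ y, pair (succ n) y ∈ᴹ f → ∃ x, pair n x ∈ᴹ f ∧ y = G n x := by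
    intro n hn y hy
    by_contra hne
    have hd' : Def (fun p : M => p ≠ pair (succ n) y) := by fun_prop
    refine ((mem_sep hd').1 (((hmem _).1 hy).2 (sep f (fun p => p ≠ pair (succ n) y)) ⟨?_, ?_⟩)).2 rfl
    · rw [mem_sep hd']; exact ⟨f0, by simp [(succ_ne_zero n).symm]⟩
    · intro m x hm hx h
      rw [mem_sep hd'] at h ⊢
      refine ⟨fs m x hm hx h.1, fun e => ?_⟩
      rw [pair_inj] at e
      obtain rfl := succ_inj hm e.1
      exact hne ⟨x, h.1, e.2.symm⟩
  have ex : ∀ n, n ∈ᴹ nats → ∃! y, pair n y ∈ᴹ f := by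
    refine nat_induction (P := fun n => ∃! y, pair n y ∈ᴹ f) (by fun_prop) ⟨x₀, f0, u0⟩ ?_
    rintro n hn ⟨x, hx, hu⟩
    refine ⟨G n x, fs n x hn (hX _ _ hx) hx, fun y hy => ?_⟩
    obtain ⟨x', hx', rfl⟩ := us n hn y hy
    rw [hu x' hx']
  have hfun : IsFun f nats X := by
    refine ⟨fun p hp => ?_, fun n hn => by simpa only [app_iff] using ex n hn⟩
    obtain ⟨n, x, hn, hx, e⟩ := hprod p hp
    exact ⟨n, x, hn, hx, isOPair_iff.2 e⟩
  exact ⟨hfun, hfun.app_eq f0, fun n hn =>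
    hfun.app_eq (fs n _ hn (hfun.app_mem hn) (hfun.pair_app_mem hn))⟩

end Nat

/-! ### Arithmetic -/

section Arithmetic

variable {M : Type u} [setLang.Structure M] {Γ : Type u} [Ctx M Γ] [hM : Fact (IsZFModel M)]

/-- addition of natural numbers -/
noncomputable def add (m n : M) : M := app (natRec nats m fun _ x => succ x) n

/-- multiplication of natural numbers -/
noncomputable def mul (m n : M) : M := app (natRec nats zero fun _ x => add x m) n

@[fun_prop] theorem DefF.add {x y : Γ → M} (hx : DefF x) (hy : DefF y) :
    DefF (fun g => add (x g) (y g)) := by unfold InternalZF.add; fun_prop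

@[fun_prop] theorem DefF.mul {x y : Γ → M} (hx : DefF x) (hy : DefF y) :
    DefF (fun g => mul (x g) (y g)) := by unfold InternalZF.mul; fun_prop

theorem add_spec {m : M} (hm : m ∈ᴹ nats) :
    IsFun (natRec nats m fun _ x => succ x) nats nats ∧ add m zero = m ∧
      ∀ n, n ∈ᴹ nats → add m (succ n) = succ (add m n) :=
  natRec_spec (by fun_prop) hm (fun _ x _ hx => succ_mem_nats hx)

theorem add_mem {m n : M} (hm : m ∈ᴹ nats) (hn : n ∈ᴹ nats) : add m n ∈ᴹ nats :=
  (add_spec hm).1.app_mem hn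

theorem mul_spec {m : M} (hm : m ∈ᴹ nats) :
    IsFun (natRec nats zero fun _ x => add x m) nats nats ∧ mul m zero = zero ∧
      ∀ n, n ∈ᴹ nats → mul m (succ n) = add (mul m n) m :=
  natRec_spec (by fun_prop) zero_mem_nats (fun _ x _ hx => add_mem hx hm)

theorem mul_mem {m n : M} (hm : m ∈ᴹ nats) (hn : n ∈ᴹ nats) : mul m n ∈ᴹ nats :=
  (mul_spec hm).1.app_mem hn

variable (M) in
/-- The natural numbers of `M` as a type; they form an ordered semiring, but possibly a non-standard
one. -/
structure N : Type u where
  /-- the element of `M` -/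
  val : M
  mem : val ∈ᴹ nats

namespace N

instance : CoeOut (N M) M := ⟨N.val⟩

protected theorem ext {m n : N M} (h : m.1 = n.1) : m = n := by
  cases m; cases n; congr

theorem coe_inj {m n : N M} : m.1 = n.1 ↔ m = n :=
  ⟨N.ext, congrArg _⟩

noncomputable instance : Zero (N M) := ⟨⟨zero, zero_mem_nats⟩⟩
noncomputable instance : One (N M) := ⟨⟨succ zero, succ_mem_nats zero_mem_nats⟩⟩
noncomputable instance : Add (N M) := ⟨fun m n => ⟨add m n, add_mem m.2 n.2⟩⟩
noncomputable instance : Mul (N M) := ⟨fun m n => ⟨mul m n, mul_mem m.2 n.2⟩⟩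

theorem coe_zero : (0 : N M).1 = zero := rfl
theorem coe_one : (1 : N M).1 = succ zero := rfl
theorem coe_add (m n : N M) : (m + n).1 = add m.1 n.1 := rfl
theorem coe_mul (m n : N M) : (m * n).1 = mul m.1 n.1 := rfl

/-- Induction for definable properties of natural numbers. -/
theorem induction {P : N M → Prop} (Q : M → Prop) (hQ : Def Q) (hPQ : ∀ n : N M, Q n ↔ P n)
    (h0 : P 0) (hs : ∀ n, P n → P (n + 1)) (n : N M) : P n := by
  rw [← hPQ]
  refine nat_induction hQ ((hPQ 0).2 h0) (fun n hn h => ?_) n n.2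
  have := (hPQ _).2 (hs ⟨n, hn⟩ ((hPQ ⟨n, hn⟩).1 h))
  rwa [coe_add, coe_one, (add_spec hn).2.2 _ zero_mem_nats, (add_spec hn).2.1] at this

theorem coe_succ (n : N M) : (n + 1).1 = succ n.1 := by
  rw [coe_add, coe_one, (add_spec n.2).2.2 _ zero_mem_nats, (add_spec n.2).2.1]

protected theorem add_zero (m : N M) : m + 0 = m := N.ext (add_spec m.2).2.1

protected theorem add_succ (m n : N M) : m + (n + 1) = m + n + 1 :=
  N.ext (by rw [coe_succ, coe_add, coe_succ, (add_spec m.2).2.2 _ n.2, coe_add])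

protected theorem mul_zero (m : N M) : m * 0 = 0 := N.ext (mul_spec m.2).2.1

protected theorem mul_succ (m n : N M) : m * (n + 1) = m * n + m :=
  N.ext (by rw [coe_mul, coe_succ, (mul_spec m.2).2.2 _ n.2, coe_add, coe_mul])

protected theorem zero_add (n : N M) : 0 + n = n := by
  refine induction (P := fun n => 0 + n = n) (fun n : M => add zero n = n) (by fun_prop)
    (fun n => by rw [← coe_inj]; rfl) ?_ ?_ n
  · exact N.add_zero 0
  · intro n ih; rw [N.add_succ, ih]

protected theorem add_assoc (k m n : N M) : k + m + n = k + (m + n) := by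
  refine induction (P := fun n => k + m + n = k + (m + n))
    (fun n : M => add (add k.1 m.1) n = add k.1 (add m.1 n)) (by fun_prop)
    (fun n => by rw [← coe_inj]; rfl) ?_ ?_ n
  · simp only [N.add_zero]
  · intro n ih; rw [N.add_succ, ih, N.add_succ, N.add_succ]

protected theorem succ_add (m n : N M) : m + 1 + n = m + n + 1 := by
  refine induction (P := fun n => m + 1 + n = m + n + 1)
    (fun n : M => add (add m.1 (succ zero)) n = add (add m.1 n) (succ zero)) (by fun_prop)
    (fun n => by rw [← coe_inj]; rfl) ?_ ?_ n
  · simp only [N.add_zero]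
  · intro n ih; rw [N.add_succ, ih, N.add_succ]

protected theorem add_comm (m n : N M) : m + n = n + m := by
  refine induction (P := fun n => m + n = n + m)
    (fun n : M => add m.1 n = add n m.1) (by fun_prop)
    (fun n => by rw [← coe_inj]; rfl) ?_ ?_ n
  · rw [N.add_zero, N.zero_add]
  · intro n ih; rw [N.add_succ, ih, N.succ_add]

protected theorem zero_mul (n : N M) : 0 * n = 0 := by
  refine induction (P := fun n => 0 * n = 0) (fun n : M => mul zero n = zero) (by fun_prop)
    (fun n => by rw [← coe_inj]; rfl) ?_ ?_ n
  · exact N.mul_zero 0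
  · intro n ih; rw [N.mul_succ, ih, N.add_zero]

protected theorem succ_mul (m n : N M) : (m + 1) * n = m * n + n := by
  refine induction (P := fun n => (m + 1) * n = m * n + n)
    (fun n : M => mul (add m.1 (succ zero)) n = add (mul m.1 n) n) (by fun_prop)
    (fun n => by rw [← coe_inj]; rfl) ?_ ?_ n
  · simp only [N.mul_zero, N.add_zero]
  · intro n ih
    rw [N.mul_succ, ih, N.mul_succ, N.add_succ, N.add_succ, N.add_assoc, N.add_assoc,
      N.add_comm n, N.succ_add, N.add_succ, ← N.add_assoc]

protected theorem mul_comm (m n : N M) : m * n = n * m := by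
  refine induction (P := fun n => m * n = n * m)
    (fun n : M => mul m.1 n = mul n m.1) (by fun_prop)
    (fun n => by rw [← coe_inj]; rfl) ?_ ?_ n
  · rw [N.mul_zero, N.zero_mul]
  · intro n ih; rw [N.mul_succ, ih, N.succ_mul]

protected theorem mul_add (k m n : N M) : k * (m + n) = k * m + k * n := by
  refine induction (P := fun n => k * (m + n) = k * m + k * n)
    (fun n : M => mul k.1 (add m.1 n) = add (mul k.1 m.1) (mul k.1 n)) (by fun_prop)
    (fun n => by rw [← coe_inj]; rfl) ?_ ?_ n
  · simp only [N.add_zero, N.mul_zero]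
  · intro n ih; rw [N.add_succ, N.mul_succ, ih, N.mul_succ, N.add_assoc]

protected theorem mul_assoc (k m n : N M) : k * m * n = k * (m * n) := by
  refine induction (P := fun n => k * m * n = k * (m * n))
    (fun n : M => mul (mul k.1 m.1) n = mul k.1 (mul m.1 n)) (by fun_prop)
    (fun n => by rw [← coe_inj]; rfl) ?_ ?_ n
  · simp only [N.mul_zero]
  · intro n ih; rw [N.mul_succ, ih, N.mul_succ, N.mul_add]

protected theorem mul_one (n : N M) : n * 1 = n := by
  rw [← N.zero_add 1, N.mul_succ, N.mul_zero, N.zero_add]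

noncomputable instance : CommSemiring (N M) where
  add_assoc := N.add_assoc
  zero_add := N.zero_add
  add_zero := N.add_zero
  add_comm := N.add_comm
  mul_assoc := N.mul_assoc
  one_mul n := by rw [N.mul_comm, N.mul_one]
  mul_one := N.mul_one
  left_distrib := N.mul_add
  right_distrib k m n := by rw [N.mul_comm, N.mul_add, N.mul_comm n k, N.mul_comm n m]
  zero_mul := N.zero_mul
  mul_zero := N.mul_zero
  mul_comm := N.mul_comm
  nsmul := nsmulRec

noncomputable instance : LinearOrder (N M) where
  le m n := (m : M) ∈ᴹ n ∨ m = n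
  lt m n := (m : M) ∈ᴹ n
  le_refl _ := .inr rfl
  le_trans k m n hk hm := by
    rcases hk with hk | rfl
    · rcases hm with hm | rfl
      exacts [.inl (nat_trans hk hm n.2), .inl hk]
    · exact hm
  lt_iff_le_not_ge m n := by
    constructor
    · intro h
      refine ⟨.inl h, ?_⟩
      rintro (h' | rfl)
      exacts [not_mem_self _ (nat_trans h h' m.2), not_mem_self _ h]
    · rintro ⟨h | rfl, h'⟩
      exacts [h, absurd (.inr rfl) h']
  le_antisymm m n h h' := by
    rcases h with h | h
    · rcases h' with h' | h'
      exacts [absurd (nat_trans h h' m.2) (not_mem_self _), h'.symm]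
    · exact h
  le_total m n := by
    rcases nat_trichotomy m.2 n.2 with h | h | h
    exacts [.inl (.inl h), .inl (.inr (N.ext h)), .inr (.inl h)]
  toDecidableLE := Classical.decRel _

theorem lt_iff {m n : N M} : m < n ↔ (m : M) ∈ᴹ n := Iff.rfl

theorem lt_succ_iff {m n : N M} : m < n + 1 ↔ m ≤ n := by
  rw [lt_iff, coe_succ, mem_succ, le_iff_lt_or_eq, lt_iff]
  exact or_congr_right coe_inj

protected theorem zero_le (n : N M) : 0 ≤ n := by
  rcases zero_eq_or_mem n.2 with h | h
  exacts [(N.ext h : n = 0).ge, le_of_lt (lt_iff.2 h)]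

theorem succ_le_iff {m n : N M} : m + 1 ≤ n ↔ m < n := by
  constructor
  · exact (lt_succ_iff.2 le_rfl).trans_le
  · intro h
    rcases succ_eq_or_mem (lt_iff.1 h) n.2 with h | h
    · rw [← coe_succ] at h; exact (N.ext h).le
    · rw [← coe_succ] at h; exact le_of_lt h

theorem succ_lt_succ {m n : N M} (h : m < n) : m + 1 < n + 1 :=
  lt_succ_iff.2 (succ_le_iff.2 h)

protected theorem add_lt_add_right {m n : N M} (h : m < n) (k : N M) : m + k < n + k := by
  refine induction (P := fun k => m + k < n + k) (fun k : M => add m.1 k ∈ᴹ add n.1 k) (by fun_prop)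
    (fun k => Iff.rfl) (by simpa using h) (fun k ih => ?_) k
  rw [← add_assoc, ← add_assoc]
  exact succ_lt_succ ih

theorem pos_or_zero (n : N M) : n = 0 ∨ ∃ m, n = m + 1 := by
  rcases nat_cases n.2 with h | ⟨m, hm, h⟩
  · exact .inl (N.ext h)
  · exact .inr ⟨⟨m, hm⟩, N.ext (by rw [h, coe_succ])⟩

protected theorem mul_lt_mul {m n k : N M} (h : m < n) (hk : 0 < k) : m * k < n * k := by
  obtain rfl | ⟨k, rfl⟩ := pos_or_zero k
  · exact absurd hk (lt_irrefl _)
  clear hk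
  refine induction (P := fun k => m * (k + 1) < n * (k + 1))
    (fun k : M => mul m.1 (add k (succ zero)) ∈ᴹ mul n.1 (add k (succ zero))) (by fun_prop)
    (fun k => Iff.rfl) (by simpa using h) (fun k ih => ?_) k
  rw [mul_add_one m (k + 1), mul_add_one n (k + 1)]
  calc _ < n * (k + 1) + m := N.add_lt_add_right ih m
    _ = m + n * (k + 1) := add_comm _ _
    _ < n + n * (k + 1) := N.add_lt_add_right h _
    _ = _ := add_comm _ _

instance : IsStrictOrderedRing (N M) where
  add_le_add_left a b h c := by
    rcases h.lt_or_eq with h | rfl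
    exacts [(N.add_lt_add_right h c).le, le_rfl]
  le_of_add_le_add_left a b c h := by
    by_contra h'
    rw [add_comm a, add_comm a] at h
    exact absurd (N.add_lt_add_right (not_le.1 h') a) h.not_gt
  zero_le_one := N.zero_le 1
  exists_pair_ne := ⟨0, 1, (lt_succ_iff.2 le_rfl : (0 : N M) < 0 + 1).ne.trans_eq (zero_add 1)⟩
  mul_lt_mul_of_pos_left a ha b c h := by
    rw [mul_comm a, mul_comm a]; exact N.mul_lt_mul h ha
  mul_lt_mul_of_pos_right a ha b c h := N.mul_lt_mul h ha

end N

/-- first component of an ordered pair -/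
noncomputable def fst (p : M) : M := sUnion (sep (sUnion p) fun x => ∃ y, p = pair x y)

/-- second component of an ordered pair -/
noncomputable def snd (p : M) : M := sUnion (sep (sUnion p) fun y => ∃ x, p = pair x y)

@[fun_prop] theorem DefF.fst' {x : Γ → M} (hx : DefF x) : DefF (fun g => InternalZF.fst (x g)) := by
  unfold InternalZF.fst; fun_prop

@[fun_prop] theorem DefF.snd' {x : Γ → M} (hx : DefF x) : DefF (fun g => InternalZF.snd (x g)) := by
  unfold InternalZF.snd; fun_prop

@[simp] theorem fst_pair (x y : M) : fst (pair x y) = x := by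
  refine ext fun z => ?_
  rw [fst, mem_sUnion]
  constructor
  · rintro ⟨w, hw, hz⟩
    rw [mem_sep (by fun_prop)] at hw
    obtain ⟨-, y', e⟩ := hw
    rw [pair_inj] at e
    rwa [e.1]
  · refine fun hz => ⟨x, (mem_sep (by fun_prop)).2 ⟨?_, y, rfl⟩, hz⟩
    simp [pair]

@[simp] theorem snd_pair (x y : M) : snd (pair x y) = y := by
  refine ext fun z => ?_
  rw [snd, mem_sUnion]
  constructor
  · rintro ⟨w, hw, hz⟩
    rw [mem_sep (by fun_prop)] at hw
    obtain ⟨-, y', e⟩ := hw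
    rw [pair_inj] at e
    rwa [e.2]
  · refine fun hz => ⟨y, (mem_sep (by fun_prop)).2 ⟨?_, x, rfl⟩, hz⟩
    simp only [mem_sUnion]
    exact ⟨upair x y, by simp [pair], by simp⟩

theorem IsFun.app₂_iff {f a b x y z : M} (hf : IsFun f a b) :
    App₂ f x y z ↔ pair x y ∈ᴹ a ∧ z = app f (pair x y) := by
  simp [App₂, isOPair_iff, hf.app_iff]

/-- Every definable binary operation on `ω` is given by a function that is an element of `M`. -/
theorem exists_operation {op : M → M → M} (hop : DefF (fun p : M × M => op p.1 p.2))
    (hmem : ∀ m n, m ∈ᴹ nats → n ∈ᴹ nats → op m n ∈ᴹ nats) :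
    ∃ f : M, IsFun f (prod nats nats) nats ∧
      ∀ m n, m ∈ᴹ nats → n ∈ᴹ nats → app f (pair m n) = op m n := by
  refine ⟨lam (prod nats nats) (fun p => op (fst p) (snd p)), isFun_lam (by fun_prop) ?_, ?_⟩
  · intro p hp
    obtain ⟨x, y, hx, hy, rfl⟩ := mem_prod.1 hp
    simpa using hmem x y hx hy
  · intro m n hm hn
    rw [app_lam (by fun_prop) (by simp [hm, hn])]
    simp

theorem plus_iff {m n k : M} : Plus m n k ↔ m ∈ᴹ nats ∧ n ∈ᴹ nats ∧ k = add m n := by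
  constructor
  · rintro ⟨f, ⟨w, p, hw, hp, hf, h0, hs⟩, hk⟩
    rw [isOmega_iff] at hw
    subst hw
    rw [isProd_iff] at hp
    subst hp
    simp only [hf.app₂_iff, pair_mem_prod, isEmp_iff, isSucc_iff] at h0 hs hk
    obtain ⟨⟨hm, hn⟩, rfl⟩ := hk
    refine ⟨hm, hn, ?_⟩
    refine nat_induction (P := fun n => app f (pair m n) = add m n) (by fun_prop) ?_ ?_ n hn
    · rw [(add_spec hm).2.1, ← (h0 m zero hm rfl).2]
    · intro n hn ih
      rw [← (hs m n _ _ _ hm hn rfl ⟨⟨hm, hn⟩, rfl⟩ rfl).2, ih, (add_spec hm).2.2 n hn]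
  · rintro ⟨hm, hn, rfl⟩
    obtain ⟨f, hf, hfe⟩ := exists_operation (M := M) (op := add) (by fun_prop)
      (fun _ _ => add_mem)
    refine ⟨f, ⟨nats, _, isOmega_nats, isProd_iff.2 rfl, hf, ?_, ?_⟩, ?_⟩
    · intro m e hm he
      rw [isEmp_iff] at he
      subst he
      rw [hf.app₂_iff, hfe m _ hm zero_mem_nats, (add_spec hm).2.1]
      simp [hm]
    · intro m n n' k k' hm hn hn' hk hk'
      rw [isSucc_iff] at hn' hk'
      subst hn' hk'
      rw [hf.app₂_iff] at hk ⊢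
      rw [hk.2, hfe m _ hm (succ_mem_nats hn), hfe m _ hm hn, (add_spec hm).2.2 n hn]
      simp [hm, succ_mem_nats hn]
    · rw [hf.app₂_iff, hfe m n hm hn]
      simp [hm, hn]

theorem times_iff {m n k : M} : Times m n k ↔ m ∈ᴹ nats ∧ n ∈ᴹ nats ∧ k = mul m n := by
  constructor
  · rintro ⟨f, ⟨w, p, hw, hp, hf, h0, hs⟩, hk⟩
    rw [isOmega_iff] at hw
    subst hw
    rw [isProd_iff] at hp
    subst hp
    simp only [hf.app₂_iff, pair_mem_prod, isEmp_iff, isSucc_iff, plus_iff] at h0 hs hk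
    obtain ⟨⟨hm, hn⟩, rfl⟩ := hk
    refine ⟨hm, hn, ?_⟩
    refine nat_induction (P := fun n => app f (pair m n) = mul m n) (by fun_prop) ?_ ?_ n hn
    · rw [(mul_spec hm).2.1, ← (h0 m zero hm rfl).2]
    · intro n hn ih
      rw [← (hs m n _ _ _ hm hn rfl ⟨⟨hm, hn⟩, rfl⟩
        ⟨hf.app_mem (by simp [hm, hn]), hm, rfl⟩).2, ih, (mul_spec hm).2.2 n hn]
  · rintro ⟨hm, hn, rfl⟩
    obtain ⟨f, hf, hfe⟩ := exists_operation (M := M) (op := mul) (by fun_prop)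
      (fun _ _ => mul_mem)
    refine ⟨f, ⟨nats, _, isOmega_nats, isProd_iff.2 rfl, hf, ?_, ?_⟩, ?_⟩
    · intro m e hm he
      rw [isEmp_iff] at he
      subst he
      rw [hf.app₂_iff, hfe m _ hm zero_mem_nats, (mul_spec hm).2.1]
      simp [hm]
    · intro m n n' k k' hm hn hn' hk hk'
      rw [isSucc_iff] at hn'
      subst hn'
      rw [plus_iff] at hk'
      rw [hf.app₂_iff] at hk ⊢
      rw [hk'.2.2, hk.2, hfe m _ hm (succ_mem_nats hn), hfe m _ hm hn, (mul_spec hm).2.2 n hn]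
      simp [hm, succ_mem_nats hn]
    · rw [hf.app₂_iff, hfe m n hm hn]
      simp [hm, hn]

end Arithmetic

/-! ### General topology -/

section Topology

variable {M : Type u} [setLang.Structure M]

theorem Sub.refl (x : M) : Sub x x := fun _ h => h

theorem natLe_refl (n : M) : NatLe n n := .inr rfl

/-- A criterion for families of sets defined by basic neighbourhoods: `B x i` says that the
basic set `{y | C i y}` is a neighbourhood of `x`. -/
theorem isTopology_of_nhds {X T : M} {ι : Type*} (B : M → ι → Prop) (C : ι → M → Prop)
    (hT : ∀ U, U ∈ᴹ T ↔ Sub U X ∧ ∀ x, x ∈ᴹ U → ∃ i, B x i ∧ ∀ y, y ∈ᴹ X → C i y → y ∈ᴹ U)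
    (hne : ∀ x, x ∈ᴹ X → ∃ i, B x i)
    (hdir : ∀ x i j, B x i → B x j → ∃ k, B x k ∧ ∀ y, y ∈ᴹ X → C k y → C i y ∧ C j y) :
    IsTopology X T := by
  refine ⟨fun U hU => ((hT U).1 hU).1, (hT X).2 ⟨Sub.refl X, fun x hx => ?_⟩, ?_, ?_⟩
  · obtain ⟨i, hi⟩ := hne x hx
    exact ⟨i, hi, fun y hy _ => hy⟩
  · intro F U hF hU
    rw [hT]
    constructor
    · intro x hx
      obtain ⟨V, hV, hxV⟩ := (hU x).1 hx
      exact ((hT V).1 (hF V hV)).1 x hxV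
    · intro x hx
      obtain ⟨V, hV, hxV⟩ := (hU x).1 hx
      obtain ⟨i, hi, hi'⟩ := ((hT V).1 (hF V hV)).2 x hxV
      exact ⟨i, hi, fun y hy hc => (hU y).2 ⟨V, hV, hi' y hy hc⟩⟩
  · intro U V W hU hV hW
    rw [hT] at hU hV ⊢
    refine ⟨fun x hx => hU.1 x ((hW x).1 hx).1, fun x hx => ?_⟩
    obtain ⟨i, hi, hi'⟩ := hU.2 x ((hW x).1 hx).1
    obtain ⟨j, hj, hj'⟩ := hV.2 x ((hW x).1 hx).2
    obtain ⟨k, hk, hk'⟩ := hdir x i j hi hj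
    exact ⟨k, hk, fun y hy hc =>
      (hW y).2 ⟨hi' y hy (hk' y hy hc).1, hj' y hy (hk' y hy hc).2⟩⟩

variable [hM : Fact (IsZFModel M)]

theorem Sub.antisymm {x y : M} (h : Sub x y) (h' : Sub y x) : x = y :=
  ext fun z => ⟨h z, h' z⟩

theorem isClosedIn_iff {X T A : M} : IsClosedIn X T A ↔ Sub A X ∧ diff X A ∈ᴹ T := by
  simp [IsClosedIn, isDiff_iff]

theorem convergesTo_iff {T s x A : M} (hs : IsFun s nats A) :
    ConvergesTo T s x ↔ ∀ U, U ∈ᴹ T → x ∈ᴹ U → ∃ n, n ∈ᴹ nats ∧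
      ∀ m, m ∈ᴹ nats → NatLe n m → app s m ∈ᴹ U := by
  simp only [ConvergesTo, isNat_iff, hs.app_iff]
  refine forall₃_congr fun U _ _ => exists_congr fun n => and_congr_right fun _ => ?_
  constructor
  · intro h m hm hnm; exact h m _ hm hnm ⟨hm, rfl⟩
  · rintro h m y hm hnm ⟨-, rfl⟩; exact h m hm hnm

theorem isSeqClosedIn_iff {X T A : M} : IsSeqClosedIn X T A ↔ Sub A X ∧
    ∀ s x, IsFun s nats A → x ∈ᴹ X → ConvergesTo T s x → x ∈ᴹ A := by
  simp only [IsSeqClosedIn, isOmega_iff]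
  exact and_congr_right fun _ => ⟨fun h s x => h _ s x rfl, by rintro h _ s x rfl; exact h s x⟩

theorem IsTopology.open_of_nhds {X T U : M} (hT : IsTopology X T)
    (h : ∀ x, x ∈ᴹ U → ∃ W, W ∈ᴹ T ∧ x ∈ᴹ W ∧ Sub W U) : U ∈ᴹ T := by
  have hd : Def (fun W : M => Sub W U) := by fun_prop
  refine hT.2.2.1 (sep T (fun W => Sub W U)) U (fun W hW => ((mem_sep hd).1 hW).1)
    (isUnion_iff.2 (ext fun x => ?_))
  simp only [mem_sUnion, mem_sep hd]
  constructor
  · intro hx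
    obtain ⟨W, hW, hxW, hWU⟩ := h x hx
    exact ⟨W, ⟨hW, hWU⟩, hxW⟩
  · rintro ⟨W, ⟨-, hWU⟩, hx⟩; exact hWU x hx

theorem IsTopology.inter_mem {X T U V : M} (hT : IsTopology X T) (hU : U ∈ᴹ T) (hV : V ∈ᴹ T) :
    inter U V ∈ᴹ T := hT.2.2.2 U V _ hU hV (isInter_iff.2 rfl)

theorem IsTopology.empty_mem {X T : M} (hT : IsTopology X T) : zero ∈ᴹ T :=
  hT.open_of_nhds (by simp)

theorem IsTopology.closed_of_nhds {X T A : M} (hT : IsTopology X T) (hA : Sub A X)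
    (h : ∀ x, x ∈ᴹ X → ¬ x ∈ᴹ A → ∃ W, W ∈ᴹ T ∧ x ∈ᴹ W ∧ ∀ y, y ∈ᴹ W → ¬ y ∈ᴹ A) :
    IsClosedIn X T A := by
  refine isClosedIn_iff.2 ⟨hA, hT.open_of_nhds fun x hx => ?_⟩
  rw [mem_diff] at hx
  obtain ⟨W, hW, hxW, hWA⟩ := h x hx.1 hx.2
  exact ⟨W, hW, hxW, fun y hy => mem_diff.2 ⟨hT.1 W hW y hy, hWA y hy⟩⟩

theorem IsClosedIn.isSeqClosedIn {X T A : M} (h : IsClosedIn X T A) : IsSeqClosedIn X T A := by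
  rw [isClosedIn_iff] at h
  refine isSeqClosedIn_iff.2 ⟨h.1, fun s x hs hx hc => ?_⟩
  by_contra hxA
  obtain ⟨n, hn, hn'⟩ := (convergesTo_iff hs).1 hc _ h.2 (mem_diff.2 ⟨hx, hxA⟩)
  exact (mem_diff.1 (hn' n hn (natLe_refl n))).2 (hs.app_mem hn)

theorem isSequential_iff {X T : M} : IsSequential X T ↔
    IsTopology X T ∧ ∀ A, IsSeqClosedIn X T A → IsClosedIn X T A :=
  and_congr_right fun _ => forall_congr' fun _ =>
    ⟨fun h => h.1, fun h => ⟨h, IsClosedIn.isSeqClosedIn⟩⟩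

/-- The subspace topology on `Y`. -/
noncomputable def subTop (Y T : M) : M := image T fun V => inter V Y

theorem mem_subTop {Y T U : M} : U ∈ᴹ subTop Y T ↔ ∃ V, V ∈ᴹ T ∧ U = inter V Y :=
  mem_image (by fun_prop)

theorem isSubspaceTopology_iff {S Y T : M} : IsSubspaceTopology S Y T ↔ S = subTop Y T := by
  simp only [IsSubspaceTopology, isInter_iff]
  exact ⟨fun h => ext fun U => by rw [h, mem_subTop], by rintro rfl U; exact mem_subTop⟩

theorem IsTopology.subTop {X Y T : M} (hT : IsTopology X T) (hY : Sub Y X) :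
    IsTopology Y (subTop Y T) := by
  have hd (F : M) : Def (fun V => inter V Y ∈ᴹ F) := by fun_prop
  refine ⟨fun U hU => ?_, mem_subTop.2 ⟨X, hT.2.1, ext fun z => ?_⟩, fun F U hF hU => ?_,
    fun U V W hU hV hW => ?_⟩
  · obtain ⟨V, -, rfl⟩ := mem_subTop.1 hU
    intro z hz; exact (mem_inter.1 hz).2
  · rw [mem_inter]; exact ⟨fun h => ⟨hY z h, h⟩, And.right⟩
  · rw [isUnion_iff] at hU
    refine mem_subTop.2 ⟨sUnion (sep T fun V => inter V Y ∈ᴹ F), hT.2.2.1 _ _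
      (fun V hV => ((mem_sep (hd F)).1 hV).1) (isUnion_iff.2 rfl), ext fun z => ?_⟩
    simp only [hU, mem_inter, mem_sUnion, mem_sep (hd F)]
    constructor
    · rintro ⟨V, hV, hz⟩
      obtain ⟨V', hV', rfl⟩ := mem_subTop.1 (hF V hV)
      rw [mem_inter] at hz
      exact ⟨⟨V', ⟨hV', hV⟩, hz.1⟩, hz.2⟩
    · rintro ⟨⟨V, ⟨-, hV⟩, hz⟩, hz'⟩
      exact ⟨_, hV, mem_inter.2 ⟨hz, hz'⟩⟩
  · rw [isInter_iff] at hW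
    obtain ⟨U, hU', rfl⟩ := mem_subTop.1 hU
    obtain ⟨V, hV', rfl⟩ := mem_subTop.1 hV
    refine mem_subTop.2 ⟨inter U V, hT.inter_mem hU' hV', ext fun z => ?_⟩
    simp only [hW, mem_inter]
    tauto

theorem IsHausdorff.subTop {X Y T : M} (hT : IsHausdorff X T) (hY : Sub Y X) :
    IsHausdorff Y (subTop Y T) := by
  intro x y hx hy hxy
  obtain ⟨U, V, hU, hV, hxU, hyV, hUV⟩ := hT x y (hY x hx) (hY y hy) hxy
  refine ⟨inter U Y, inter V Y, mem_subTop.2 ⟨U, hU, rfl⟩, mem_subTop.2 ⟨V, hV, rfl⟩,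
    mem_inter.2 ⟨hxU, hx⟩, mem_inter.2 ⟨hyV, hy⟩, fun z hz => hUV z ?_⟩
  simp only [mem_inter] at hz
  exact ⟨hz.1.1, hz.2.1⟩

theorem convergesTo_subTop {Y T s x A : M} (hs : IsFun s nats A) (hA : Sub A Y) (hx : x ∈ᴹ Y) :
    ConvergesTo (subTop Y T) s x ↔ ConvergesTo T s x := by
  rw [convergesTo_iff hs, convergesTo_iff hs]
  constructor
  · intro h U hU hxU
    obtain ⟨n, hn, hn'⟩ := h (inter U Y) (mem_subTop.2 ⟨U, hU, rfl⟩) (mem_inter.2 ⟨hxU, hx⟩)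
    exact ⟨n, hn, fun m hm hnm => (mem_inter.1 (hn' m hm hnm)).1⟩
  · intro h U hU hxU
    obtain ⟨V, hV, rfl⟩ := mem_subTop.1 hU
    obtain ⟨n, hn, hn'⟩ := h V hV (mem_inter.1 hxU).1
    exact ⟨n, hn, fun m hm hnm => mem_inter.2 ⟨hn' m hm hnm, hA _ (hs.app_mem hm)⟩⟩

/-- A closed subspace of a sequential space is sequential. -/
theorem IsSequential.closed_subspace {X T Y : M} (h : IsSequential X T) (hY : IsClosedIn X T Y) :
    IsSequential Y (subTop Y T) := by
  rw [isSequential_iff] at h ⊢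
  refine ⟨h.1.subTop hY.1, fun A hA => ?_⟩
  rw [isSeqClosedIn_iff] at hA
  have hAX : Sub A X := fun z hz => hY.1 z (hA.1 z hz)
  have hc : IsClosedIn X T A := by
    refine h.2 A (isSeqClosedIn_iff.2 ⟨hAX, fun s x hs hx hsx => ?_⟩)
    have hxY : x ∈ᴹ Y := (isSeqClosedIn_iff.1 hY.isSeqClosedIn).2 s x
      (hs.mono fun n hn => hA.1 _ (hs.app_mem hn)) hx hsx
    exact hA.2 s x hs hxY ((convergesTo_subTop hs hA.1 hxY).2 hsx)
  rw [isClosedIn_iff] at hc ⊢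
  refine ⟨hA.1, mem_subTop.2 ⟨_, hc.2, ext fun z => ?_⟩⟩
  simp only [mem_diff, mem_inter]
  exact ⟨fun hz => ⟨⟨hY.1 z hz.1, hz.2⟩, hz.1⟩, fun hz => ⟨hz.2, hz.1.2⟩⟩

end Topology

/-! ### Rational numbers -/

section Rationals

variable {M : Type u} [setLang.Structure M] {Γ : Type u} [Ctx M Γ] [hM : Fact (IsZFModel M)]

/-- The triple that represents `(a - b) / c`. -/
noncomputable def frac (a b c : N M) : M := pair (pair a.val b.val) c.val

/-- The set of all triples that represent rational numbers. -/
noncomputable def rats : M := sep (prod (prod nats nats) nats) fun q => snd q ≠ zero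

theorem N.pos_iff {c : N M} : 0 < c ↔ c.val ≠ zero := by
  rw [(N.zero_le c).lt_iff_ne, ne_comm, Ne, ← N.coe_inj, N.coe_zero]

theorem mem_rats {q : M} : q ∈ᴹ rats ↔ ∃ a b c : N M, 0 < c ∧ q = frac a b c := by
  rw [rats, mem_sep (by fun_prop), mem_prod]
  constructor
  · rintro ⟨⟨p, c, hp, hc, rfl⟩, h⟩
    obtain ⟨a, b, ha, hb, rfl⟩ := mem_prod.1 hp
    rw [snd_pair] at h
    exact ⟨⟨a, ha⟩, ⟨b, hb⟩, ⟨c, hc⟩, N.pos_iff.2 h, rfl⟩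
  · rintro ⟨a, b, c, hc, rfl⟩
    exact ⟨⟨_, _, by simp [a.mem, b.mem], c.mem, rfl⟩, by simpa [frac] using N.pos_iff.1 hc⟩

theorem frac_mem_rats {a b c : N M} (hc : 0 < c) : frac a b c ∈ᴹ rats :=
  mem_rats.2 ⟨a, b, c, hc, rfl⟩

theorem isFrac_iff {q : M} {a b c : M} : IsFrac q a b c ↔
    ∃ a' b' c' : N M, 0 < c' ∧ a = a'.val ∧ b = b'.val ∧ c = c'.val ∧ q = frac a' b' c' := by
  simp only [IsFrac, isNat_iff, isEmp_iff, isOPair_iff]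
  constructor
  · rintro ⟨ha, hb, hc, h, p, rfl, rfl⟩
    exact ⟨⟨a, ha⟩, ⟨b, hb⟩, ⟨c, hc⟩, N.pos_iff.2 h, rfl, rfl, rfl, rfl⟩
  · rintro ⟨a, b, c, hc, rfl, rfl, rfl, rfl⟩
    exact ⟨a.mem, b.mem, c.mem, N.pos_iff.1 hc, _, rfl, rfl⟩

theorem isRat_iff {q : M} : IsRat q ↔ q ∈ᴹ rats := by
  simp only [IsRat, mem_rats, isFrac_iff]
  constructor
  · rintro ⟨_, _, _, a, b, c, hc, -, -, -, rfl⟩; exact ⟨a, b, c, hc, rfl⟩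
  · rintro ⟨a, b, c, hc, rfl⟩; exact ⟨_, _, _, a, b, c, hc, rfl, rfl, rfl, rfl⟩

theorem frac_inj {a b c a' b' c' : N M} : frac a b c = frac a' b' c' ↔
    a = a' ∧ b = b' ∧ c = c' := by
  simp only [frac, pair_inj, N.coe_inj, and_assoc]

theorem ratLt_iff {q q' : M} : RatLt q q' ↔ ∃ a b c a' b' c' : N M, 0 < c ∧ 0 < c' ∧
    q = frac a b c ∧ q' = frac a' b' c' ∧ a * c' + b' * c < a' * c + b * c' := by
  simp only [RatLt, isFrac_iff, times_iff, plus_iff]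
  constructor
  · rintro ⟨_, _, _, _, _, _, ⟨a, b, c, hc, rfl, rfl, rfl, rfl⟩, ⟨a', b', c', hc', rfl, rfl, rfl, rfl⟩,
      _, _, _, _, _, _, ⟨-, -, rfl⟩, ⟨-, -, rfl⟩, ⟨-, -, rfl⟩, ⟨-, -, rfl⟩, ⟨-, -, rfl⟩,
      ⟨-, -, rfl⟩, h⟩
    exact ⟨a, b, c, a', b', c', hc, hc', rfl, rfl, h⟩
  · rintro ⟨a, b, c, a', b', c', hc, hc', rfl, rfl, h⟩
    exact ⟨_, _, _, _, _, _, ⟨a, b, c, hc, rfl, rfl, rfl, rfl⟩,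
      ⟨a', b', c', hc', rfl, rfl, rfl, rfl⟩,
      _, _, _, _, _, _, ⟨a.mem, c'.mem, rfl⟩, ⟨b'.mem, c.mem, rfl⟩, ⟨a'.mem, c.mem, rfl⟩,
      ⟨b.mem, c'.mem, rfl⟩, ⟨(a * c').mem, (b' * c).mem, rfl⟩,
      ⟨(a' * c).mem, (b * c').mem, rfl⟩, h⟩

theorem frac_lt_frac {a b c a' b' c' : N M} (hc : 0 < c) (hc' : 0 < c') :
    RatLt (frac a b c) (frac a' b' c') ↔ a * c' + b' * c < a' * c + b * c' := by
  rw [ratLt_iff]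
  constructor
  · rintro ⟨_, _, _, _, _, _, -, -, h1, h2, h⟩
    obtain ⟨rfl, rfl, rfl⟩ := frac_inj.1 h1
    obtain ⟨rfl, rfl, rfl⟩ := frac_inj.1 h2
    exact h
  · intro h; exact ⟨_, _, _, _, _, _, hc, hc', rfl, rfl, h⟩

@[fun_prop] theorem Def.ratLt {x y : Γ → M} (hx : DefF x) (hy : DefF y) :
    Def (fun g => RatLt (x g) (y g)) := by
  simp only [RatLt, IsFrac, isNat_iff, isEmp_iff, isOPair_iff, times_iff, plus_iff]
  fun_prop

theorem RatLt.left_mem {q r : M} (h : RatLt q r) : q ∈ᴹ rats := by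
  obtain ⟨a, b, c, _, _, _, hc, -, rfl, -⟩ := ratLt_iff.1 h
  exact frac_mem_rats hc

theorem RatLt.right_mem {q r : M} (h : RatLt q r) : r ∈ᴹ rats := by
  obtain ⟨_, _, _, a, b, c, -, hc, -, rfl, -⟩ := ratLt_iff.1 h
  exact frac_mem_rats hc

theorem ratLt_irrefl (q : M) : ¬ RatLt q q := by
  intro h
  obtain ⟨a, b, c, hc, rfl⟩ := mem_rats.1 h.left_mem
  rw [frac_lt_frac hc hc] at h
  exact lt_irrefl _ h

/-- The order of the rationals is a strict weak order: triples that represent the same rational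
number are incomparable. -/
theorem RatLt.cotrans {q s r : M} (h : RatLt q s) (hr : r ∈ᴹ rats) : RatLt q r ∨ RatLt r s := by
  obtain ⟨a, b, c, hc, rfl⟩ := mem_rats.1 h.left_mem
  obtain ⟨a', b', c', hc', rfl⟩ := mem_rats.1 hr
  obtain ⟨a'', b'', c'', hc'', rfl⟩ := mem_rats.1 h.right_mem
  rw [frac_lt_frac hc hc''] at h
  rw [frac_lt_frac hc hc', frac_lt_frac hc' hc'']
  by_contra! h'
  have := add_lt_add_of_lt_of_le (mul_lt_mul_of_pos_right h hc')
    (add_le_add (mul_le_mul_of_nonneg_right h'.1 hc''.le) (mul_le_mul_of_nonneg_right h'.2 hc.le))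
  exact this.ne (by ring)

theorem RatLt.asymm {q r : M} (h : RatLt q r) : ¬ RatLt r q := by
  intro h'
  obtain ⟨a, b, c, hc, rfl⟩ := mem_rats.1 h.left_mem
  obtain ⟨a', b', c', hc', rfl⟩ := mem_rats.1 h.right_mem
  rw [frac_lt_frac hc hc'] at h
  rw [frac_lt_frac hc' hc, add_comm, add_comm (a * c')] at h'
  exact (lt_trans h (by rwa [add_comm (b * c'), add_comm (b' * c)] at h')).false

theorem RatLt.trans {q r s : M} (h : RatLt q r) (h' : RatLt r s) : RatLt q s :=
  (h.cotrans h'.right_mem).resolve_right h'.asymm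

theorem RatLt.dense {q s : M} (h : RatLt q s) : ∃ r, RatLt q r ∧ RatLt r s := by
  obtain ⟨a, b, c, hc, rfl⟩ := mem_rats.1 h.left_mem
  obtain ⟨a', b', c', hc', rfl⟩ := mem_rats.1 h.right_mem
  rw [frac_lt_frac hc hc'] at h
  -- the mediant of the two fractions lies strictly between them
  refine ⟨frac (a + a') (b + b') (c + c'), ?_, ?_⟩
  · rw [frac_lt_frac hc (add_pos hc hc')]
    calc _ = a * c' + b' * c + (a * c + b * c) := by ring
      _ < a' * c + b * c' + (a * c + b * c) := by gcongr
      _ = _ := by ring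
  · rw [frac_lt_frac (add_pos hc hc') hc']
    calc _ = a * c' + b' * c + (a' * c' + b' * c') := by ring
      _ < a' * c + b * c' + (a' * c' + b' * c') := by gcongr
      _ = _ := by ring

theorem exists_rat_gt {q : M} (hq : q ∈ᴹ rats) : ∃ r, RatLt q r := by
  obtain ⟨a, b, c, hc, rfl⟩ := mem_rats.1 hq
  refine ⟨frac (a + 1) b c, ?_⟩
  rw [frac_lt_frac hc hc]
  gcongr
  exact N.lt_succ_iff.2 le_rfl

theorem exists_rat_lt {q : M} (hq : q ∈ᴹ rats) : ∃ r, RatLt r q := by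
  obtain ⟨a, b, c, hc, rfl⟩ := mem_rats.1 hq
  refine ⟨frac a (b + 1) c, ?_⟩
  rw [frac_lt_frac hc hc]
  gcongr
  exact N.lt_succ_iff.2 le_rfl

end Rationals

/-! ### Real numbers -/

section Reals

variable {M : Type u} [setLang.Structure M] {Γ : Type u} [Ctx M Γ] [hM : Fact (IsZFModel M)]

@[fun_prop] theorem Def.isCut {x : Γ → M} (hx : DefF x) : Def (fun g => IsCut (x g)) := by
  simp only [IsCut, isRat_iff]; fun_prop

/-- the set of real numbers -/
noncomputable def reals : M := sep (pow rats) IsCut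

theorem mem_reals {x : M} : x ∈ᴹ reals ↔ IsCut x := by
  rw [reals, mem_sep (by fun_prop), and_iff_right_iff_imp, mem_pow]
  exact fun h q hq => isRat_iff.1 (h.1 q hq)

theorem rat_of_mem {x q : M} (hx : x ∈ᴹ reals) (hq : q ∈ᴹ x) : q ∈ᴹ rats :=
  isRat_iff.1 ((mem_reals.1 hx).1 q hq)

theorem exists_mem {x : M} (hx : x ∈ᴹ reals) : ∃ q, q ∈ᴹ x := (mem_reals.1 hx).2.1

theorem exists_not_mem {x : M} (hx : x ∈ᴹ reals) : ∃ q, q ∈ᴹ rats ∧ ¬ q ∈ᴹ x := by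
  simpa only [isRat_iff] using (mem_reals.1 hx).2.2.1

theorem mem_of_lt {x q r : M} (hx : x ∈ᴹ reals) (h : RatLt q r) (hr : r ∈ᴹ x) : q ∈ᴹ x :=
  (mem_reals.1 hx).2.2.2.1 q r h hr

theorem exists_mem_gt {x q : M} (hx : x ∈ᴹ reals) (hq : q ∈ᴹ x) : ∃ r, r ∈ᴹ x ∧ RatLt q r :=
  (mem_reals.1 hx).2.2.2.2 q hq

/-- `q ≤ r ∈ x` implies `q ∈ x`. -/
theorem mem_of_not_lt {x q r : M} (hx : x ∈ᴹ reals) (hq : q ∈ᴹ rats) (h : ¬ RatLt r q)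
    (hr : r ∈ᴹ x) : q ∈ᴹ x := by
  obtain ⟨s, hs, hrs⟩ := exists_mem_gt hx hr
  exact mem_of_lt hx ((hrs.cotrans hq).resolve_left h) hs

theorem lt_of_mem_of_not_mem {x q r : M} (hx : x ∈ᴹ reals) (hr : r ∈ᴹ x) (hq : q ∈ᴹ rats)
    (h : ¬ q ∈ᴹ x) : RatLt r q := by
  by_contra h'
  exact h (mem_of_not_lt hx hq h' hr)

theorem sub_of_not_mem {x y q : M} (hx : x ∈ᴹ reals) (hy : y ∈ᴹ reals) (hq : q ∈ᴹ y)
    (h : ¬ q ∈ᴹ x) : Sub x y :=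
  fun _ hr => mem_of_lt hy (lt_of_mem_of_not_mem hx hr (rat_of_mem hy hq) h) hq

theorem realLt_iff {x y : M} (hx : x ∈ᴹ reals) (hy : y ∈ᴹ reals) :
    RealLt x y ↔ ∃ q, q ∈ᴹ y ∧ ¬ q ∈ᴹ x := by
  constructor
  · rintro ⟨h, hne⟩
    by_contra! h'
    exact hne (h.antisymm h')
  · rintro ⟨q, hq, h⟩
    exact ⟨sub_of_not_mem hx hy hq h, by rintro rfl; exact h hq⟩

/-- the real number given by the rational number `r` -/
noncomputable def ratCut (r : M) : M := sep rats fun q => RatLt q r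

theorem mem_ratCut {q r : M} : q ∈ᴹ ratCut r ↔ RatLt q r := by
  rw [ratCut, mem_sep (by fun_prop), and_iff_right_iff_imp]
  exact RatLt.left_mem

theorem isRatCut_iff {x r : M} : IsRatCut x r ↔ x = ratCut r :=
  ⟨fun h => ext fun q => by rw [h, mem_ratCut], by rintro rfl q; exact mem_ratCut⟩

theorem ratCut_mem {r : M} (hr : r ∈ᴹ rats) : ratCut r ∈ᴹ reals := by
  rw [mem_reals]
  simp only [IsCut, isRat_iff, mem_ratCut]
  exact ⟨fun q hq => hq.left_mem, exists_rat_lt hr, ⟨r, hr, ratLt_irrefl r⟩,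
    fun q s h h' => h.trans h', fun q hq => by
      obtain ⟨s, h, h'⟩ := hq.dense; exact ⟨s, h', h⟩⟩

/-- `x < q`, for a real number `x` and a rational number `q`. -/
def Above (q x : M) : Prop := ∃ q', q' ∈ᴹ rats ∧ ¬ q' ∈ᴹ x ∧ RatLt q' q

@[fun_prop] theorem Def.above {x y : Γ → M} (hx : DefF x) (hy : DefF y) :
    Def (fun g => Above (x g) (y g)) := by unfold Above; fun_prop

theorem Above.not_mem {q x : M} (h : Above q x) (hx : x ∈ᴹ reals) : ¬ q ∈ᴹ x := by
  rintro hq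
  obtain ⟨q', -, hq', h⟩ := h
  exact hq' (mem_of_lt hx h hq)

theorem exists_above {x : M} (hx : x ∈ᴹ reals) : ∃ q, Above q x := by
  obtain ⟨q, hq, hqx⟩ := exists_not_mem hx
  obtain ⟨r, hr⟩ := exists_rat_gt hq
  exact ⟨r, q, hq, hqx, hr⟩

/-- Distinct real numbers are separated by a rational number. -/
theorem exists_rat_between {x y : M} (hx : x ∈ᴹ reals) (hy : y ∈ᴹ reals) (h : RealLt x y) :
    ∃ q, q ∈ᴹ y ∧ Above q x := by
  obtain ⟨q, hq, hqx⟩ := (realLt_iff hx hy).1 h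
  obtain ⟨r, hr, hqr⟩ := exists_mem_gt hy hq
  exact ⟨r, hr, q, rat_of_mem hy hq, hqx, hqr⟩

theorem realLt_or_realLt {x y : M} (hx : x ∈ᴹ reals) (hy : y ∈ᴹ reals) (h : x ≠ y) :
    RealLt x y ∨ RealLt y x := by
  rw [realLt_iff hx hy, realLt_iff hy hx]
  by_contra! h'
  exact h (Sub.antisymm h'.2 h'.1)

/-- the usual topology of the real line -/
noncomputable def realTop : M := sep (pow reals) fun U => ∀ x, x ∈ᴹ U →
  ∃ a b, a ∈ᴹ reals ∧ b ∈ᴹ reals ∧ RealLt a x ∧ RealLt x b ∧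
    ∀ y, y ∈ᴹ reals → RealLt a y → RealLt y b → y ∈ᴹ U

theorem mem_realTop' {U : M} : U ∈ᴹ realTop ↔ Sub U reals ∧ ∀ x, x ∈ᴹ U →
    ∃ a b, a ∈ᴹ reals ∧ b ∈ᴹ reals ∧ RealLt a x ∧ RealLt x b ∧
      ∀ y, y ∈ᴹ reals → RealLt a y → RealLt y b → y ∈ᴹ U := by
  rw [realTop, mem_sep (by unfold RealLt; fun_prop), mem_pow]

theorem isRealLine_iff {R T : M} : IsRealLine R T ↔ R = reals ∧ T = realTop := by
  constructor
  · rintro ⟨h, h'⟩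
    obtain rfl : R = reals := ext fun x => by rw [h, mem_reals]
    exact ⟨rfl, ext fun U => by rw [h', mem_realTop']⟩
  · rintro ⟨rfl, rfl⟩
    exact ⟨fun x => mem_reals, fun U => mem_realTop'⟩

/-- The open intervals with rational end points form a base of the real line. -/
theorem mem_realTop {U : M} : U ∈ᴹ realTop ↔ Sub U reals ∧ ∀ x, x ∈ᴹ U →
    ∃ i : M × M, (i.1 ∈ᴹ x ∧ Above i.2 x) ∧
      ∀ y, y ∈ᴹ reals → i.1 ∈ᴹ y ∧ Above i.2 y → y ∈ᴹ U := by
  rw [mem_realTop']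
  refine and_congr_right fun hU => forall₂_congr fun x hx => ?_
  replace hx := hU x hx
  constructor
  · rintro ⟨a, b, ha, hb, hax, hxb, h⟩
    rw [realLt_iff ha hx] at hax
    obtain ⟨p, hp, hpa⟩ := hax
    obtain ⟨q, hq, hqx⟩ := exists_rat_between hx hb hxb
    refine ⟨(p, q), ⟨hp, hqx⟩, fun y hy hpq => h y hy ((realLt_iff ha hy).2 ⟨p, hpq.1, hpa⟩)
      ((realLt_iff hy hb).2 ⟨q, hq, hpq.2.not_mem hy⟩)⟩
  · rintro ⟨⟨p, q⟩, ⟨hp, hqx⟩, h⟩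
    have hq : q ∈ᴹ rats := by obtain ⟨_, -, -, h⟩ := hqx; exact h.right_mem
    have hpr := rat_of_mem hx hp
    refine ⟨ratCut p, ratCut q, ratCut_mem hpr, ratCut_mem hq, ?_, ?_, fun y hy hpy hyq =>
      h y hy ⟨?_, ?_⟩⟩
    · exact (realLt_iff (ratCut_mem hpr) hx).2 ⟨p, hp, by rw [mem_ratCut]; exact ratLt_irrefl p⟩
    · obtain ⟨q', -, hq', hlt⟩ := hqx
      exact (realLt_iff hx (ratCut_mem hq)).2 ⟨q', mem_ratCut.2 hlt, hq'⟩
    · obtain ⟨r, hr, hrp⟩ := (realLt_iff (ratCut_mem hpr) hy).1 hpy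
      rw [mem_ratCut] at hrp
      exact mem_of_not_lt hy hpr hrp hr
    · obtain ⟨r, hr, hry⟩ := (realLt_iff hy (ratCut_mem hq)).1 hyq
      rw [mem_ratCut] at hr
      exact ⟨r, hr.left_mem, hry, hr⟩

theorem isTopology_realTop : IsTopology (reals : M) realTop := by
  refine isTopology_of_nhds (fun x i => x ∈ᴹ reals ∧ i.1 ∈ᴹ x ∧ Above i.2 x)
    (fun (i : M × M) y => i.1 ∈ᴹ y ∧ Above i.2 y) (fun U => ?_) (fun x hx => ?_) ?_
  · rw [mem_realTop]
    refine and_congr_right fun hU => forall₂_congr fun x hx => exists_congr fun i => ?_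
    simp [hU x hx]
  · obtain ⟨q, hq⟩ := exists_above hx
    obtain ⟨p, hp⟩ := exists_mem hx
    exact ⟨(p, q), hx, hp, hq⟩
  · rintro x ⟨p, q⟩ ⟨p', q'⟩ ⟨hx, hp, hq⟩ ⟨-, hp', hq'⟩
    have h1 : ∃ r, r ∈ᴹ x ∧ ∀ y, y ∈ᴹ reals → r ∈ᴹ y → p ∈ᴹ y ∧ p' ∈ᴹ y := by
      by_cases h : RatLt p p'
      · exact ⟨p', hp', fun y hy hr => ⟨mem_of_lt hy h hr, hr⟩⟩
      · exact ⟨p, hp, fun y hy hr => ⟨hr, mem_of_not_lt hy (rat_of_mem hx hp') h hr⟩⟩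
    have h2 : ∃ r, Above r x ∧ ∀ y, y ∈ᴹ reals → Above r y → Above q y ∧ Above q' y := by
      by_cases h : RatLt q q'
      · refine ⟨q, hq, fun y hy hr => ⟨hr, ?_⟩⟩
        obtain ⟨r, hr, hry, hlt⟩ := hr
        exact ⟨r, hr, hry, hlt.trans h⟩
      · refine ⟨q', hq', fun y hy hr => ⟨?_, hr⟩⟩
        obtain ⟨r, hr, hry, hlt⟩ := hr
        obtain ⟨_, _, _, hlt'⟩ := hq
        exact ⟨r, hr, hry, (hlt.cotrans hlt'.right_mem).resolve_right h⟩
    obtain ⟨r, hr, hr'⟩ := h1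
    obtain ⟨t, ht, ht'⟩ := h2
    exact ⟨(r, t), ⟨hx, hr, ht⟩, fun y hy h =>
      ⟨⟨(hr' y hy h.1).1, (ht' y hy h.2).1⟩, (hr' y hy h.1).2, (ht' y hy h.2).2⟩⟩

/-- the open ray of all real numbers greater than `q` -/
noncomputable def rayGt (q : M) : M := sep reals fun x => q ∈ᴹ x

/-- the open ray of all real numbers less than `q` -/
noncomputable def rayLt (q : M) : M := sep reals fun x => Above q x

theorem mem_rayGt {q x : M} : x ∈ᴹ rayGt q ↔ x ∈ᴹ reals ∧ q ∈ᴹ x := mem_sep (by fun_prop)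

theorem mem_rayLt {q x : M} : x ∈ᴹ rayLt q ↔ x ∈ᴹ reals ∧ Above q x := mem_sep (by fun_prop)

theorem rayGt_open (q : M) : rayGt q ∈ᴹ realTop := by
  refine mem_realTop.2 ⟨fun x hx => (mem_rayGt.1 hx).1, fun x hx => ?_⟩
  rw [mem_rayGt] at hx
  obtain ⟨r, hr⟩ := exists_above hx.1
  exact ⟨(q, r), ⟨hx.2, hr⟩, fun y hy h => mem_rayGt.2 ⟨hy, h.1⟩⟩

theorem rayLt_open (q : M) : rayLt q ∈ᴹ realTop := by
  refine mem_realTop.2 ⟨fun x hx => (mem_rayLt.1 hx).1, fun x hx => ?_⟩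
  rw [mem_rayLt] at hx
  obtain ⟨r, hr⟩ := exists_mem hx.1
  exact ⟨(r, q), ⟨hr, hx.2⟩, fun y hy h => mem_rayLt.2 ⟨hy, h.2⟩⟩

theorem isHausdorff_realTop : IsHausdorff (reals : M) realTop := by
  have key : ∀ x y : M, x ∈ᴹ reals → y ∈ᴹ reals → RealLt x y →
      ∃ q, x ∈ᴹ rayLt q ∧ y ∈ᴹ rayGt q ∧ ∀ z, ¬ (z ∈ᴹ rayLt q ∧ z ∈ᴹ rayGt q) := by
    intro x y hx hy hxy
    obtain ⟨q, hq, hqx⟩ := exists_rat_between hx hy hxy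
    refine ⟨q, mem_rayLt.2 ⟨hx, hqx⟩, mem_rayGt.2 ⟨hy, hq⟩, fun z hz => ?_⟩
    rw [mem_rayLt, mem_rayGt] at hz
    exact hz.1.2.not_mem hz.1.1 hz.2.2
  intro x y hx hy hxy
  rcases realLt_or_realLt hx hy hxy with h | h
  · obtain ⟨q, h1, h2, h3⟩ := key x y hx hy h
    exact ⟨_, _, rayLt_open q, rayGt_open q, h1, h2, h3⟩
  · obtain ⟨q, h1, h2, h3⟩ := key y x hy hx h
    exact ⟨_, _, rayGt_open q, rayLt_open q, h2, h1, fun z hz => h3 z hz.symm⟩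

/-- the closed interval `[a, b]` -/
noncomputable def interval (a b : M) : M := sep reals fun x => Sub a x ∧ Sub x b

theorem mem_interval {a b x : M} : x ∈ᴹ interval a b ↔ x ∈ᴹ reals ∧ Sub a x ∧ Sub x b :=
  mem_sep (by fun_prop)

theorem interval_sub (a b : M) : Sub (interval a b) reals := fun _ hx => (mem_interval.1 hx).1

theorem isClosedIn_interval {a b : M} (ha : a ∈ᴹ reals) (hb : b ∈ᴹ reals) :
    IsClosedIn reals realTop (interval a b) := by
  refine isTopology_realTop.closed_of_nhds (interval_sub a b) fun x hx hxab => ?_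
  rw [mem_interval, not_and, not_and_or] at hxab
  rcases hxab hx with h | h
  · have : RealLt x a := by
      refine (realLt_or_realLt hx ha ?_).resolve_right fun h' => h h'.1
      rintro rfl; exact h (Sub.refl x)
    obtain ⟨q, hq, hqx⟩ := exists_rat_between hx ha this
    refine ⟨_, rayLt_open q, mem_rayLt.2 ⟨hx, hqx⟩, fun y hy hy' => ?_⟩
    rw [mem_rayLt] at hy
    exact hy.2.not_mem hy.1 ((mem_interval.1 hy').2.1 q hq)
  · have : RealLt b x := by
      refine (realLt_or_realLt hb hx ?_).resolve_right fun h' => h h'.1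
      rintro rfl; exact h (Sub.refl b)
    obtain ⟨q, hq, hqx⟩ := exists_rat_between hb hx this
    refine ⟨_, rayGt_open q, mem_rayGt.2 ⟨hx, hq⟩, fun y hy hy' => ?_⟩
    rw [mem_rayGt] at hy
    exact hqx.not_mem hb ((mem_interval.1 hy').2.2 q hy.2)

/-- the real number `0` -/
noncomputable def realZero : M := ratCut (frac (M := M) 0 0 1)

/-- the real number `1` -/
noncomputable def realOne : M := ratCut (frac (M := M) 1 0 1)

theorem N.one_pos : (0 : N M) < 1 := zero_lt_one

theorem realZero_mem : (realZero : M) ∈ᴹ reals := ratCut_mem (frac_mem_rats N.one_pos)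

theorem realOne_mem : (realOne : M) ∈ᴹ reals := ratCut_mem (frac_mem_rats N.one_pos)

theorem isRealZero_iff {x : M} : IsRealZero x ↔ x = realZero := by
  simp only [IsRealZero, IsZeroOne, isEmp_iff, isSucc_iff, isFrac_iff, isRatCut_iff]
  constructor
  · rintro ⟨_, _, _, ⟨rfl, rfl⟩, ⟨a, b, c, -, ha, hb, hc, rfl⟩, rfl⟩
    rw [← N.coe_one] at hc
    rw [← N.coe_zero] at ha hb
    rw [realZero, ← N.ext ha, ← N.ext hb, ← N.ext hc]
  · rintro rfl
    exact ⟨_, _, _, ⟨rfl, rfl⟩, ⟨0, 0, 1, N.one_pos, rfl, rfl, rfl, rfl⟩, rfl⟩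

theorem isRealOne_iff {x : M} : IsRealOne x ↔ x = realOne := by
  simp only [IsRealOne, IsZeroOne, isEmp_iff, isSucc_iff, isFrac_iff, isRatCut_iff]
  constructor
  · rintro ⟨_, _, _, ⟨rfl, rfl⟩, ⟨a, b, c, -, ha, hb, hc, rfl⟩, rfl⟩
    rw [← N.coe_one] at hc ha
    rw [← N.coe_zero] at hb
    rw [realOne, ← N.ext ha, ← N.ext hb, ← N.ext hc]
  · rintro rfl
    exact ⟨_, _, _, ⟨rfl, rfl⟩, ⟨1, 0, 1, N.one_pos, rfl, rfl, rfl, rfl⟩, rfl⟩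

theorem isUnitInterval_iff {I S : M} : IsUnitInterval I S ↔
    I = interval realZero realOne ∧ S = subTop (interval realZero realOne) realTop := by
  simp only [IsUnitInterval, isRealLine_iff, isRealZero_iff, isRealOne_iff,
    isSubspaceTopology_iff]
  constructor
  · rintro ⟨_, _, _, _, ⟨rfl, rfl⟩, rfl, rfl, hI, rfl⟩
    obtain rfl : I = interval realZero realOne := ext fun x => by rw [hI, mem_interval]
    exact ⟨rfl, rfl⟩
  · rintro ⟨rfl, rfl⟩
    exact ⟨_, _, _, _, ⟨rfl, rfl⟩, rfl, rfl, fun x => mem_interval, rfl⟩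

end Reals

/-! ### Countable powers and the Cantor cube -/

section Powers

variable {M : Type u} [setLang.Structure M] {Γ : Type u} [Ctx M Γ]

@[fun_prop] theorem DefF.ite {P : Γ → Prop} [∀ g, Decidable (P g)] {s t : Γ → M} (hP : Def P)
    (hs : DefF s) (ht : DefF t) : DefF (fun g => if P g then s g else t g) := by
  refine .of_graph (Q := fun g y => (P g → y = s g) ∧ (¬ P g → y = t g)) ?_ fun g y => ?_
  · have : Def (fun p : Γ × M => P p.1) := Def.comp hP DefF.fst
    fun_prop
  · by_cases h : P g <;> simp [h]

@[fun_prop] theorem Def.natLe {s t : Γ → M} (hs : DefF s) (ht : DefF t) :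
    Def (fun g => NatLe (s g) (t g)) := by unfold NatLe; fun_prop

/-- `z` and `z'` agree below `m`. -/
def Agree (m z z' : M) : Prop := ∀ i, i ∈ᴹ m → app z i = app z' i

theorem Agree.refl (m z : M) : Agree m z z := fun _ _ => rfl

theorem Agree.symm {m z z' : M} (h : Agree m z z') : Agree m z' z := fun i hi => (h i hi).symm

theorem Agree.trans {m z z' z'' : M} (h : Agree m z z') (h' : Agree m z' z'') : Agree m z z'' :=
  fun i hi => (h i hi).trans (h' i hi)

variable [hM : Fact (IsZFModel M)]

theorem natLe_iff {m n : N M} : NatLe m.val n.val ↔ m ≤ n := by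
  rw [NatLe, N.coe_inj, ← N.lt_iff, le_iff_lt_or_eq]

theorem exists_natLe {k l : M} (hk : k ∈ᴹ nats) (hl : l ∈ᴹ nats) :
    ∃ m, m ∈ᴹ nats ∧ NatLe k m ∧ NatLe l m :=
  ⟨_, (max (⟨k, hk⟩ : N M) ⟨l, hl⟩).mem, natLe_iff.2 (le_max_left (⟨k, hk⟩ : N M) ⟨l, hl⟩),
    natLe_iff.2 (le_max_right (⟨k, hk⟩ : N M) ⟨l, hl⟩)⟩

theorem NatLe.trans {k l m : M} (h : NatLe k l) (h' : NatLe l m) (hm : m ∈ᴹ nats) : NatLe k m := by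
  rcases h with h | rfl
  · rcases h' with h' | rfl
    exacts [.inl (nat_trans h h' hm), .inl h]
  · exact h'

theorem NatLe.mem {i k m : M} (h : NatLe k m) (hi : i ∈ᴹ k) (hm : m ∈ᴹ nats) : i ∈ᴹ m := by
  rcases h with h | rfl
  exacts [nat_trans hi h hm, hi]

theorem succ_natLe {i m : M} (h : i ∈ᴹ m) (hm : m ∈ᴹ nats) : NatLe (succ i) m :=
  (succ_eq_or_mem h hm).symm

theorem natLe_or_mem {m n : M} (hm : m ∈ᴹ nats) (hn : n ∈ᴹ nats) : NatLe m n ∨ n ∈ᴹ m := by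
  rcases nat_trichotomy hm hn with h | h | h
  exacts [.inl (.inl h), .inl (.inr h), .inr h]

/-- `V` is a sequence of open sets, all but finitely many of them equal to `X`. -/
def Box (X T V : M) : Prop :=
  IsFun V nats T ∧ ∃ k, k ∈ᴹ nats ∧ ∀ n, n ∈ᴹ nats → NatLe k n → app V n = X

theorem isBox_iff {X T V : M} : IsBox X T V ↔ Box X T V := by
  simp only [IsBox, isOmega_iff, isNat_iff, exists_eq_left]
  refine and_congr_right fun hV => exists_congr fun k => and_congr_right fun _ =>
    forall₂_congr fun n hn => ?_
  rw [hV.app_iff, eq_comm]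
  simp [hn]

theorem inBox_iff {g V X T : M} (hg : IsFun g nats X) (hV : IsFun V nats T) :
    InBox g V ↔ ∀ n, n ∈ᴹ nats → app g n ∈ᴹ app V n := by
  simp only [InBox, isNat_iff, hg.app_iff, hV.app_iff]
  constructor
  · intro h n hn; exact h n _ _ hn ⟨hn, rfl⟩ ⟨hn, rfl⟩
  · rintro h n y U hn ⟨-, rfl⟩ ⟨-, rfl⟩; exact h n hn

/-- The product topology of `X^ω`. -/
noncomputable def powTop (X T : M) : M := sep (pow (funs nats X)) fun U => ∀ g, g ∈ᴹ U →
  ∃ V, Box X T V ∧ (∀ n, n ∈ᴹ nats → app g n ∈ᴹ app V n) ∧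
    ∀ h, h ∈ᴹ funs nats X → (∀ n, n ∈ᴹ nats → app h n ∈ᴹ app V n) → h ∈ᴹ U

theorem mem_powTop {X T U : M} : U ∈ᴹ powTop X T ↔ Sub U (funs nats X) ∧ ∀ g, g ∈ᴹ U →
    ∃ V, Box X T V ∧ (∀ n, n ∈ᴹ nats → app g n ∈ᴹ app V n) ∧
      ∀ h, h ∈ᴹ funs nats X → (∀ n, n ∈ᴹ nats → app h n ∈ᴹ app V n) → h ∈ᴹ U := by
  rw [powTop, mem_sep (by unfold Box; fun_prop), mem_pow]

theorem isOmegaPower_iff {P S X T : M} :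
    IsOmegaPower P S X T ↔ P = funs nats X ∧ S = powTop X T := by
  have key : ∀ U : M, (Sub U (funs nats X) ∧ ∀ g : M, g ∈ᴹ U →
      ∃ V : M, IsBox X T V ∧ InBox g V ∧ ∀ h : M, h ∈ᴹ funs nats X → InBox h V → h ∈ᴹ U) ↔
        U ∈ᴹ powTop X T := by
    intro U
    rw [mem_powTop]
    refine and_congr_right fun hU => forall₂_congr fun g hg => exists_congr fun V => ?_
    rw [isBox_iff]
    refine and_congr_right fun hV => ?_
    rw [inBox_iff (mem_funs.1 (hU g hg)) hV.1]
    refine and_congr_right fun _ => forall₂_congr fun h hh => ?_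
    rw [inBox_iff (mem_funs.1 hh) hV.1]
  constructor
  · rintro ⟨⟨w, hw, hP⟩, hS⟩
    rw [isOmega_iff] at hw
    subst hw
    obtain rfl : P = funs nats X := ext fun g => by rw [hP, mem_funs]
    exact ⟨rfl, ext fun U => by rw [hS, key]⟩
  · rintro ⟨rfl, rfl⟩
    exact ⟨⟨nats, isOmega_nats, fun g => mem_funs⟩, fun U => (key U).symm⟩

theorem IsTopology.powTop {X T : M} (hT : IsTopology X T) :
    IsTopology (funs nats X) (powTop X T) := by
  refine isTopology_of_nhds
    (fun g V => IsFun g nats X ∧ Box X T V ∧ ∀ n, n ∈ᴹ nats → app g n ∈ᴹ app V n)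
    (fun V h => ∀ n, n ∈ᴹ nats → app h n ∈ᴹ app V n) (fun U => ?_) (fun g hg => ?_) ?_
  · rw [mem_powTop]
    refine and_congr_right fun hU => forall₂_congr fun g hg => exists_congr fun V => ?_
    rw [and_iff_right (mem_funs.1 (hU g hg)), and_assoc]
  · rw [mem_funs] at hg
    have happ : ∀ n, n ∈ᴹ nats → app (lam nats fun _ => X) n = X := fun n hn =>
      app_lam (by fun_prop) hn
    refine ⟨lam nats fun _ => X, hg, ⟨isFun_lam (by fun_prop) fun _ _ => hT.2.1, zero,
      zero_mem_nats, fun n hn _ => happ n hn⟩, fun n hn => ?_⟩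
    rw [happ n hn]
    exact hg.app_mem hn
  · rintro g V V' ⟨hg, ⟨hV, k, hk, hVk⟩, hgV⟩ ⟨-, ⟨hV', k', hk', hVk'⟩, hgV'⟩
    have happ : ∀ n, n ∈ᴹ nats → app (lam nats fun n => inter (app V n) (app V' n)) n =
        inter (app V n) (app V' n) := fun n hn => app_lam (by fun_prop) hn
    obtain ⟨l, hl, hkl, hkl'⟩ := exists_natLe hk hk'
    refine ⟨lam nats fun n => inter (app V n) (app V' n), ⟨hg, ⟨isFun_lam (by fun_prop) fun n hn =>
      hT.inter_mem (hV.app_mem hn) (hV'.app_mem hn), l, hl, fun n hn hln => ?_⟩, fun n hn => ?_⟩,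
      fun h hh hhn => ?_⟩
    · rw [happ n hn, hVk n hn (hkl.trans hln hn), hVk' n hn (hkl'.trans hln hn)]
      exact ext fun z => by rw [mem_inter, and_self]
    · rw [happ n hn, mem_inter]; exact ⟨hgV n hn, hgV' n hn⟩
    · have : ∀ n, n ∈ᴹ nats → _ := fun n hn => mem_inter.1 (happ n hn ▸ hhn n hn)
      exact ⟨fun n hn => (this n hn).1, fun n hn => (this n hn).2⟩

open Classical in
/-- The sequence `z` with its value at `m` changed to `a`. -/
noncomputable def update (z m a : M) : M := lam nats fun i => if i = m then a else app z i

@[fun_prop] theorem DefF.update {z m a : Γ → M} (hz : DefF z) (hm : DefF m) (ha : DefF a) :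
    DefF (fun g => update (z g) (m g) (a g)) := by unfold InternalZF.update; fun_prop

theorem isFun_update {z m a X : M} (hz : IsFun z nats X) (ha : a ∈ᴹ X) :
    IsFun (update z m a) nats X := by
  refine isFun_lam (by fun_prop) fun i hi => ?_
  split_ifs
  exacts [ha, hz.app_mem hi]

theorem app_update_self {z m a : M} (hm : m ∈ᴹ nats) : app (update z m a) m = a := by
  rw [update, app_lam (by fun_prop) hm, if_pos rfl]

theorem app_update_of_ne {z m a i : M} (hi : i ∈ᴹ nats) (h : i ≠ m) :
    app (update z m a) i = app z i := by
  rw [update, app_lam (by fun_prop) hi, if_neg h]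

/-- The sequence with the constant value `a`. -/
noncomputable def constSeq (a : M) : M := lam nats fun _ => a

theorem isFun_constSeq {a X : M} (ha : a ∈ᴹ X) : IsFun (constSeq a) nats X :=
  isFun_lam (by fun_prop) fun _ _ => ha

theorem app_constSeq {a n : M} (hn : n ∈ᴹ nats) : app (constSeq a) n = a :=
  app_lam (by fun_prop) hn

/-- The cylinder `{g | g(n) ∈ U}`. -/
noncomputable def cylinder (X n U : M) : M := sep (funs nats X) fun g => app g n ∈ᴹ U

theorem mem_cylinder {X n U g : M} : g ∈ᴹ cylinder X n U ↔ IsFun g nats X ∧ app g n ∈ᴹ U := by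
  rw [cylinder, mem_sep (by fun_prop), mem_funs]

theorem IsTopology.cylinder_open {X T n U : M} (hT : IsTopology X T) (hn : n ∈ᴹ nats)
    (hU : U ∈ᴹ T) : cylinder X n U ∈ᴹ InternalZF.powTop X T := by
  refine mem_powTop.2 ⟨fun g hg => mem_funs.2 (mem_cylinder.1 hg).1, fun g hg => ?_⟩
  rw [mem_cylinder] at hg
  refine ⟨update (constSeq X) n U, ⟨isFun_update (isFun_constSeq hT.2.1) hU, succ n,
    succ_mem_nats hn, fun i hi hni => ?_⟩, fun i hi => ?_, fun h hh hi => ?_⟩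
  · rw [app_update_of_ne hi, app_constSeq hi]
    rintro rfl
    exact not_mem_self i (hni.mem (mem_succ.2 (.inr rfl)) hi)
  · by_cases h : i = n
    · subst h; rw [app_update_self hi]; exact hg.2
    · rw [app_update_of_ne hi h, app_constSeq hi]; exact hg.1.app_mem hi
  · refine mem_cylinder.2 ⟨mem_funs.1 hh, ?_⟩
    simpa only [app_update_self hn] using hi n hn

theorem IsHausdorff.powTop {X T : M} (hT : IsTopology X T) (hX : IsHausdorff X T) :
    IsHausdorff (funs nats X) (powTop X T) := by
  intro g h hg hh hgh
  rw [mem_funs] at hg hh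
  obtain ⟨n, hn, hne⟩ : ∃ n, n ∈ᴹ nats ∧ app g n ≠ app h n := by
    by_contra! h'
    exact hgh (hg.ext hh h')
  obtain ⟨U, V, hU, hV, hgU, hhV, hUV⟩ := hX _ _ (hg.app_mem hn) (hh.app_mem hn) hne
  refine ⟨_, _, hT.cylinder_open hn hU, hT.cylinder_open hn hV, mem_cylinder.2 ⟨hg, hgU⟩,
    mem_cylinder.2 ⟨hh, hhV⟩, fun z hz => hUV (app z n) ?_⟩
  rw [mem_cylinder, mem_cylinder] at hz
  exact ⟨hz.1.2, hz.2.2⟩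

/-- A space with a sequential countable power is sequential: it is the image of the power under the
projection to the coordinate `0`. -/
theorem IsSequential.of_powTop {X T : M} (hT : IsTopology X T)
    (h : IsSequential (funs nats X) (powTop X T)) : IsSequential X T := by
  rw [isSequential_iff] at h ⊢
  refine ⟨hT, fun A hA => ?_⟩
  rw [isSeqClosedIn_iff] at hA
  have hd : Def (fun g : M => app g zero ∈ᴹ A) := by fun_prop
  have hcl := h.2 (sep (funs nats X) fun g => app g zero ∈ᴹ A) (isSeqClosedIn_iff.2
    ⟨fun g hg => ((mem_sep hd).1 hg).1, fun s g hs hg hsg => ?_⟩)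
  · rw [isClosedIn_iff] at hcl
    refine hT.closed_of_nhds hA.1 fun x hx hxA => ?_
    have hx' := isFun_constSeq hx
    have hmem : constSeq x ∈ᴹ diff (funs nats X) (sep (funs nats X) fun g => app g zero ∈ᴹ A) := by
      rw [mem_diff, mem_sep hd, mem_funs, app_constSeq zero_mem_nats]
      exact ⟨hx', fun h => hxA h.2⟩
    obtain ⟨V, hV, hxV, hVA⟩ := (mem_powTop.1 hcl.2).2 _ hmem
    refine ⟨app V zero, hV.1.app_mem zero_mem_nats, ?_, fun y hy hyA => ?_⟩
    · simpa only [app_constSeq zero_mem_nats] using hxV zero zero_mem_nats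
    · have hyX := hA.1 y hyA
      have := hVA (update (constSeq x) zero y) (mem_funs.2 (isFun_update hx' hyX)) fun n hn => by
        by_cases h : n = zero
        · subst h; rwa [app_update_self hn]
        · rw [app_update_of_ne hn h]; exact hxV n hn
      rw [mem_diff, mem_sep hd, app_update_self zero_mem_nats] at this
      exact this.2 ⟨this.1, hyA⟩
  · rw [mem_sep hd]
    have hs' : ∀ n, n ∈ᴹ nats → app s n ∈ᴹ funs nats X ∧ app (app s n) zero ∈ᴹ A := fun n hn =>
      (mem_sep hd).1 (hs.app_mem hn)
    have happ : ∀ n, n ∈ᴹ nats → app (lam nats fun n => app (app s n) zero) n =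
      app (app s n) zero := fun n hn => app_lam (by fun_prop) hn
    have hfun : IsFun (lam nats fun n => app (app s n) zero) nats A :=
      isFun_lam (by fun_prop) fun n hn => (hs' n hn).2
    rw [mem_funs] at hg
    refine ⟨mem_funs.2 hg, hA.2 _ _ hfun (hg.app_mem zero_mem_nats) ?_⟩
    rw [convergesTo_iff hs] at hsg
    refine (convergesTo_iff hfun).2 fun U hU hgU => ?_
    obtain ⟨n, hn, hn'⟩ := hsg _ (hT.cylinder_open zero_mem_nats hU) (mem_cylinder.2 ⟨hg, hgU⟩)
    refine ⟨n, hn, fun m hm hnm => ?_⟩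
    rw [happ m hm]
    exact (mem_cylinder.1 (hn' m hm hnm)).2

/-- The number `1`. -/
noncomputable def one : M := succ zero

/-- The set `{0, 1}`. -/
noncomputable def two : M := upair zero one

theorem mem_two {x : M} : x ∈ᴹ two ↔ x = zero ∨ x = one := mem_upair

theorem one_ne_zero' : (one : M) ≠ zero := succ_ne_zero _

/-- The set of all binary sequences. -/
noncomputable def cantor : M := funs nats two

theorem mem_cantor {z : M} : z ∈ᴹ cantor ↔ IsFun z nats two := mem_funs

@[fun_prop] theorem Def.agree {m z z' : Γ → M} (hm : DefF m) (hz : DefF z) (hz' : DefF z') :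
    Def (fun g => Agree (m g) (z g) (z' g)) := by unfold Agree; fun_prop

theorem Agree.mono {k m z z' : M} (h : Agree m z z') (hkm : NatLe k m) (hm : m ∈ᴹ nats) :
    Agree k z z' := fun i hi => h i (hkm.mem hi hm)

/-- The topology of the Cantor cube. -/
noncomputable def cantorTop : M := powTop two (pow two)

theorem isCantorCube_iff {P S : M} : IsCantorCube P S ↔ P = cantor ∧ S = cantorTop := by
  simp only [IsCantorCube, IsDiscreteTwo, IsZeroOne, isEmp_iff, isSucc_iff, isUPair_iff, isPow_iff,
    isOmegaPower_iff]
  constructor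
  · rintro ⟨_, _, ⟨⟨_, _, ⟨rfl, rfl⟩, rfl⟩, rfl⟩, rfl, rfl⟩; exact ⟨rfl, rfl⟩
  · rintro ⟨rfl, rfl⟩; exact ⟨_, _, ⟨⟨_, _, ⟨rfl, rfl⟩, rfl⟩, rfl⟩, rfl, rfl⟩

theorem isTopology_discrete (X : M) : IsTopology X (pow X) := by
  refine ⟨fun U hU => mem_pow.1 hU, mem_pow.2 (Sub.refl X), fun F U hF hU => mem_pow.2 fun x hx => ?_,
    fun U V W hU hV hW => mem_pow.2 fun x hx => mem_pow.1 hU x ((hW x).1 hx).1⟩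
  obtain ⟨V, hV, hx⟩ := (hU x).1 hx
  exact mem_pow.1 (hF V hV) x hx

theorem isHausdorff_discrete (X : M) : IsHausdorff X (pow X) := by
  intro x y hx hy hxy
  refine ⟨upair x x, upair y y, ?_, ?_, by simp, by simp, fun z hz => ?_⟩
  · rw [mem_pow]; intro z hz; simp only [mem_upair, or_self] at hz; rwa [hz]
  · rw [mem_pow]; intro z hz; simp only [mem_upair, or_self] at hz; rwa [hz]
  · simp only [mem_upair, or_self] at hz; exact hxy (hz.1.symm.trans hz.2)

theorem isTopology_cantorTop : IsTopology (cantor : M) cantorTop :=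
  (isTopology_discrete two).powTop

theorem isHausdorff_cantorTop : IsHausdorff (cantor : M) cantorTop :=
  (isHausdorff_discrete two).powTop (isTopology_discrete two)

/-- The sets of all binary sequences with a given initial segment form a base of the Cantor cube. -/
theorem mem_cantorTop {U : M} : U ∈ᴹ cantorTop ↔ Sub U cantor ∧ ∀ z, z ∈ᴹ U →
    ∃ m, m ∈ᴹ nats ∧ ∀ z', z' ∈ᴹ cantor → Agree m z z' → z' ∈ᴹ U := by
  rw [cantorTop, mem_powTop]
  refine and_congr_right fun hU => forall₂_congr fun z hz => ?_
  replace hz := mem_cantor.1 (hU z hz)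
  constructor
  · rintro ⟨V, ⟨hV, k, hk, hVk⟩, hzV, h⟩
    refine ⟨k, hk, fun z' hz' hag => h z' hz' fun n hn => ?_⟩
    rcases natLe_or_mem hk hn with hkn | hnk
    · rw [hVk n hn hkn]; exact (mem_cantor.1 hz').app_mem hn
    · rw [← hag n hnk]; exact hzV n hn
  · rintro ⟨m, hm, h⟩
    classical
    have happ : ∀ n, n ∈ᴹ nats →
        app (lam nats fun n => if n ∈ᴹ m then upair (app z n) (app z n) else two) n =
          if n ∈ᴹ m then upair (app z n) (app z n) else two := fun n hn => app_lam (by fun_prop) hn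
    refine ⟨lam nats fun n => if n ∈ᴹ m then upair (app z n) (app z n) else two,
      ⟨isFun_lam (by fun_prop) fun n hn => ?_, m, hm, fun n hn hmn => ?_⟩, fun n hn => ?_,
      fun z' hz' hn => h z' hz' fun i hi => ?_⟩
    · rw [mem_pow]
      intro x hx
      split_ifs at hx
      · simp only [mem_upair, or_self] at hx; rw [hx]; exact hz.app_mem hn
      · exact hx
    · rw [happ n hn, if_neg fun h => not_mem_self n (hmn.mem h hn)]
    · rw [happ n hn]
      split_ifs
      exacts [by simp, hz.app_mem hn]
    · have hin := mem_nats_of_mem hi hm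
      have := hn i hin
      rw [happ i hin, if_pos hi] at this
      exact (by simpa using this : app z' i = app z i).symm

/-- The set of all binary sequences that agree with `z` below `m`. -/
noncomputable def ball (m z : M) : M := sep cantor fun z' => Agree m z z'

theorem mem_ball {m z z' : M} : z' ∈ᴹ ball m z ↔ z' ∈ᴹ cantor ∧ Agree m z z' :=
  mem_sep (by fun_prop)

theorem ball_open {m z : M} (hm : m ∈ᴹ nats) : ball m z ∈ᴹ cantorTop := by
  refine mem_cantorTop.2 ⟨fun z' hz' => (mem_ball.1 hz').1, fun z' hz' => ⟨m, hm, fun z'' h h' => ?_⟩⟩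
  exact mem_ball.2 ⟨h, (mem_ball.1 hz').2.trans h'⟩

theorem exists_cantor : ∃ z : M, z ∈ᴹ cantor :=
  ⟨_, mem_cantor.2 (isFun_constSeq (mem_two.2 (.inl rfl)))⟩

open Classical in
/-- A form of König's lemma that needs no choice: `B m z` says that the initial segment of length `m`
of `z` is a node of a binary tree, and the leftmost infinite path of nodes without dead ends is defined
by recursion. -/
theorem exists_branch {B : M → M → Prop} (hB : Def (fun p : M × M => B p.1 p.2))
    (hcongr : ∀ m z z', m ∈ᴹ nats → z ∈ᴹ cantor → z' ∈ᴹ cantor → Agree m z z' → B m z → B m z')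
    (h0 : ∃ z, z ∈ᴹ cantor ∧ B zero z)
    (hs : ∀ m z, m ∈ᴹ nats → z ∈ᴹ cantor → B m z →
      ∃ z', z' ∈ᴹ cantor ∧ Agree m z z' ∧ B (succ m) z') :
    ∃ z, z ∈ᴹ cantor ∧ ∀ m, m ∈ᴹ nats → B m z := by
  obtain ⟨z₀, hz₀, hBz₀⟩ := h0
  -- keep the first `m` digits and choose the next digit, preferring `0`
  let G : M → M → M := fun m z =>
    if B (succ m) (update z m zero) then update z m zero else update z m one
  have hGd : DefF (fun p : M × M => G p.1 p.2) := by fun_prop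
  have hupd : ∀ m z a : M, z ∈ᴹ cantor → a ∈ᴹ two → update z m a ∈ᴹ cantor := fun m z a hz ha =>
    mem_cantor.2 (isFun_update (mem_cantor.1 hz) ha)
  have hG : ∀ m z, m ∈ᴹ nats → z ∈ᴹ cantor → G m z ∈ᴹ cantor := by
    intro m z hm hz
    simp only [G]
    split_ifs
    exacts [hupd _ _ _ hz (mem_two.2 (.inl rfl)), hupd _ _ _ hz (mem_two.2 (.inr rfl))]
  have hupda : ∀ m z a : M, m ∈ᴹ nats → Agree m z (update z m a) := fun m z a hm i hi => by
    rw [app_update_of_ne (mem_nats_of_mem hi hm)]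
    rintro rfl; exact not_mem_self i hi
  have hGa : ∀ m z, m ∈ᴹ nats → Agree m z (G m z) := by
    intro m z hm
    simp only [G]
    split_ifs <;> exact hupda _ _ _ hm
  obtain ⟨hF, hF0, hFs⟩ := natRec_spec hGd hz₀ hG
  set F := natRec cantor z₀ G
  have hFd : DefF fun n => app F n := by fun_prop
  have hBF : ∀ m, m ∈ᴹ nats → B m (app F m) := by
    refine nat_induction (by fun_prop) (by rwa [hF0]) fun m hm ih => ?_
    rw [hFs m hm]
    obtain ⟨z', hz', hag, hBz'⟩ := hs m _ hm (hF.app_mem hm) ih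
    have key : B (succ m) (update (app F m) m (app z' m)) := by
      refine hcongr _ z' _ (succ_mem_nats hm) hz' (hupd _ _ _ (hF.app_mem hm)
        ((mem_cantor.1 hz').app_mem hm)) (fun i hi => ?_) hBz'
      rcases mem_succ.1 hi with hi | rfl
      · rw [← hag i hi, hupda m _ _ hm i hi]
      · rw [app_update_self hm]
    simp only [G]
    split_ifs with h
    · exact h
    · rcases mem_two.1 ((mem_cantor.1 hz').app_mem hm) with e | e
      · rw [e] at key; exact absurd key h
      · rwa [e] at key
  have hag : ∀ n, n ∈ᴹ nats → ∀ m, NatLe m n → Agree m (app F m) (app F n) := by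
    refine nat_induction (by fun_prop) ?_ fun n hn ih m hm => ?_
    · rintro m (h | rfl)
      exacts [absurd h (not_mem_zero m), Agree.refl _ _]
    · rcases hm with h | rfl
      · have hmn : NatLe m n := mem_succ.1 h
        refine (ih m hmn).trans ?_
        rw [hFs n hn]
        exact (hGa n _ hn).mono hmn hn
      · exact Agree.refl _ _
  -- the branch is the diagonal of the sequence `F` of better and better approximations
  have happ : ∀ n, n ∈ᴹ nats → app (lam nats fun i => app (app F (succ i)) i) n =
    app (app F (succ n)) n := fun n hn => app_lam (by fun_prop) hn
  have hz : lam nats (fun i => app (app F (succ i)) i) ∈ᴹ cantor := mem_cantor.2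
    (isFun_lam (by fun_prop) fun i hi => (mem_cantor.1 (hF.app_mem (succ_mem_nats hi))).app_mem hi)
  refine ⟨_, hz, fun m hm => hcongr m _ _ hm (hF.app_mem hm) hz (fun i hi => ?_) (hBF m hm)⟩
  have hi' := mem_nats_of_mem hi hm
  rw [happ i hi']
  exact (hag m hm (succ i) (succ_natLe hi hm) i (mem_succ.2 (.inr rfl))).symm

/-- The map `f` is continuous on the subset `C` of the Cantor cube, for the topology `T` on its values. -/
def ContOn (f : M → M) (C T : M) : Prop := ∀ z, z ∈ᴹ C → ∀ U, U ∈ᴹ T → f z ∈ᴹ U →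
  ∃ m, m ∈ᴹ nats ∧ ∀ z', z' ∈ᴹ C → Agree m z z' → f z' ∈ᴹ U

theorem ContOn.mono {f : M → M} {C K T : M} (h : ContOn f K T) (hCK : Sub C K) : ContOn f C T := by
  intro z hz U hU hzU
  obtain ⟨m, hm, hm'⟩ := h z (hCK z hz) U hU hzU
  exact ⟨m, hm, fun z' hz' => hm' z' (hCK z' hz')⟩

theorem mem_of_closed {C z : M} (hC : IsClosedIn cantor cantorTop C) (hz : z ∈ᴹ cantor)
    (h : ∀ m, m ∈ᴹ nats → ∃ z', z' ∈ᴹ C ∧ Agree m z z') : z ∈ᴹ C := by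
  by_contra hzC
  rw [isClosedIn_iff, mem_cantorTop] at hC
  obtain ⟨m, hm, hm'⟩ := hC.2.2 z (mem_diff.2 ⟨hz, hzC⟩)
  obtain ⟨z', hz', hag⟩ := h m hm
  exact (mem_diff.1 (hm' z' (hC.1 z' hz') hag)).2 hz'

/-- The image of a closed subset of the Cantor cube under a continuous map to a Hausdorff space is
closed: if `x` is in its closure, then a branch of initial segments of sequences in `C` with values
arbitrarily close to `x` leads to an element of `C` that is mapped to `x`. -/
theorem closed_image {f : M → M} (hf : DefF f) {C X T x : M} (hC : IsClosedIn cantor cantorTop C)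
    (hT : IsTopology X T) (hX : IsHausdorff X T) (hfX : ∀ z, z ∈ᴹ C → f z ∈ᴹ X)
    (hcont : ContOn f C T) (hx : x ∈ᴹ X) (hxf : ∀ z, z ∈ᴹ C → f z ≠ x) :
    ∃ W, W ∈ᴹ T ∧ x ∈ᴹ W ∧ ∀ z, z ∈ᴹ C → ¬ f z ∈ᴹ W := by
  by_contra! hcon
  obtain ⟨z, hz, hBz⟩ : ∃ z, z ∈ᴹ cantor ∧ ∀ m, m ∈ᴹ nats →
      ∀ W, W ∈ᴹ T → x ∈ᴹ W → ∃ z', z' ∈ᴹ C ∧ Agree m z z' ∧ f z' ∈ᴹ W := by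
    refine exists_branch
      (B := fun m z => ∀ W, W ∈ᴹ T → x ∈ᴹ W → ∃ z', z' ∈ᴹ C ∧ Agree m z z' ∧ f z' ∈ᴹ W)
      (by fun_prop) ?_ ?_ ?_
    · intro m z z' hm _ _ hag h W hW hxW
      obtain ⟨z'', h1, h2, h3⟩ := h W hW hxW
      exact ⟨z'', h1, hag.symm.trans h2, h3⟩
    · obtain ⟨z, hz⟩ := exists_cantor (M := M)
      refine ⟨z, hz, fun W hW hxW => ?_⟩
      obtain ⟨z', hz', h⟩ := hcon W hW hxW
      exact ⟨z', hz', fun i hi => absurd hi (not_mem_zero i), h⟩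
    · intro m z hm hz h
      by_contra! h'
      have hupd : ∀ a, a ∈ᴹ two → update z m a ∈ᴹ cantor ∧ Agree m z (update z m a) := by
        refine fun a ha => ⟨mem_cantor.2 (isFun_update (mem_cantor.1 hz) ha), fun i hi => ?_⟩
        rw [app_update_of_ne (mem_nats_of_mem hi hm)]
        rintro rfl; exact not_mem_self i hi
      have h0 := hupd zero (mem_two.2 (.inl rfl))
      have h1 := hupd one (mem_two.2 (.inr rfl))
      obtain ⟨W₀, hW₀, hxW₀, hW₀'⟩ := h' _ h0.1 h0.2
      obtain ⟨W₁, hW₁, hxW₁, hW₁'⟩ := h' _ h1.1 h1.2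
      obtain ⟨z', hz', hag, hzW⟩ := h _ (hT.inter_mem hW₀ hW₁) (mem_inter.2 ⟨hxW₀, hxW₁⟩)
      rw [mem_inter] at hzW
      have hag' : Agree (succ m) (update z m (app z' m)) z' := by
        intro i hi
        rcases mem_succ.1 hi with hi | rfl
        · rw [app_update_of_ne (mem_nats_of_mem hi hm), hag i hi]
          rintro rfl; exact not_mem_self i hi
        · rw [app_update_self hm]
      rcases mem_two.1 ((mem_cantor.1 (hC.1 z' hz')).app_mem hm) with e | e
      · rw [e] at hag'; exact hW₀' z' hz' hag' hzW.1
      · rw [e] at hag'; exact hW₁' z' hz' hag' hzW.2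
  have hzC : z ∈ᴹ C := mem_of_closed hC hz fun m hm => by
    obtain ⟨z', hz', hag, -⟩ := hBz m hm X hT.2.1 hx
    exact ⟨z', hz', hag⟩
  obtain ⟨U, V, hU, hV, hzU, hxV, hUV⟩ := hX _ _ (hfX z hzC) hx (hxf z hzC)
  obtain ⟨m, hm, hm'⟩ := hcont z hzC U hU hzU
  obtain ⟨z', hz', hag, hzV⟩ := hBz m hm V hV hxV
  exact hUV _ ⟨hm' z' hz' hag, hzV⟩

/-- If the Cantor cube is sequential, then so is every Hausdorff space that is a continuous image of a
closed subset of it: such an image is a quotient. -/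
theorem IsSequential.of_image {f : M → M} (hf : DefF f) {K X T : M}
    (h : IsSequential (cantor : M) cantorTop) (hK : IsClosedIn cantor cantorTop K)
    (hT : IsTopology X T) (hX : IsHausdorff X T) (hfX : ∀ z, z ∈ᴹ K → f z ∈ᴹ X)
    (hcont : ContOn f K T) (hsurj : ∀ x, x ∈ᴹ X → ∃ z, z ∈ᴹ K ∧ f z = x) :
    IsSequential X T := by
  rw [isSequential_iff] at h ⊢
  refine ⟨hT, fun A hA => ?_⟩
  rw [isSeqClosedIn_iff] at hA
  have hd : Def (fun z : M => f z ∈ᴹ A) := by fun_prop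
  have hCK : Sub (sep K fun z => f z ∈ᴹ A) K := fun z hz => ((mem_sep hd).1 hz).1
  have hC : IsClosedIn cantor cantorTop (sep K fun z => f z ∈ᴹ A) := by
    refine h.2 _ (isSeqClosedIn_iff.2 ⟨fun z hz => hK.1 z (hCK z hz), fun s z hs hz hsz => ?_⟩)
    have hzK : z ∈ᴹ K := (isSeqClosedIn_iff.1 hK.isSeqClosedIn).2 s z
      (hs.mono fun n hn => hCK _ (hs.app_mem hn)) hz hsz
    refine (mem_sep hd).2 ⟨hzK, ?_⟩
    have hfun : IsFun (lam nats fun n => f (app s n)) nats A :=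
      isFun_lam (by fun_prop) fun n hn => ((mem_sep hd).1 (hs.app_mem hn)).2
    refine hA.2 _ _ hfun (hfX z hzK) ((convergesTo_iff hfun).2 fun U hU hzU => ?_)
    obtain ⟨m, hm, hm'⟩ := hcont z hzK U hU hzU
    obtain ⟨n, hn, hn'⟩ := (convergesTo_iff hs).1 hsz _ (ball_open hm)
      (mem_ball.2 ⟨hz, Agree.refl m z⟩)
    refine ⟨n, hn, fun k hk hnk => ?_⟩
    rw [app_lam (by fun_prop) hk]
    exact hm' _ (hCK _ (hs.app_mem hk)) (mem_ball.1 (hn' k hk hnk)).2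
  refine hT.closed_of_nhds hA.1 fun x hx hxA => ?_
  obtain ⟨W, hW, hxW, hWA⟩ := closed_image hf hC hT hX (fun z hz => hfX z (hCK z hz))
    (hcont.mono hCK) hx (by rintro z hz rfl; exact hxA ((mem_sep hd).1 hz).2)
  refine ⟨W, hW, hxW, fun y hy hyA => ?_⟩
  obtain ⟨z, hz, rfl⟩ := hsurj y (hA.1 y hyA)
  exact hWA z ((mem_sep hd).2 ⟨hz, hyA⟩) hy

theorem isClosedIn_cantor : IsClosedIn (cantor : M) cantorTop cantor := by
  rw [isClosedIn_iff]
  refine ⟨Sub.refl _, ?_⟩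
  rw [show diff (cantor : M) cantor = zero from ext fun z => by simp]
  exact isTopology_cantorTop.empty_mem

/-- If some sequential Hausdorff space contains a copy of the Cantor cube, then the Cantor cube is
sequential: the copy is closed. -/
theorem IsSequential.of_embedding {f : M → M} (hf : DefF f) {X T : M} (h : IsSequential X T)
    (hX : IsHausdorff X T) (hfX : ∀ z, z ∈ᴹ cantor → f z ∈ᴹ X) (hcont : ContOn f cantor T)
    (hinj : ∀ z z', z ∈ᴹ cantor → z' ∈ᴹ cantor → f z = f z' → z = z') :
    IsSequential (cantor : M) cantorTop := by
  rw [isSequential_iff] at h ⊢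
  refine ⟨isTopology_cantorTop, fun A hA => ?_⟩
  rw [isSeqClosedIn_iff] at hA
  have hmem : ∀ z, z ∈ᴹ cantor → (f z ∈ᴹ image A f ↔ z ∈ᴹ A) := by
    intro z hz
    rw [mem_image hf]
    constructor
    · rintro ⟨z', hz', e⟩; rwa [hinj z z' hz (hA.1 z' hz') e]
    · intro hz; exact ⟨z, hz, rfl⟩
  have hcl : IsClosedIn X T (image A f) := by
    refine h.2 _ (isSeqClosedIn_iff.2 ⟨fun x hx => ?_, fun s x hs hx hsx => ?_⟩)
    · obtain ⟨z, hz, rfl⟩ := (mem_image hf).1 hx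
      exact hfX z (hA.1 z hz)
    rw [convergesTo_iff hs] at hsx
    have hsz : ∀ n, n ∈ᴹ nats → ∃ z, z ∈ᴹ A ∧ app s n = f z := fun n hn =>
      (mem_image hf).1 (hs.app_mem hn)
    obtain ⟨y, hy, rfl⟩ : ∃ y, y ∈ᴹ cantor ∧ f y = x := by
      by_contra! hxf
      obtain ⟨W, hW, hxW, hWf⟩ := closed_image hf isClosedIn_cantor h.1 hX hfX hcont hx hxf
      obtain ⟨n, hn, hn'⟩ := hsx W hW hxW
      obtain ⟨z, hz, e⟩ := hsz n hn
      exact hWf z (hA.1 z hz) (e ▸ hn' n hn (natLe_refl n))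
    refine (hmem y hy).2 ?_
    -- the sequence of the unique preimages in `A`
    have hpre : ∀ n, n ∈ᴹ nats → ∃ z, z ∈ᴹ A ∧ f z = app s n ∧
        app (lam nats fun n => the A fun z => app s n = f z) n = z := by
      intro n hn
      obtain ⟨z, hz, e⟩ := hsz n hn
      refine ⟨z, hz, e.symm, ?_⟩
      rw [app_lam (by fun_prop) hn]
      exact the_eq (by fun_prop) hz e fun z' hz' e' =>
        hinj z' z (hA.1 z' hz') (hA.1 z hz) (e'.symm.trans e)
    have hfun : IsFun (lam nats fun n => the A fun z => app s n = f z) nats A :=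
      (isFun_lam (b := image nats fun n => the A fun z => app s n = f z) (by fun_prop)
        fun n hn => (mem_image (by fun_prop)).2 ⟨n, hn, rfl⟩).mono fun n hn => by
          obtain ⟨z, hz, -, e⟩ := hpre n hn; rwa [e]
    refine hA.2 _ _ hfun hy ((convergesTo_iff hfun).2 fun U hU hyU => ?_)
    -- the image of the complement of a neighbourhood of `y` is closed and does not contain `f y`
    have hCsub : Sub (diff cantor U) cantor := fun z hz => (mem_diff.1 hz).1
    have hC : IsClosedIn cantor cantorTop (diff cantor U) := by
      refine isClosedIn_iff.2 ⟨hCsub, ?_⟩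
      rwa [show diff cantor (diff cantor U) = U from ext fun z => ?_]
      simp only [mem_diff]
      have := isTopology_cantorTop.1 U hU z
      tauto
    obtain ⟨W, hW, hyW, hWf⟩ := closed_image hf hC h.1 hX (fun z hz => hfX z (hCsub z hz))
      (hcont.mono hCsub) hx (fun z hz e => (mem_diff.1 hz).2 (by
        rwa [hinj z y (hCsub z hz) hy e]))
    obtain ⟨n, hn, hn'⟩ := hsx W hW hyW
    refine ⟨n, hn, fun m hm hnm => ?_⟩
    obtain ⟨z, hz, e, e'⟩ := hpre m hm
    rw [e']
    by_contra hzU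
    exact hWf z (mem_diff.2 ⟨hA.1 z hz, hzU⟩) (e ▸ hn' m hm hnm)
  rw [isClosedIn_iff] at hcl
  refine isClosedIn_iff.2 ⟨hA.1, mem_cantorTop.2 ⟨fun z hz => (mem_diff.1 hz).1, fun z hz => ?_⟩⟩
  rw [mem_diff] at hz
  obtain ⟨m, hm, hm'⟩ := hcont z hz.1 _ hcl.2
    (mem_diff.2 ⟨hfX z hz.1, fun h => hz.2 ((hmem z hz.1).1 h)⟩)
  refine ⟨m, hm, fun z' hz' hag => mem_diff.2 ⟨hz', fun hzA => ?_⟩⟩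
  exact (mem_diff.1 (hm' z' hz' hag)).2 ((hmem z' hz').2 hzA)

end Powers

/-! ### Finite and countable sets -/

section Finite

variable {M : Type u} [setLang.Structure M] {Γ : Type u} [Ctx M Γ] [hM : Fact (IsZFModel M)]

theorem isInj_iff {f a b : M} : IsInj f a b ↔
    IsFun f a b ∧ ∀ x x', x ∈ᴹ a → x' ∈ᴹ a → app f x = app f x' → x = x' := by
  refine and_congr_right fun hf => ?_
  simp only [hf.app_iff]
  constructor
  · intro h x x' hx hx' e; exact h x x' _ ⟨hx, rfl⟩ ⟨hx', e⟩
  · rintro h x x' y ⟨hx, rfl⟩ ⟨hx', e⟩; exact h x x' hx hx' e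

theorem isBij_iff {f a b : M} : IsBij f a b ↔ IsFun f a b ∧
    (∀ x x', x ∈ᴹ a → x' ∈ᴹ a → app f x = app f x' → x = x') ∧
      ∀ y, y ∈ᴹ b → ∃ x, x ∈ᴹ a ∧ app f x = y := by
  rw [IsBij, isInj_iff, and_assoc]
  refine and_congr_right fun hf => and_congr_right fun _ => forall₂_congr fun y hy =>
    exists_congr fun x => ?_
  rw [hf.app_iff, eq_comm]
  tauto

@[fun_prop] theorem Def.isBij {f a b : Γ → M} (hf : DefF f) (ha : DefF a) (hb : DefF b) :
    Def (fun g => IsBij (f g) (a g) (b g)) := by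
  simp only [isBij_iff]; fun_prop

@[fun_prop] theorem Def.isFinite {s : Γ → M} (hs : DefF s) : Def (fun g => IsFinite (s g)) := by
  simp only [IsFinite, isNat_iff]; fun_prop

theorem isFinite_nat {n : M} (hn : n ∈ᴹ nats) : IsFinite n := by
  refine ⟨n, lam n fun x => x, isNat_iff.2 hn, isBij_iff.2
    ⟨isFun_lam (by fun_prop) fun _ h => h, fun x x' hx hx' e => ?_, fun y hy =>
      ⟨y, hy, app_lam (by fun_prop) hy⟩⟩⟩
  rwa [app_lam (by fun_prop) hx, app_lam (by fun_prop) hx'] at e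

open Classical in
theorem IsFinite.insert {d : M} (h : IsFinite d) (u : M) : IsFinite (cup d (upair u u)) := by
  by_cases hu : u ∈ᴹ d
  · rwa [show cup d (upair u u) = d from ext fun z => ?_]
    simp only [mem_cup, mem_upair, or_self, or_iff_left_iff_imp]
    rintro rfl; exact hu
  obtain ⟨n, f, hn, hf⟩ := h
  obtain ⟨hf, hinj, hsurj⟩ := isBij_iff.1 hf
  have hself : app (lam (succ n) fun i => if i = n then u else app f i) n = u := by
    rw [app_lam (by fun_prop) (by simp), if_pos rfl]
  have hlt : ∀ i, i ∈ᴹ n → app (lam (succ n) fun i => if i = n then u else app f i) i = app f i := by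
    intro i hi
    rw [app_lam (by fun_prop) (by simp [hi]), if_neg]
    rintro rfl; exact not_mem_self i hi
  refine ⟨succ n, lam (succ n) fun i => if i = n then u else app f i,
    isNat_iff.2 (succ_mem_nats (isNat_iff.1 hn)), isBij_iff.2 ⟨isFun_lam (by fun_prop) fun i hi => ?_,
      fun i j hi hj e => ?_, fun y hy => ?_⟩⟩
  · rw [mem_cup]
    split_ifs with h
    · right; simp
    · exact .inl (hf.app_mem ((mem_succ.1 hi).resolve_right h))
  · rcases mem_succ.1 hi with hi | rfl <;> rcases mem_succ.1 hj with hj | rfl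
    · rw [hlt i hi, hlt j hj] at e; exact hinj i j hi hj e
    · rw [hlt i hi, hself] at e; exact absurd (e ▸ hf.app_mem hi) hu
    · rw [hlt j hj, hself] at e; exact absurd (e ▸ hf.app_mem hj) hu
    · rfl
  · rcases mem_cup.1 hy with hy | hy
    · obtain ⟨x, hx, rfl⟩ := hsurj y hy
      exact ⟨x, by simp [hx], hlt x hx⟩
    · simp only [mem_upair, or_self] at hy
      exact ⟨n, by simp, hy ▸ hself⟩

/-- Induction on finite sets. -/
theorem IsFinite.induction {P : M → Prop} (hP : Def P) (h0 : P zero)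
    (hs : ∀ d u, P d → P (cup d (upair u u))) {d : M} (hd : IsFinite d) : P d := by
  obtain ⟨n, f, hn, hf⟩ := hd
  refine nat_induction (P := fun n => ∀ d f, IsBij f n d → P d)
    (by fun_prop) (fun d f hf => ?_) (fun n hn ih d f hf => ?_) n (isNat_iff.1 hn) d f hf
  · rwa [show d = zero from ext fun z => ?_]
    simp only [not_mem_zero, iff_false]
    intro hz
    obtain ⟨x, hx, -⟩ := (isBij_iff.1 hf).2.2 z hz
    exact not_mem_zero x hx
  · obtain ⟨hf, hinj, hsurj⟩ := isBij_iff.1 hf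
    have hnn : n ∈ᴹ succ n := by simp
    have hsub : ∀ i, i ∈ᴹ n → i ∈ᴹ succ n := fun i hi => by simp [hi]
    have happ : ∀ i, i ∈ᴹ n → app (lam n fun i => app f i) i = app f i := fun i hi =>
      app_lam (by fun_prop) hi
    have himg : ∀ y, y ∈ᴹ image n (fun i => app f i) ↔ ∃ i, i ∈ᴹ n ∧ y = app f i := fun y =>
      mem_image (by fun_prop)
    rw [show d = cup (image n fun i => app f i) (upair (app f n) (app f n)) from ext fun z => ?_]
    · refine hs _ _ (ih _ (lam n fun i => app f i) (isBij_iff.2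
        ⟨isFun_lam (by fun_prop) fun i hi => (himg _).2 ⟨i, hi, rfl⟩, fun i j hi hj e => ?_,
          fun y hy => ?_⟩))
      · rw [happ i hi, happ j hj] at e
        exact hinj i j (hsub i hi) (hsub j hj) e
      · obtain ⟨i, hi, rfl⟩ := (himg y).1 hy
        exact ⟨i, hi, happ i hi⟩
    · simp only [mem_cup, himg, mem_upair, or_self]
      constructor
      · intro hz
        obtain ⟨i, hi, rfl⟩ := hsurj z hz
        rcases mem_succ.1 hi with hi | rfl
        exacts [.inl ⟨i, hi, rfl⟩, .inr rfl]
      · rintro (⟨i, hi, rfl⟩ | rfl)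
        exacts [hf.app_mem (hsub i hi), hf.app_mem hnn]

theorem IsFinite.union {c d : M} (hc : IsFinite c) (hd : IsFinite d) : IsFinite (cup c d) := by
  refine hd.induction (P := fun d => IsFinite (cup c d)) (by fun_prop) ?_ fun d u h => ?_
  · rwa [show cup c zero = c from ext fun z => by simp]
  · rw [show cup c (cup d (upair u u)) = cup (cup c d) (upair u u) from ext fun z => by
      simp [or_assoc]]
    exact h.insert u

/-- Finitely many natural numbers have a common upper bound. -/
theorem IsFinite.exists_bound {φ : M → M → Prop} (hφ : Def (fun p : M × M => φ p.1 p.2)) {d : M}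
    (hd : IsFinite d) (hmono : ∀ u m n, m ∈ᴹ nats → n ∈ᴹ nats → NatLe m n → φ u m → φ u n)
    (h : ∀ u, u ∈ᴹ d → ∃ m, m ∈ᴹ nats ∧ φ u m) :
    ∃ m, m ∈ᴹ nats ∧ ∀ u, u ∈ᴹ d → φ u m := by
  refine hd.induction (P := fun d => (∀ u, u ∈ᴹ d → ∃ m, m ∈ᴹ nats ∧ φ u m) →
    ∃ m, m ∈ᴹ nats ∧ ∀ u, u ∈ᴹ d → φ u m) (by fun_prop)
    (fun _ => ⟨zero, zero_mem_nats, by simp⟩) (fun d u ih h => ?_) h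
  obtain ⟨m, hm, hm'⟩ := ih fun v hv => h v (mem_cup.2 (.inl hv))
  obtain ⟨n, hn, hn'⟩ := h u (mem_cup.2 (.inr (by simp)))
  obtain ⟨l, hl, hml, hnl⟩ := exists_natLe hm hn
  refine ⟨l, hl, fun v hv => ?_⟩
  rcases mem_cup.1 hv with hv | hv
  · exact hmono v m l hm hl hml (hm' v hv)
  · simp only [mem_upair, or_self] at hv
    subst hv
    exact hmono v n l hn hl hnl hn'

/-- A set is countable if its elements can be coded by natural numbers. -/
theorem isCountable_of_code {φ : M → M → Prop} (hφ : Def (fun p : M × M => φ p.1 p.2)) {B : M}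
    (hex : ∀ u, u ∈ᴹ B → ∃ k, k ∈ᴹ nats ∧ φ u k)
    (hinj : ∀ u v k, u ∈ᴹ B → v ∈ᴹ B → φ u k → φ v k → u = v) : IsCountable B := by
  have key : ∀ u, u ∈ᴹ B → ∃ k, k ∈ᴹ nats ∧ φ u k ∧
      app (lam B fun u => the nats fun k => φ u k ∧ ∀ j, j ∈ᴹ k → ¬ φ u j) u = k := by
    intro u hu
    obtain ⟨k, hk, hk'⟩ := hex u hu
    obtain ⟨k, hk, hk', hmin⟩ := exists_least (P := fun k => φ u k) (by fun_prop) hk hk'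
    refine ⟨k, hk, hk', ?_⟩
    rw [app_lam (by fun_prop) hu]
    refine the_eq (by fun_prop) hk ⟨hk', hmin⟩ fun j hj h => ?_
    rcases nat_trichotomy hj hk with h' | h' | h'
    exacts [absurd h.1 (hmin j h'), h', absurd hk' (h.2 k h')]
  refine ⟨nats, lam B fun u => the nats fun k => φ u k ∧ ∀ j, j ∈ᴹ k → ¬ φ u j, isOmega_nats,
    isInj_iff.2 ⟨?_, fun u v hu hv e => ?_⟩⟩
  · refine (isFun_lam (b := image B fun u => the nats fun k => φ u k ∧ ∀ j, j ∈ᴹ k → ¬ φ u j)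
      (by fun_prop) fun u hu => (mem_image (by fun_prop)).2 ⟨u, hu, rfl⟩).mono fun u hu => ?_
    obtain ⟨k, hk, -, e⟩ := key u hu
    rwa [e]
  · obtain ⟨k, -, hk, e1⟩ := key u hu
    obtain ⟨l, -, hl, e2⟩ := key v hv
    obtain rfl : k = l := e1.symm.trans (e.trans e2)
    exact hinj u v k hu hv hk hl

/-- An injective coding of pairs of natural numbers by natural numbers. -/
noncomputable def npair (m n : M) : M := add (mul (add m n) (add m n)) m

@[fun_prop] theorem DefF.npair {x y : Γ → M} (hx : DefF x) (hy : DefF y) :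
    DefF (fun g => npair (x g) (y g)) := by unfold InternalZF.npair; fun_prop

theorem npair_mem {m n : M} (hm : m ∈ᴹ nats) (hn : n ∈ᴹ nats) : npair m n ∈ᴹ nats :=
  add_mem (mul_mem (add_mem hm hn) (add_mem hm hn)) hm

theorem N.sq_add_lt {a b c d : N M} (h : a + b < c + d) :
    (a + b) * (a + b) + a < (c + d) * (c + d) + c := by
  have h1 := N.succ_le_iff.2 h
  calc (a + b) * (a + b) + a < (a + b) * (a + b) + a + ((a + b) + b + 1) := by
        refine lt_add_of_pos_right _ (lt_of_lt_of_le N.one_pos ?_)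
        exact le_add_of_nonneg_left (N.zero_le _)
    _ = (a + b + 1) * (a + b + 1) := by ring
    _ ≤ (c + d) * (c + d) := mul_le_mul h1 h1 (N.zero_le _) (N.zero_le _)
    _ ≤ (c + d) * (c + d) + c := le_add_of_nonneg_right (N.zero_le _)

theorem npair_inj {m n m' n' : M} (hm : m ∈ᴹ nats) (hn : n ∈ᴹ nats) (hm' : m' ∈ᴹ nats)
    (hn' : n' ∈ᴹ nats) (h : npair m n = npair m' n') : m = m' ∧ n = n' := by
  let a : N M := ⟨m, hm⟩
  let b : N M := ⟨n, hn⟩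
  let c : N M := ⟨m', hm'⟩
  let d : N M := ⟨n', hn'⟩
  have e : (a + b) * (a + b) + a = (c + d) * (c + d) + c := N.ext h
  have hs : a + b = c + d := by
    rcases lt_trichotomy (a + b) (c + d) with h | h | h
    exacts [absurd e (N.sq_add_lt h).ne, h, absurd e (N.sq_add_lt h).ne']
  rw [hs] at e
  have hac : a = c := add_left_cancel e
  rw [hac] at hs
  have hbd : b = d := add_left_cancel hs
  exact ⟨congrArg N.val hac, congrArg N.val hbd⟩

end Finite

/-! ### Compact spaces with a countable base are images of closed subsets of the Cantor cube -/

section Compact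

variable {M : Type u} [setLang.Structure M] [hM : Fact (IsZFModel M)]

theorem closed_of_limits {K : M} (hK : Sub K cantor) (h : ∀ z, z ∈ᴹ cantor →
    (∀ m, m ∈ᴹ nats → ∃ z', z' ∈ᴹ K ∧ Agree m z z') → z ∈ᴹ K) :
    IsClosedIn cantor cantorTop K := by
  refine isTopology_cantorTop.closed_of_nhds hK fun z hz hzK => ?_
  by_contra! h'
  refine hzK (h z hz fun m hm => ?_)
  obtain ⟨z', h1, h2⟩ := h' _ (ball_open hm) (mem_ball.2 ⟨hz, Agree.refl m z⟩)
  exact ⟨z', h2, (mem_ball.1 h1).2⟩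

open Classical in
/-- Let `B` be a countable base of `X`. Each pair of disjoint sets `U, V ∈ B` gives a cover of `X` by
the closed sets `X \ U` and `X \ V`.  A binary sequence selects one set from each of these covers.
Distinct points are separated by some cover, so a selection has at most one common point, and by
compactness the selections with a common point form a closed subset of the Cantor cube, on which the
common point depends continuously on the selection. -/
theorem IsSequential.of_compact (h : IsSequential (cantor : M) cantorTop) {X T : M}
    (hT : IsTopology X T) (hB : IsSecondCountable T) (hc : IsCompactSpace X T)
    (hX : IsHausdorff X T) : IsSequential X T := by
  obtain ⟨B, ⟨hBT, hB⟩, w, e, hw, he⟩ := hB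
  rw [isOmega_iff] at hw
  subst hw
  obtain ⟨he, hinj⟩ := isInj_iff.1 he
  -- the place at which a binary sequence chooses between `X \ U` and `X \ V`
  let code : M → M → M := fun U V => npair (app e U) (app e V)
  have hcode : ∀ U V, U ∈ᴹ B → V ∈ᴹ B → code U V ∈ᴹ nats := fun U V hU hV =>
    npair_mem (he.app_mem hU) (he.app_mem hV)
  let Pair : M → M → Prop := fun U V => U ∈ᴹ B ∧ V ∈ᴹ B ∧ ∀ x, ¬ (x ∈ᴹ U ∧ x ∈ᴹ V)
  -- `x` lies in the set that `z` chooses from the cover given by `U` and `V`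
  let Side : M → M → M → M → Prop := fun z U V x =>
    (app z (code U V) = zero → ¬ x ∈ᴹ U) ∧ (app z (code U V) = one → ¬ x ∈ᴹ V)
  -- `x` lies in all sets chosen by the digits of `z` below `m`
  let Pt : M → M → M → Prop := fun z m x =>
    x ∈ᴹ X ∧ ∀ U V, Pair U V → code U V ∈ᴹ m → Side z U V x
  -- `x` lies in all sets chosen by `z`
  let Lim : M → M → Prop := fun z x => x ∈ᴹ X ∧ ∀ U V, Pair U V → Side z U V x
  have hPtcongr : ∀ z z' m x : M, Agree m z z' → Pt z m x → Pt z' m x := by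
    intro z z' m x hag hx
    refine ⟨hx.1, fun U V hUV hm => ?_⟩
    have := hx.2 U V hUV hm
    simp only [Side] at this ⊢
    rwa [← hag _ hm]
  have hLimPt : ∀ z m x, Lim z x → Pt z m x := fun z m x hx => ⟨hx.1, fun U V hUV _ => hx.2 U V hUV⟩
  have huniq : ∀ z x y : M, z ∈ᴹ cantor → Lim z x → Lim z y → x = y := by
    intro z x y hz hx hy
    by_contra hxy
    obtain ⟨U, V, hU, hV, hxU, hyV, hUV⟩ := hX x y hx.1 hy.1 hxy
    obtain ⟨U', hU', hxU', hUU'⟩ := hB U x hU hxU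
    obtain ⟨V', hV', hyV', hVV'⟩ := hB V y hV hyV
    have hp : Pair U' V' := ⟨hU', hV', fun w hw => hUV w ⟨hUU' w hw.1, hVV' w hw.2⟩⟩
    rcases mem_two.1 ((mem_cantor.1 hz).app_mem (hcode U' V' hU' hV')) with e | e
    exacts [(hx.2 U' V' hp).1 e hxU', (hy.2 U' V' hp).2 e hyV']
  -- `W` and the complements of the sets chosen by `z` cover `X`, so by compactness finitely many do
  have hcompact : ∀ z W : M, z ∈ᴹ cantor → W ∈ᴹ T → (∀ x, Lim z x → x ∈ᴹ W) →
      ∃ m, m ∈ᴹ nats ∧ ∀ x, Pt z m x → x ∈ᴹ W := by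
    intro z W hz hW hzW
    have hd : Def (fun O : M => O = W ∨ ∃ U V, Pair U V ∧
        ((app z (code U V) = zero ∧ O = U) ∨ (app z (code U V) = one ∧ O = V))) := by
      simp only [Pair, code]; fun_prop
    obtain ⟨d, hdc, hdfin, hdX⟩ := hc (sep T fun O => O = W ∨ ∃ U V, Pair U V ∧
        ((app z (code U V) = zero ∧ O = U) ∨ (app z (code U V) = one ∧ O = V)))
      (fun O hO => ((mem_sep hd).1 hO).1) (fun x hx => by
        by_cases hl : Lim z x
        · exact ⟨W, (mem_sep hd).2 ⟨hW, .inl rfl⟩, hzW x hl⟩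
        · obtain ⟨U, V, hp, hs⟩ : ∃ U V, Pair U V ∧ ¬ Side z U V x := by
            by_contra! h'; exact hl ⟨hx, h'⟩
          simp only [Side, not_and_or, Classical.not_imp, not_not] at hs
          rcases hs with hs | hs
          · exact ⟨U, (mem_sep hd).2 ⟨hBT U hp.1, .inr ⟨U, V, hp, .inl ⟨hs.1, rfl⟩⟩⟩, hs.2⟩
          · exact ⟨V, (mem_sep hd).2 ⟨hBT V hp.2.1, .inr ⟨U, V, hp, .inr ⟨hs.1, rfl⟩⟩⟩, hs.2⟩)
    obtain ⟨m, hm, hm'⟩ := hdfin.exists_bound (φ := fun O m => ∀ x, x ∈ᴹ O → Pt z m x → x ∈ᴹ W)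
      (by simp only [Pt, Side, Pair, code]; fun_prop)
      (fun O m n _ hn hmn hO x hx hP => hO x hx ⟨hP.1, fun U V hUV hc =>
        hP.2 U V hUV (hmn.mem hc hn)⟩)
      (fun O hO => by
        rcases ((mem_sep hd).1 (hdc O hO)).2 with rfl | ⟨U, V, hp, ⟨hz0, rfl⟩ | ⟨hz1, rfl⟩⟩
        · exact ⟨zero, zero_mem_nats, fun x hx _ => hx⟩
        · refine ⟨succ (code O V), succ_mem_nats (hcode O V hp.1 hp.2.1), fun x hx hP => ?_⟩
          exact absurd hx ((hP.2 O V hp (by simp)).1 hz0)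
        · refine ⟨succ (code U O), succ_mem_nats (hcode U O hp.1 hp.2.1), fun x hx hP => ?_⟩
          exact absurd hx ((hP.2 U O hp (by simp)).2 hz1))
    refine ⟨m, hm, fun x hx => ?_⟩
    obtain ⟨O, hO, hxO⟩ := hdX x hx.1
    exact hm' O hO x hxO hx
  have hd : Def (fun z : M => ∀ m, m ∈ᴹ nats → ∃ x, Pt z m x) := by
    simp only [Pt, Side, Pair, code]; fun_prop
  have hK : ∀ z, z ∈ᴹ sep cantor (fun z => ∀ m, m ∈ᴹ nats → ∃ x, Pt z m x) ↔ _ :=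
    fun z => mem_sep hd
  have hLim : ∀ z, z ∈ᴹ sep cantor (fun z => ∀ m, m ∈ᴹ nats → ∃ x, Pt z m x) → ∃ x, Lim z x := by
    intro z hz
    rw [hK] at hz
    by_contra! hno
    obtain ⟨m, hm, hm'⟩ := hcompact z zero hz.1 hT.empty_mem fun x hx => absurd hx (hno x)
    obtain ⟨x, hx⟩ := hz.2 m hm
    exact not_mem_zero x (hm' x hx)
  have hLd : ∀ z, Def (fun x => Lim z x) := by
    intro z; simp only [Lim, Side, Pair, code]; fun_prop
  have hthe : ∀ z x : M, z ∈ᴹ cantor → Lim z x → the X (fun x => Lim z x) = x := fun z x hz hx =>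
    the_eq (hLd z) hx.1 hx fun y _ hy => huniq z y x hz hy hx
  refine h.of_image (f := fun z => the X fun x => Lim z x)
    (K := sep cantor fun z => ∀ m, m ∈ᴹ nats → ∃ x, Pt z m x)
    (by simp only [Lim, Side, Pair, code]; fun_prop)
    (closed_of_limits (fun z hz => ((hK z).1 hz).1) fun z hz hlim => (hK z).2 ⟨hz, fun m hm => ?_⟩)
    hT hX (fun z hz => ?_) (fun z hz U hU hzU => ?_) fun x hx => ?_
  · obtain ⟨z', hz', hag⟩ := hlim m hm
    obtain ⟨x, hx⟩ := ((hK z').1 hz').2 m hm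
    exact ⟨x, hPtcongr z' z m x hag.symm hx⟩
  · obtain ⟨x, hx⟩ := hLim z hz
    rw [hthe z x ((hK z).1 hz).1 hx]
    exact hx.1
  · obtain ⟨x, hx⟩ := hLim z hz
    have hz' := ((hK z).1 hz).1
    simp only [hthe z x hz' hx] at hzU
    obtain ⟨m, hm, hm'⟩ := hcompact z U hz' hU fun y hy => by rwa [huniq z y x hz' hy hx]
    refine ⟨m, hm, fun z' hz' hag => ?_⟩
    obtain ⟨x', hx'⟩ := hLim z' hz'
    simp only [hthe z' x' ((hK z').1 hz').1 hx']
    exact hm' x' (hPtcongr z' z m x' hag.symm (hLimPt z' m x' hx'))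
  -- the point `x` is selected by the sequence that chooses `X \ V` if and only if `x ∈ U`
  · have hdz : DefF (fun n : M =>
        if ∃ U V, Pair U V ∧ n = code U V ∧ x ∈ᴹ U then (one : M) else zero) := by
      refine DefF.ite ?_ (by fun_prop) (by fun_prop)
      simp only [Pair, code]; fun_prop
    have happ : ∀ n, n ∈ᴹ nats → _ := fun n hn => app_lam (a := nats) (x := n) hdz hn
    have hz : lam nats (fun n => if ∃ U V, Pair U V ∧ n = code U V ∧ x ∈ᴹ U then one else zero)
        ∈ᴹ cantor := by
      refine mem_cantor.2 (isFun_lam hdz fun n hn => ?_)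
      rw [mem_two]
      split_ifs
      exacts [.inr rfl, .inl rfl]
    have hl : Lim (lam nats fun n => if ∃ U V, Pair U V ∧ n = code U V ∧ x ∈ᴹ U then one else zero)
        x := by
      refine ⟨hx, fun U V hp => ⟨fun h0 hxU => ?_, fun h1 hxV => ?_⟩⟩
      · rw [happ _ (hcode U V hp.1 hp.2.1), if_pos ⟨U, V, hp, rfl, hxU⟩] at h0
        exact one_ne_zero' h0
      · rw [happ _ (hcode U V hp.1 hp.2.1)] at h1
        split_ifs at h1 with h'
        · obtain ⟨U', V', hp', e', hxU'⟩ := h'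
          have := npair_inj (he.app_mem hp.1) (he.app_mem hp.2.1) (he.app_mem hp'.1)
            (he.app_mem hp'.2.1) e'
          obtain rfl := hinj U U' hp.1 hp'.1 this.1
          exact hp.2.2 x ⟨hxU', hxV⟩
        · exact one_ne_zero' h1.symm
    exact ⟨_, (hK _).2 ⟨hz, fun m hm => ⟨x, hLimPt _ m x hl⟩⟩, hthe _ x hz hl⟩

end Compact

/-! ### Ternary expansions -/

section Ternary

variable {M : Type u} [setLang.Structure M] {Γ : Type u} [Ctx M Γ] [hM : Fact (IsZFModel M)]

/-- The number with the ternary digits `2 z(0), …, 2 z(n - 1)`. -/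
noncomputable def tsum (z n : M) : M :=
  app (natRec nats zero fun i x => add (mul (3 : N M).val x) (mul (2 : N M).val (app z i))) n

/-- `3 ^ n` -/
noncomputable def tpow (n : M) : M := app (natRec nats one fun _ x => mul (3 : N M).val x) n

@[fun_prop] theorem DefF.tsum {x y : Γ → M} (hx : DefF x) (hy : DefF y) :
    DefF (fun g => tsum (x g) (y g)) := by unfold InternalZF.tsum; fun_prop

@[fun_prop] theorem DefF.tpow {x : Γ → M} (hx : DefF x) : DefF (fun g => tpow (x g)) := by
  unfold InternalZF.tpow; fun_prop

theorem two_mem_nats {x : M} (hx : x ∈ᴹ two) : x ∈ᴹ nats := by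
  rcases mem_two.1 hx with rfl | rfl
  exacts [zero_mem_nats, succ_mem_nats zero_mem_nats]

theorem app_mem_nats {z n : M} (hz : z ∈ᴹ cantor) (hn : n ∈ᴹ nats) : app z n ∈ᴹ nats :=
  two_mem_nats ((mem_cantor.1 hz).app_mem hn)

theorem tsum_spec {z : M} (hz : z ∈ᴹ cantor) :
    (∀ n, n ∈ᴹ nats → tsum z n ∈ᴹ nats) ∧ tsum z zero = zero ∧ ∀ n, n ∈ᴹ nats →
      tsum z (succ n) = add (mul (3 : N M).val (tsum z n)) (mul (2 : N M).val (app z n)) := by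
  have hd : DefF (fun p : M × M =>
    add (mul (3 : N M).val p.2) (mul (2 : N M).val (app z p.1))) := by fun_prop
  have := natRec_spec (X := nats) hd zero_mem_nats fun n x hn hx =>
    add_mem (mul_mem (3 : N M).mem hx) (mul_mem (2 : N M).mem (app_mem_nats hz hn))
  exact ⟨fun n hn => this.1.app_mem hn, this.2⟩

theorem tpow_spec : (∀ n : M, n ∈ᴹ nats → tpow n ∈ᴹ nats) ∧ tpow (zero : M) = one ∧
    ∀ n : M, n ∈ᴹ nats → tpow (succ n) = mul (3 : N M).val (tpow n) := by
  have hd : DefF (fun p : M × M => mul (3 : N M).val p.2) := by fun_prop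
  have := natRec_spec (X := nats) hd (succ_mem_nats zero_mem_nats) fun n x hn hx =>
    mul_mem (3 : N M).mem hx
  exact ⟨fun n hn => this.1.app_mem hn, this.2⟩

/-- `tsum z n` as an element of the semiring of natural numbers -/
noncomputable def N.sum {z : M} (hz : z ∈ᴹ cantor) (n : N M) : N M :=
  ⟨tsum z n.val, (tsum_spec hz).1 _ n.mem⟩

/-- `tpow n` as an element of the semiring of natural numbers -/
noncomputable def N.pow (n : N M) : N M := ⟨tpow n.val, tpow_spec.1 _ n.mem⟩

/-- `z(n)` as an element of the semiring of natural numbers -/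
noncomputable def N.bit {z : M} (hz : z ∈ᴹ cantor) (n : N M) : N M :=
  ⟨app z n.val, app_mem_nats hz n.mem⟩

theorem N.sum_zero {z : M} (hz : z ∈ᴹ cantor) : N.sum hz 0 = 0 := N.ext (tsum_spec hz).2.1

theorem N.sum_succ {z : M} (hz : z ∈ᴹ cantor) (n : N M) :
    N.sum hz (n + 1) = 3 * N.sum hz n + 2 * N.bit hz n := by
  refine N.ext ?_
  change tsum z (n + 1).val = _
  rw [N.coe_succ]
  exact (tsum_spec hz).2.2 _ n.mem

theorem N.pow_zero' : N.pow (0 : N M) = 1 := N.ext tpow_spec.2.1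

theorem N.pow_succ' (n : N M) : N.pow (n + 1) = 3 * N.pow n := by
  refine N.ext ?_
  change tpow (n + 1).val = _
  rw [N.coe_succ]
  exact tpow_spec.2.2 _ n.mem

theorem N.bit_eq {z : M} (hz : z ∈ᴹ cantor) (n : N M) : N.bit hz n = 0 ∨ N.bit hz n = 1 := by
  rcases mem_two.1 ((mem_cantor.1 hz).app_mem n.mem) with h | h
  exacts [.inl (N.ext h), .inr (N.ext h)]

theorem N.lt_pow (n : N M) : n < N.pow n := by
  refine N.induction (P := fun n => n < N.pow n) (fun n => n ∈ᴹ tpow n) (by fun_prop)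
    (fun _ => Iff.rfl) (by rw [N.pow_zero']; exact N.one_pos) (fun n ih => ?_) n
  rw [N.pow_succ']
  calc n + 1 ≤ N.pow n := N.succ_le_iff.2 ih
    _ < N.pow n + 2 * N.pow n := lt_add_of_pos_right _
        (mul_pos two_pos ((N.zero_le n).trans_lt ih))
    _ = 3 * N.pow n := by ring

theorem N.pow_pos (n : N M) : 0 < N.pow n := (N.zero_le n).trans_lt (N.lt_pow n)

theorem tsum_congr {z z' n : M} (hz : z ∈ᴹ cantor) (hz' : z' ∈ᴹ cantor) (hn : n ∈ᴹ nats)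
    (h : Agree n z z') : tsum z n = tsum z' n := by
  refine nat_induction (P := fun n => Agree n z z' → tsum z n = tsum z' n) (by fun_prop) (fun _ => ?_)
    (fun n hn ih h => ?_) n hn h
  · rw [(tsum_spec hz).2.1, (tsum_spec hz').2.1]
  · rw [(tsum_spec hz).2.2 n hn, (tsum_spec hz').2.2 n hn, h n (by simp),
      ih fun i hi => h i (by simp [hi])]

theorem N.digits_inj {s s' b b' : N M} (hb : b = 0 ∨ b = 1) (hb' : b' = 0 ∨ b' = 1)
    (h : 3 * s + 2 * b = 3 * s' + 2 * b') : s = s' ∧ b = b' := by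
  have key : ∀ s s' b b' : N M, b = 0 ∨ b = 1 → 3 * s + 2 * b = 3 * s' + 2 * b' → ¬ s < s' := by
    intro s s' b b' hb h hlt
    have h1 : 3 * s + 3 ≤ 3 * s' := by
      calc 3 * s + 3 = 3 * (s + 1) := by ring
        _ ≤ 3 * s' := mul_le_mul_of_nonneg_left (N.succ_le_iff.2 hlt) (N.zero_le _)
    have h2 : (2 : N M) * b < 3 := by
      rcases hb with rfl | rfl
      · rw [mul_zero]; exact three_pos
      · rw [mul_one]
        calc (2 : N M) < 2 + 1 := N.lt_succ_iff.2 le_rfl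
          _ = 3 := by ring
    have : 3 * s + 2 * b < 3 * s' + 2 * b' :=
      calc 3 * s + 2 * b < 3 * s + 3 := by gcongr
        _ ≤ 3 * s' := h1
        _ ≤ 3 * s' + 2 * b' := le_add_of_nonneg_right (N.zero_le _)
    exact this.ne h
  have hs : s = s' := by
    rcases lt_trichotomy s s' with h' | h' | h'
    exacts [absurd h' (key _ _ _ _ hb h), h', absurd h' (key _ _ _ _ hb' h.symm)]
  subst hs
  have h2 : 2 * b = 2 * b' := add_left_cancel h
  refine ⟨rfl, ?_⟩
  rcases lt_trichotomy b b' with h' | h' | h'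
  exacts [absurd h2 (mul_lt_mul_of_pos_left h' two_pos).ne, h',
    absurd h2 (mul_lt_mul_of_pos_left h' two_pos).ne']

theorem agree_of_tsum_eq {z z' n : M} (hz : z ∈ᴹ cantor) (hz' : z' ∈ᴹ cantor) (hn : n ∈ᴹ nats)
    (h : tsum z n = tsum z' n) : Agree n z z' := by
  refine nat_induction (P := fun n => tsum z n = tsum z' n → Agree n z z') (by fun_prop)
    (fun _ i hi => absurd hi (not_mem_zero i)) (fun n hn ih h => ?_) n hn h
  have e : N.sum hz (⟨n, hn⟩ + 1) = N.sum hz' (⟨n, hn⟩ + 1) := by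
    refine N.ext ?_
    change tsum z (⟨n, hn⟩ + 1 : N M).val = tsum z' (⟨n, hn⟩ + 1 : N M).val
    rw [N.coe_succ]
    exact h
  rw [N.sum_succ, N.sum_succ] at e
  obtain ⟨e1, e2⟩ := N.digits_inj (N.bit_eq hz _) (N.bit_eq hz' _) e
  intro i hi
  rcases mem_succ.1 hi with hi | rfl
  · exact ih (congrArg N.val e1) i hi
  · exact congrArg N.val e2

/-- The rational number with the ternary expansion `0.(2 z(0))…(2 z(n - 1))`. -/
noncomputable def lower (z n : M) : M := pair (pair (tsum z n) zero) (tpow n)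

/-- `lower z n + 3 ^ (-n)` -/
noncomputable def upper (z n : M) : M := pair (pair (succ (tsum z n)) zero) (tpow n)

@[fun_prop] theorem DefF.lower {x y : Γ → M} (hx : DefF x) (hy : DefF y) :
    DefF (fun g => lower (x g) (y g)) := by unfold InternalZF.lower; fun_prop

@[fun_prop] theorem DefF.upper {x y : Γ → M} (hx : DefF x) (hy : DefF y) :
    DefF (fun g => upper (x g) (y g)) := by unfold InternalZF.upper; fun_prop

theorem lower_eq {z : M} (hz : z ∈ᴹ cantor) (n : N M) :
    lower z n.val = frac (N.sum hz n) 0 (N.pow n) := rfl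

theorem upper_eq {z : M} (hz : z ∈ᴹ cantor) (n : N M) :
    upper z n.val = frac (N.sum hz n + 1) 0 (N.pow n) := by
  rw [frac, N.coe_succ]; rfl

theorem lower_mem {z n : M} (hz : z ∈ᴹ cantor) (hn : n ∈ᴹ nats) : lower z n ∈ᴹ rats := by
  rw [lower_eq hz ⟨n, hn⟩]; exact frac_mem_rats (N.pow_pos _)

theorem upper_mem {z n : M} (hz : z ∈ᴹ cantor) (hn : n ∈ᴹ nats) : upper z n ∈ᴹ rats := by
  rw [upper_eq hz ⟨n, hn⟩]; exact frac_mem_rats (N.pow_pos _)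

theorem lower_lt_upper_self {z n : M} (hz : z ∈ᴹ cantor) (hn : n ∈ᴹ nats) :
    RatLt (lower z n) (upper z n) := by
  rw [lower_eq hz ⟨n, hn⟩, upper_eq hz ⟨n, hn⟩, frac_lt_frac (N.pow_pos _) (N.pow_pos _)]
  simp only [zero_mul, add_zero]
  exact mul_lt_mul_of_pos_right (N.lt_succ_iff.2 le_rfl) (N.pow_pos _)

theorem lower_succ {z n : M} (hz : z ∈ᴹ cantor) (hn : n ∈ᴹ nats) :
    ¬ RatLt (lower z (succ n)) (lower z n) := by
  have := N.coe_succ ⟨n, hn⟩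
  rw [← this, lower_eq hz ⟨n, hn⟩, lower_eq hz, frac_lt_frac (N.pow_pos _) (N.pow_pos _),
    N.sum_succ, N.pow_succ']
  simp only [zero_mul, add_zero, not_lt]
  calc N.sum hz ⟨n, hn⟩ * (3 * N.pow ⟨n, hn⟩) = 3 * N.sum hz ⟨n, hn⟩ * N.pow ⟨n, hn⟩ := by ring
    _ ≤ _ := mul_le_mul_of_nonneg_right (le_add_of_nonneg_right (N.zero_le _)) (N.zero_le _)

theorem upper_succ {z n : M} (hz : z ∈ᴹ cantor) (hn : n ∈ᴹ nats) :
    ¬ RatLt (upper z n) (upper z (succ n)) := by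
  have := N.coe_succ ⟨n, hn⟩
  rw [← this, upper_eq hz ⟨n, hn⟩, upper_eq hz, frac_lt_frac (N.pow_pos _) (N.pow_pos _),
    N.sum_succ, N.pow_succ']
  simp only [zero_mul, add_zero, not_lt]
  have hb : (2 : N M) * N.bit hz ⟨n, hn⟩ ≤ 2 := by
    rcases N.bit_eq hz ⟨n, hn⟩ with h | h <;> rw [h]
    · rw [mul_zero]; exact N.zero_le _
    · rw [mul_one]
  calc _ ≤ (3 * N.sum hz ⟨n, hn⟩ + 2 + 1) * N.pow ⟨n, hn⟩ := by gcongr; exact N.zero_le _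
    _ = _ := by ring

theorem not_ratLt_trans {p q r : M} (hq : q ∈ᴹ rats) (h : ¬ RatLt q p) (h' : ¬ RatLt r q) :
    ¬ RatLt r p := fun hrp => (hrp.cotrans hq).elim h' h

theorem lower_mono {z m n : M} (hz : z ∈ᴹ cantor) (hn : n ∈ᴹ nats) (h : NatLe m n) :
    ¬ RatLt (lower z n) (lower z m) := by
  refine nat_induction (P := fun n => NatLe m n → ¬ RatLt (lower z n) (lower z m)) (by fun_prop) ?_
    (fun n hn ih h => ?_) n hn h
  · rintro (h | rfl)
    exacts [absurd h (not_mem_zero m), ratLt_irrefl _]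
  · rcases h with h | rfl
    · exact not_ratLt_trans (lower_mem hz hn) (ih (mem_succ.1 h)) (lower_succ hz hn)
    · exact ratLt_irrefl _

theorem upper_anti {z m n : M} (hz : z ∈ᴹ cantor) (hn : n ∈ᴹ nats) (h : NatLe m n) :
    ¬ RatLt (upper z m) (upper z n) := by
  refine nat_induction (P := fun n => NatLe m n → ¬ RatLt (upper z m) (upper z n)) (by fun_prop) ?_
    (fun n hn ih h => ?_) n hn h
  · rintro (h | rfl)
    exacts [absurd h (not_mem_zero m), ratLt_irrefl _]
  · rcases h with h | rfl
    · exact not_ratLt_trans (upper_mem hz hn) (upper_succ hz hn) (ih (mem_succ.1 h))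
    · exact ratLt_irrefl _

theorem lower_lt_upper {z m n : M} (hz : z ∈ᴹ cantor) (hm : m ∈ᴹ nats) (hn : n ∈ᴹ nats) :
    RatLt (lower z m) (upper z n) := by
  obtain ⟨l, hl, hml, hnl⟩ := exists_natLe hm hn
  have h1 := ((lower_lt_upper_self hz hl).cotrans (lower_mem hz hm)).resolve_left
    (lower_mono hz hl hml)
  exact (h1.cotrans (upper_mem hz hn)).resolve_right (upper_anti hz hl hnl)

theorem upper_lt_lower {z z' n : M} (hz : z ∈ᴹ cantor) (hz' : z' ∈ᴹ cantor) (hn : n ∈ᴹ nats)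
    (hag : Agree n z z') (h0 : app z n = zero) (h1 : app z' n = one) :
    RatLt (upper z (succ n)) (lower z' (succ n)) := by
  have e0 : N.bit hz ⟨n, hn⟩ = 0 := N.ext h0
  have e1 : N.bit hz' ⟨n, hn⟩ = 1 := N.ext h1
  have e : N.sum hz ⟨n, hn⟩ = N.sum hz' ⟨n, hn⟩ := N.ext (tsum_congr hz hz' hn hag)
  rw [← N.coe_succ ⟨n, hn⟩, upper_eq hz, lower_eq hz', frac_lt_frac (N.pow_pos _) (N.pow_pos _),
    N.sum_succ, N.sum_succ, e0, e1, e]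
  simp only [zero_mul, add_zero, mul_zero, mul_one]
  refine mul_lt_mul_of_pos_right ?_ (N.pow_pos _)
  gcongr
  calc (1 : N M) < 1 + 1 := N.lt_succ_iff.2 le_rfl
    _ = 2 := by ring

/-- The widths of the intervals from `lower z n` to `upper z n` tend to `0`. -/
theorem exists_upper_le {q r : M} (h : RatLt q r) : ∃ n, n ∈ᴹ nats ∧ ∀ z, z ∈ᴹ cantor →
    ¬ RatLt q (lower z n) → ¬ RatLt r (upper z n) := by
  obtain ⟨a, b, c, a', b', c', hc, hc', rfl, rfl, hlt⟩ := ratLt_iff.1 h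
  refine ⟨(c * c').val, (c * c').mem, fun z hz hq hr => ?_⟩
  rw [lower_eq hz, frac_lt_frac hc (N.pow_pos _)] at hq
  rw [upper_eq hz, frac_lt_frac hc' (N.pow_pos _)] at hr
  set p := N.pow (c * c')
  set S := N.sum hz (c * c')
  have hp : c * c' < p := N.lt_pow _
  simp only [zero_mul, add_zero, not_lt] at hq hr
  -- add up `c` times `hr`, `c'` times `hq`, `p` times `hlt` and `hp`
  have h1 := mul_lt_mul_of_pos_right hr hc
  have h2 := mul_le_mul_of_nonneg_right hq hc'.le
  have h3 := mul_le_mul_of_nonneg_right (N.succ_le_iff.2 hlt) (N.pow_pos (c * c')).le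
  exact (add_lt_add (add_lt_add_of_lt_of_le h1 (add_le_add h2 h3)) hp).ne (by ring)

end Ternary

/-! ### The Cantor cube is a compact Hausdorff space with a countable base -/

section CantorCompact

variable {M : Type u} [setLang.Structure M] [hM : Fact (IsZFModel M)]

/-- The set of all `z` with `tsum z n = m` is a ball or empty, since `tsum z n` determines the first `n`
digits of `z`.  These sets form a base, which is countable because they are coded by the pairs
`(n, m)`. -/
theorem isSecondCountable_cantorTop : IsSecondCountable (cantorTop : M) := by
  have hd : Def (fun U : M => ∃ k n m : M, k ∈ᴹ nats ∧ n ∈ᴹ nats ∧ m ∈ᴹ nats ∧ k = npair n m ∧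
    ∀ z, z ∈ᴹ U ↔ z ∈ᴹ cantor ∧ tsum z n = m) := by fun_prop
  refine ⟨sep cantorTop fun U => ∃ k n m : M, k ∈ᴹ nats ∧ n ∈ᴹ nats ∧ m ∈ᴹ nats ∧ k = npair n m ∧
    ∀ z, z ∈ᴹ U ↔ z ∈ᴹ cantor ∧ tsum z n = m, ⟨fun U hU => ((mem_sep hd).1 hU).1,
      fun U z hU hz => ?_⟩, ?_⟩
  · obtain ⟨hUs, hU⟩ := mem_cantorTop.1 hU
    have hzc := hUs z hz
    obtain ⟨m, hm, hm'⟩ := hU z hz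
    refine ⟨ball m z, (mem_sep hd).2 ⟨ball_open hm, npair m (tsum z m), m, tsum z m,
      npair_mem hm ((tsum_spec hzc).1 m hm), hm, (tsum_spec hzc).1 m hm, rfl, fun z' => ?_⟩,
      mem_ball.2 ⟨hzc, Agree.refl m z⟩, fun z' hz' => ?_⟩
    · rw [mem_ball]
      exact and_congr_right fun hz' => ⟨fun h => (tsum_congr hzc hz' hm h).symm,
        fun h => agree_of_tsum_eq hzc hz' hm h.symm⟩
    · rw [mem_ball] at hz'
      exact hm' z' hz'.1 hz'.2
  · refine isCountable_of_code (φ := fun U k => ∃ n m : M, k ∈ᴹ nats ∧ n ∈ᴹ nats ∧ m ∈ᴹ nats ∧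
      k = npair n m ∧ ∀ z, z ∈ᴹ U ↔ z ∈ᴹ cantor ∧ tsum z n = m) (by fun_prop) (fun U hU => ?_) ?_
    · obtain ⟨k, n, m, hk, h⟩ := ((mem_sep hd).1 hU).2
      exact ⟨k, hk, n, m, hk, h⟩
    · rintro U V k - - ⟨n, m, hk, hn, hm, e, hU⟩ ⟨n', m', -, hn', hm', e', hV⟩
      obtain ⟨rfl, rfl⟩ := npair_inj hn hm hn' hm' (e.symm.trans e')
      exact ext fun z => by rw [hU, hV]

theorem isFinite_singleton (u : M) : IsFinite (upair u u) := by
  have := (isFinite_nat (zero_mem_nats (M := M))).insert u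
  rwa [show cup zero (upair u u) = upair u u from ext fun z => by simp] at this

theorem isCompactSpace_cantorTop : IsCompactSpace (cantor : M) cantorTop := by
  intro c hc hcov
  by_contra hcon
  -- the nodes are the initial segments whose extensions are not covered by a finite subset of `c`
  obtain ⟨z, hz, hBz⟩ : ∃ z, z ∈ᴹ cantor ∧ ∀ m, m ∈ᴹ nats → ¬ ∃ d, Sub d c ∧ IsFinite d ∧
      ∀ z', z' ∈ᴹ cantor → Agree m z z' → ∃ U, U ∈ᴹ d ∧ z' ∈ᴹ U := by
    refine exists_branch (B := fun m z => ¬ ∃ d, Sub d c ∧ IsFinite d ∧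
      ∀ z', z' ∈ᴹ cantor → Agree m z z' → ∃ U, U ∈ᴹ d ∧ z' ∈ᴹ U) (by fun_prop) ?_ ?_ ?_
    · rintro m z z' hm _ _ hag h ⟨d, hd, hfin, hcovd⟩
      exact h ⟨d, hd, hfin, fun z'' hz'' hag' => hcovd z'' hz'' (hag.symm.trans hag')⟩
    · obtain ⟨z, hz⟩ := exists_cantor (M := M)
      refine ⟨z, hz, fun ⟨d, hd, hfin, hcovd⟩ => hcon ⟨d, hd, hfin, fun z' hz' => hcovd z' hz' ?_⟩⟩
      exact fun i hi => absurd hi (not_mem_zero i)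
    · intro m z hm hz h
      by_contra! h'
      have hupd : ∀ a, a ∈ᴹ two → update z m a ∈ᴹ cantor ∧ Agree m z (update z m a) := by
        refine fun a ha => ⟨mem_cantor.2 (isFun_update (mem_cantor.1 hz) ha), fun i hi => ?_⟩
        rw [app_update_of_ne (mem_nats_of_mem hi hm)]
        rintro rfl; exact not_mem_self i hi
      have h0 := hupd zero (mem_two.2 (.inl rfl))
      have h1 := hupd one (mem_two.2 (.inr rfl))
      obtain ⟨d₀, hd₀, hfin₀, hcov₀⟩ := h' _ h0.1 h0.2
      obtain ⟨d₁, hd₁, hfin₁, hcov₁⟩ := h' _ h1.1 h1.2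
      refine h ⟨cup d₀ d₁, fun U hU => ?_, hfin₀.union hfin₁, fun z' hz' hag => ?_⟩
      · rcases mem_cup.1 hU with hU | hU
        exacts [hd₀ U hU, hd₁ U hU]
      · have hag' : Agree (succ m) (update z m (app z' m)) z' := by
          intro i hi
          rcases mem_succ.1 hi with hi | rfl
          · rw [app_update_of_ne (mem_nats_of_mem hi hm), hag i hi]
            rintro rfl; exact not_mem_self i hi
          · rw [app_update_self hm]
        rcases mem_two.1 ((mem_cantor.1 hz').app_mem hm) with e | e <;> rw [e] at hag'
        · obtain ⟨U, hU, hzU⟩ := hcov₀ z' hz' hag'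
          exact ⟨U, mem_cup.2 (.inl hU), hzU⟩
        · obtain ⟨U, hU, hzU⟩ := hcov₁ z' hz' hag'
          exact ⟨U, mem_cup.2 (.inr hU), hzU⟩
  obtain ⟨U, hU, hzU⟩ := hcov z hz
  obtain ⟨m, hm, hm'⟩ := (mem_cantorTop.1 (hc U hU)).2 z hzU
  refine hBz m hm ⟨upair U U, fun V hV => ?_, isFinite_singleton U, fun z' hz' hag =>
    ⟨U, by simp, hm' z' hz' hag⟩⟩
  simp only [mem_upair, or_self] at hV
  rwa [hV]

end CantorCompact

/-! ### The Cantor set in the unit interval -/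

section CantorSet

variable {M : Type u} [setLang.Structure M] [hM : Fact (IsZFModel M)]

/-- The real number with the ternary expansion `0.(2 z(0))(2 z(1))…`. -/
noncomputable def ternary (z : M) : M :=
  sep rats fun q => ∃ n, n ∈ᴹ nats ∧ RatLt q (lower z n)

theorem mem_ternary {z q : M} : q ∈ᴹ ternary z ↔ ∃ n, n ∈ᴹ nats ∧ RatLt q (lower z n) := by
  rw [ternary, mem_sep (by fun_prop), and_iff_right_iff_imp]
  rintro ⟨n, -, h⟩; exact h.left_mem

theorem upper_not_mem {z n : M} (hz : z ∈ᴹ cantor) (hn : n ∈ᴹ nats) :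
    ¬ upper z n ∈ᴹ ternary z := by
  rw [mem_ternary]
  rintro ⟨m, hm, h⟩
  exact h.asymm (lower_lt_upper hz hm hn)

theorem ternary_mem {z : M} (hz : z ∈ᴹ cantor) :
    ternary z ∈ᴹ interval realZero realOne := by
  have hr : ternary z ∈ᴹ reals := by
    rw [mem_reals]
    simp only [IsCut, isRat_iff, mem_ternary]
    refine ⟨fun q ⟨n, hn, h⟩ => h.left_mem, ?_, ⟨upper z zero, upper_mem hz zero_mem_nats, ?_⟩,
      fun q r hqr ⟨n, hn, h⟩ => ⟨n, hn, hqr.trans h⟩, fun q ⟨n, hn, h⟩ => ?_⟩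
    · obtain ⟨q, hq⟩ := exists_rat_lt (lower_mem hz zero_mem_nats)
      exact ⟨q, zero, zero_mem_nats, hq⟩
    · simpa only [mem_ternary] using upper_not_mem hz zero_mem_nats
    · obtain ⟨r, h1, h2⟩ := h.dense
      exact ⟨r, ⟨n, hn, h2⟩, h1⟩
  refine mem_interval.2 ⟨hr, fun q hq => ?_, fun q hq => ?_⟩
  · rw [realZero, mem_ratCut] at hq
    refine mem_ternary.2 ⟨zero, zero_mem_nats, ?_⟩
    rwa [← N.coe_zero, lower_eq hz, N.sum_zero, N.pow_zero']
  · rw [mem_ternary] at hq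
    obtain ⟨n, hn, h⟩ := hq
    have := h.trans (lower_lt_upper hz hn zero_mem_nats)
    rw [← N.coe_zero, upper_eq hz, N.sum_zero, N.pow_zero', zero_add] at this
    exact mem_ratCut.2 this

theorem ternary_injective {z z' : M} (hz : z ∈ᴹ cantor) (hz' : z' ∈ᴹ cantor)
    (h : ternary z = ternary z') : z = z' := by
  have key : ∀ z z' n : M, z ∈ᴹ cantor → z' ∈ᴹ cantor → n ∈ᴹ nats → Agree n z z' →
      app z n = zero → app z' n = one → ternary z ≠ ternary z' := by
    intro z z' n hz hz' hn hag h0 h1 e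
    refine upper_not_mem hz (succ_mem_nats hn) (e ▸ mem_ternary.2 ⟨succ n, succ_mem_nats hn, ?_⟩)
    exact upper_lt_lower hz hz' hn hag h0 h1
  by_contra hne
  obtain ⟨n, hn, hzn⟩ : ∃ n, n ∈ᴹ nats ∧ app z n ≠ app z' n := by
    by_contra! h'
    exact hne ((mem_cantor.1 hz).ext (mem_cantor.1 hz') h')
  obtain ⟨n, hn, hzn, hmin⟩ := exists_least (P := fun n => app z n ≠ app z' n) (by fun_prop) hn hzn
  have hag : Agree n z z' := fun i hi => not_not.1 (hmin i hi)
  rcases mem_two.1 ((mem_cantor.1 hz).app_mem hn) with e | e <;>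
    rcases mem_two.1 ((mem_cantor.1 hz').app_mem hn) with e' | e'
  · exact hzn (e.trans e'.symm)
  · exact key z z' n hz hz' hn hag e e' h
  · exact key z' z n hz' hz hn hag.symm e' e h.symm
  · exact hzn (e.trans e'.symm)

theorem contOn_ternary :
    ContOn (ternary (M := M)) cantor (subTop (interval realZero realOne) realTop) := by
  intro z hz U hU hzU
  obtain ⟨W, hW, rfl⟩ := mem_subTop.1 hU
  obtain ⟨⟨p, q⟩, ⟨hp, q₀, hq₀, hq₀z, hq⟩, hpq⟩ := (mem_realTop.1 hW).2 _ (mem_inter.1 hzU).1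
  obtain ⟨n, hn, hpn⟩ := mem_ternary.1 hp
  obtain ⟨q₁, hq₁, hq₁'⟩ := hq.dense
  obtain ⟨n', hn', hq₁n⟩ := exists_upper_le hq₁
  have hup : ¬ RatLt q₁ (upper z n') := hq₁n z hz fun h => hq₀z (mem_ternary.2 ⟨n', hn', h⟩)
  obtain ⟨m, hm, hnm, hnm'⟩ := exists_natLe hn hn'
  refine ⟨m, hm, fun z' hz' hag => mem_inter.2 ⟨hpq _ (interval_sub _ _ _ (ternary_mem hz')) ⟨?_, q₁,
    hq₁.right_mem, fun hmem => ?_, hq₁'⟩, ternary_mem hz'⟩⟩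
  · refine mem_ternary.2 ⟨n, hn, ?_⟩
    rwa [lower, ← tsum_congr hz hz' hn (hag.mono hnm hm)]
  · rw [upper, tsum_congr hz hz' hn' (hag.mono hnm' hm)] at hup
    obtain ⟨k, hk, hlt⟩ := mem_ternary.1 hmem
    exact hup (hlt.trans (lower_lt_upper hz' hk hn'))

/-- The Cantor set is a copy of the Cantor cube in the unit interval. -/
theorem cantor_of_unitInterval
    (h : IsSequential (interval realZero realOne : M) (subTop (interval realZero realOne) realTop)) :
    IsSequential (cantor : M) cantorTop :=
  h.of_embedding (f := ternary) (by unfold ternary; fun_prop)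
    (isHausdorff_realTop.subTop (interval_sub _ _)) (fun _ => ternary_mem) contOn_ternary
    fun _ _ => ternary_injective

end CantorSet

/-! ### Powers of intervals as images of closed subsets of the Cantor cube -/

section Hilbert

variable {M : Type u} [setLang.Structure M] {Γ : Type u} [Ctx M Γ] [hM : Fact (IsZFModel M)]

/-- A map to a countable power is continuous if its coordinates are. -/
theorem contOn_powTop {f : M → M} (hf : DefF f) {K X T : M} (hfX : ∀ z, z ∈ᴹ K → f z ∈ᴹ funs nats X)
    (h : ∀ n, n ∈ᴹ nats → ContOn (fun z => app (f z) n) K T) : ContOn f K (powTop X T) := by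
  intro z hz U hU hzU
  obtain ⟨V, ⟨hV, k, hk, hVk⟩, hzV, hVU⟩ := (mem_powTop.1 hU).2 _ hzU
  obtain ⟨m, hm, hm'⟩ := (isFinite_nat hk).exists_bound
    (φ := fun n m => ∀ z', z' ∈ᴹ K → Agree m z z' → app (f z') n ∈ᴹ app V n) (by fun_prop)
    (fun n m m' _ hm' hmm' h z' hz' hag => h z' hz' (hag.mono hmm' hm'))
    (fun n hn => by
      have hn' := mem_nats_of_mem hn hk
      exact h n hn' z hz _ (hV.app_mem hn') (hzV n hn'))
  refine ⟨m, hm, fun z' hz' hag => hVU _ (hfX z' hz') fun n hn => ?_⟩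
  rcases natLe_or_mem hk hn with hkn | hnk
  · rw [hVk n hn hkn]; exact (mem_funs.1 (hfX z' hz')).app_mem hn
  · exact hm' n hnk z' hz' hag

/-- An injective coding of the pairs of a natural number `n` and a rational number `q`. -/
noncomputable def ratCode (n q : M) : M :=
  npair n (npair (npair (fst (fst q)) (snd (fst q))) (snd q))

@[fun_prop] theorem DefF.ratCode {x y : Γ → M} (hx : DefF x) (hy : DefF y) :
    DefF (fun g => ratCode (x g) (y g)) := by unfold InternalZF.ratCode; fun_prop

theorem ratCode_mem {n q : M} (hn : n ∈ᴹ nats) (hq : q ∈ᴹ rats) : ratCode n q ∈ᴹ nats := by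
  obtain ⟨a, b, c, -, rfl⟩ := mem_rats.1 hq
  simp only [ratCode, frac, fst_pair, snd_pair]
  exact npair_mem hn (npair_mem (npair_mem a.mem b.mem) c.mem)

theorem ratCode_inj {n q n' q' : M} (hn : n ∈ᴹ nats) (hq : q ∈ᴹ rats) (hn' : n' ∈ᴹ nats)
    (hq' : q' ∈ᴹ rats) (h : ratCode n q = ratCode n' q') : n = n' ∧ q = q' := by
  obtain ⟨a, b, c, -, rfl⟩ := mem_rats.1 hq
  obtain ⟨a', b', c', -, rfl⟩ := mem_rats.1 hq'
  simp only [ratCode, frac, fst_pair, snd_pair] at h ⊢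
  have hab := npair_mem a.mem b.mem
  have hab' := npair_mem a'.mem b'.mem
  obtain ⟨e1, e2⟩ := npair_inj hn (npair_mem hab c.mem) hn' (npair_mem hab' c'.mem) h
  obtain ⟨e3, e4⟩ := npair_inj hab c.mem hab' c'.mem e2
  obtain ⟨e5, e6⟩ := npair_inj a.mem b.mem a'.mem b'.mem e3
  exact ⟨e1, by rw [e4, e5, e6]⟩

open Classical in
/-- A binary sequence whose `ratCode n q`-th value decides whether `q` lies in the `n`-th of a
sequence of real numbers determines that sequence, up to the choice made at the real number itself
if it is rational.  The binary sequences that decide consistently form a closed set. -/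
theorem powTop_interval (h : IsSequential (cantor : M) cantorTop) {a b : M} (ha : a ∈ᴹ reals)
    (hb : b ∈ᴹ reals) : IsSequential (funs nats (interval a b))
      (powTop (interval a b) (subTop (interval a b) realTop)) := by
  have hIT : IsTopology (interval a b) (subTop (interval a b) realTop) :=
    isTopology_realTop.subTop (interval_sub a b)
  have hIH : IsHausdorff (interval a b) (subTop (interval a b) realTop) :=
    isHausdorff_realTop.subTop (interval_sub a b)
  -- the decisions are monotone, and compatible with the end points `a` and `b`
  let P : M → Prop := fun z => ∀ n q, n ∈ᴹ nats → q ∈ᴹ rats →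
    (∀ q', RatLt q q' → app z (ratCode n q') = one → app z (ratCode n q) = one) ∧
      (q ∈ᴹ a → app z (ratCode n q) = one) ∧ (app z (ratCode n q) = one → q ∈ᴹ b)
  have hPd : Def P := by fun_prop
  have hK : ∀ z, z ∈ᴹ sep cantor P ↔ z ∈ᴹ cantor ∧ P z := fun z => mem_sep hPd
  -- the `n`-th real number given by `z`: the cut of its positive decisions, made free of a maximum
  let x : M → M → M := fun z n => sep rats fun q => ∃ q', RatLt q q' ∧ app z (ratCode n q') = one
  have hx : ∀ z n q, q ∈ᴹ x z n ↔ ∃ q', RatLt q q' ∧ app z (ratCode n q') = one := by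
    intro z n q
    rw [mem_sep (by fun_prop), and_iff_right_iff_imp]
    rintro ⟨q', h, -⟩; exact h.left_mem
  have hxI : ∀ z n, z ∈ᴹ sep cantor P → n ∈ᴹ nats → x z n ∈ᴹ interval a b := by
    intro z n hz hn
    rw [hK] at hz
    have hax : Sub a (x z n) := fun q hq => by
      obtain ⟨q', hq', hlt⟩ := exists_mem_gt ha hq
      exact (hx z n q).2 ⟨q', hlt, (hz.2 n q' hn (rat_of_mem ha hq')).2.1 hq'⟩
    have hxb : Sub (x z n) b := fun q hq => by
      obtain ⟨q', hlt, hq'⟩ := (hx z n q).1 hq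
      exact mem_of_lt hb hlt ((hz.2 n q' hn hlt.right_mem).2.2 hq')
    refine mem_interval.2 ⟨?_, hax, hxb⟩
    rw [mem_reals]
    simp only [IsCut, isRat_iff]
    refine ⟨fun q hq => ?_, ?_, ?_, fun q r hqr hr => ?_, fun q hq => ?_⟩
    · obtain ⟨q', hlt, -⟩ := (hx z n q).1 hq
      exact hlt.left_mem
    · obtain ⟨q, hq⟩ := exists_mem ha
      exact ⟨q, hax q hq⟩
    · obtain ⟨q, hq, hqb⟩ := exists_not_mem hb
      exact ⟨q, hq, fun h => hqb (hxb q h)⟩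
    · obtain ⟨q', hlt, hq'⟩ := (hx z n r).1 hr
      exact (hx z n q).2 ⟨q', hqr.trans hlt, hq'⟩
    · obtain ⟨q', hlt, hq'⟩ := (hx z n q).1 hq
      obtain ⟨r, h1, h2⟩ := hlt.dense
      exact ⟨r, (hx z n r).2 ⟨q', h2, hq'⟩, h1⟩
  have hfd : DefF (fun z : M => lam nats fun n => x z n) := by fun_prop
  have happ : ∀ z n, n ∈ᴹ nats → app (lam nats fun n => x z n) n = x z n := fun z n hn =>
    app_lam (by fun_prop) hn
  have hfX : ∀ z, z ∈ᴹ sep cantor P → (lam nats fun n => x z n) ∈ᴹ funs nats (interval a b) :=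
    fun z hz => mem_funs.2 (isFun_lam (by fun_prop) fun n hn => hxI z n hz hn)
  refine h.of_image hfd (K := sep cantor P) (closed_of_limits (fun z hz => ((hK z).1 hz).1) ?_)
    hIT.powTop (hIH.powTop hIT) hfX (contOn_powTop hfd hfX ?_) ?_
  · intro z hz hlim
    have hval : ∀ i j, i ∈ᴹ nats → j ∈ᴹ nats → ∃ z', P z' ∧ app z i = app z' i ∧
        app z j = app z' j := by
      intro i j hi hj
      obtain ⟨m, hm, him, hjm⟩ := exists_natLe (succ_mem_nats hi) (succ_mem_nats hj)
      obtain ⟨z', hz', hag⟩ := hlim m hm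
      exact ⟨z', ((hK z').1 hz').2, hag i (him.mem (by simp) hm), hag j (hjm.mem (by simp) hm)⟩
    refine (hK z).2 ⟨hz, fun n q hn hq => ⟨fun q' hlt => ?_, ?_⟩⟩
    · obtain ⟨z', hz', e1, e2⟩ := hval _ _ (ratCode_mem hn hq) (ratCode_mem hn hlt.right_mem)
      rw [e1, e2]
      exact (hz' n q hn hq).1 q' hlt
    · obtain ⟨z', hz', e1, -⟩ := hval _ _ (ratCode_mem hn hq) (ratCode_mem hn hq)
      rw [e1]
      exact (hz' n q hn hq).2
  · intro n hn z hz U hU hzU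
    simp only [happ _ n hn] at hzU ⊢
    obtain ⟨W, hW, rfl⟩ := mem_subTop.1 hU
    obtain ⟨⟨p, q⟩, ⟨hp, q₀, hq₀, hq₀z, hq⟩, hpq⟩ := (mem_realTop.1 hW).2 _ (mem_inter.1 hzU).1
    obtain ⟨p', hpp', hp'⟩ := (hx z n p).1 hp
    obtain ⟨q₁, hq₁, hq₁'⟩ := hq.dense
    have hq₁z : app z (ratCode n q₁) ≠ one := fun h => hq₀z ((hx z n q₀).2 ⟨q₁, hq₁, h⟩)
    have hi := ratCode_mem hn hpp'.right_mem
    have hj := ratCode_mem hn hq₁.right_mem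
    obtain ⟨m, hm, him, hjm⟩ := exists_natLe (succ_mem_nats hi) (succ_mem_nats hj)
    refine ⟨m, hm, fun z' hz' hag => ?_⟩
    have hzI := hxI z' n hz' hn
    refine mem_inter.2 ⟨hpq _ (interval_sub _ _ _ hzI) ⟨(hx z' n p).2 ⟨p', hpp', ?_⟩, q₁,
      hq₁.right_mem, fun hmem => ?_, hq₁'⟩, hzI⟩
    · rw [← hag _ (him.mem (by simp) hm), hp']
    · obtain ⟨q₂, hlt, hq₂⟩ := (hx z' n q₁).1 hmem
      rw [hag _ (hjm.mem (by simp) hm)] at hq₁z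
      exact hq₁z ((((hK z').1 hz').2 n q₁ hn hlt.left_mem).1 q₂ hlt hq₂)
  · intro g hg
    rw [mem_funs] at hg
    have hdz : DefF (fun i : M => if ∃ n q, n ∈ᴹ nats ∧ q ∈ᴹ rats ∧ i = ratCode n q ∧ q ∈ᴹ app g n
        then (one : M) else zero) := by fun_prop
    set z := lam nats fun i : M => if ∃ n q, n ∈ᴹ nats ∧ q ∈ᴹ rats ∧ i = ratCode n q ∧ q ∈ᴹ app g n
        then (one : M) else zero with hzdef
    have hzc : z ∈ᴹ cantor := by
      refine mem_cantor.2 (isFun_lam hdz fun i hi => ?_)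
      rw [mem_two]
      split_ifs
      exacts [.inr rfl, .inl rfl]
    have hz1 : ∀ n q, n ∈ᴹ nats → q ∈ᴹ rats → (app z (ratCode n q) = one ↔ q ∈ᴹ app g n) := by
      intro n q hn hq
      rw [hzdef, app_lam hdz (ratCode_mem hn hq)]
      split_ifs with h'
      · obtain ⟨n', q', hn', hq', e, hmem⟩ := h'
        obtain ⟨rfl, rfl⟩ := ratCode_inj hn hq hn' hq' e
        simpa using hmem
      · simp only [one_ne_zero'.symm, false_iff]
        exact fun hmem => h' ⟨n, q, hn, hq, rfl, hmem⟩
    have hgI : ∀ n, n ∈ᴹ nats → _ := fun n hn => mem_interval.1 (hg.app_mem hn)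
    have hzK : z ∈ᴹ sep cantor P := by
      refine (hK z).2 ⟨hzc, fun n q hn hq => ⟨fun q' hlt => ?_, ?_, ?_⟩⟩
      · rw [hz1 n q' hn hlt.right_mem, hz1 n q hn hq]
        exact mem_of_lt (hgI n hn).1 hlt
      · rw [hz1 n q hn hq]; exact (hgI n hn).2.1 q
      · rw [hz1 n q hn hq]; exact (hgI n hn).2.2 q
    refine ⟨z, hzK, (mem_funs.1 (hfX z hzK)).ext hg fun n hn => ?_⟩
    rw [happ z n hn]
    refine ext fun q => ?_
    rw [hx]
    constructor
    · rintro ⟨q', hlt, hq'⟩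
      rw [hz1 n q' hn hlt.right_mem] at hq'
      exact mem_of_lt (hgI n hn).1 hlt hq'
    · intro hq
      obtain ⟨q', hq', hlt⟩ := exists_mem_gt (hgI n hn).1 hq
      exact ⟨q', hlt, (hz1 n q' hn hlt.right_mem).2 hq'⟩

/-- The real line is sequential if its compact intervals are, since they form neighbourhoods of the
points. -/
theorem realLine_of_intervals
    (h : ∀ a b : M, a ∈ᴹ reals → b ∈ᴹ reals →
      IsSequential (interval a b) (subTop (interval a b) realTop)) :
    IsSequential (reals : M) realTop := by
  refine isSequential_iff.2 ⟨isTopology_realTop, fun A hA => ?_⟩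
  rw [isSeqClosedIn_iff] at hA
  refine isTopology_realTop.closed_of_nhds hA.1 fun x hx hxA => ?_
  -- a closed interval that contains the point `x` in its interior
  obtain ⟨q, hq⟩ := exists_above hx
  obtain ⟨p, hp⟩ := exists_mem hx
  have hpr := rat_of_mem hx hp
  have hqr : q ∈ᴹ rats := by obtain ⟨_, -, -, h⟩ := hq; exact h.right_mem
  have hray : ∀ y, y ∈ᴹ rayGt p → y ∈ᴹ rayLt q → y ∈ᴹ interval (ratCut p) (ratCut q) := by
    intro y hy hy'
    rw [mem_rayGt] at hy
    rw [mem_rayLt] at hy'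
    refine mem_interval.2 ⟨hy.1, fun r hr => mem_of_lt hy.1 (mem_ratCut.1 hr) hy.2, fun r hr => ?_⟩
    exact mem_ratCut.2 (lt_of_mem_of_not_mem hy.1 hr hqr (hy'.2.not_mem hy.1))
  have hxI := hray x (mem_rayGt.2 ⟨hx, hp⟩) (mem_rayLt.2 ⟨hx, hq⟩)
  have hI := interval_sub (ratCut p) (ratCut q)
  have hcl := (isSequential_iff.1 (h _ _ (ratCut_mem hpr) (ratCut_mem hqr))).2
    (inter A (interval (ratCut p) (ratCut q))) (isSeqClosedIn_iff.2
      ⟨fun y hy => (mem_inter.1 hy).2, fun s y hs hy hsy => mem_inter.2 ⟨hA.2 s y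
        (hs.mono fun n hn => (mem_inter.1 (hs.app_mem hn)).1) (hI y hy)
        ((convergesTo_subTop hs (fun y hy => (mem_inter.1 hy).2) hy).1 hsy), hy⟩⟩)
  obtain ⟨V, hV, e⟩ := mem_subTop.1 (isClosedIn_iff.1 hcl).2
  have hVm : ∀ y, y ∈ᴹ interval (ratCut p) (ratCut q) → (y ∈ᴹ V ↔ ¬ y ∈ᴹ A) := by
    intro y hy
    have : y ∈ᴹ inter V (interval (ratCut p) (ratCut q)) ↔ y ∈ᴹ interval (ratCut p) (ratCut q) ∧
        ¬ y ∈ᴹ inter A (interval (ratCut p) (ratCut q)) := by rw [← e, mem_diff]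
    simpa only [mem_inter, hy, and_true, true_and] using this
  refine ⟨inter V (inter (rayGt p) (rayLt q)), isTopology_realTop.inter_mem hV
    (isTopology_realTop.inter_mem (rayGt_open p) (rayLt_open q)), ?_, fun y hy => ?_⟩
  · simp only [mem_inter]
    exact ⟨(hVm x hxI).2 hxA, mem_rayGt.2 ⟨hx, hp⟩, mem_rayLt.2 ⟨hx, hq⟩⟩
  · simp only [mem_inter] at hy
    exact (hVm y (hray y hy.2.1 hy.2.2)).1 hy.1

end Hilbert

/-! ### The equivalences -/

section Sentences

variable {M : Type u} [setLang.Structure M] [hM : Fact (IsZFModel M)]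

theorem cantorCubeSequential_iff :
    CantorCubeSequential M ↔ IsSequential (cantor : M) cantorTop := by
  simp [CantorCubeSequential, isCantorCube_iff, and_assoc]

theorem realLineSequential_iff :
    RealLineSequential M ↔ IsSequential (reals : M) realTop := by
  simp [RealLineSequential, isRealLine_iff, and_assoc]

theorem unitIntervalSequential_iff : UnitIntervalSequential M ↔
    IsSequential (interval realZero realOne : M) (subTop (interval realZero realOne) realTop) := by
  simp [UnitIntervalSequential, isUnitInterval_iff, and_assoc]

theorem hilbertCubeSequential_iff : HilbertCubeSequential M ↔
    IsSequential (funs nats (interval realZero realOne) : M)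
      (powTop (interval realZero realOne) (subTop (interval realZero realOne) realTop)) := by
  simp [HilbertCubeSequential, IsHilbertCube, isUnitInterval_iff, isOmegaPower_iff, and_assoc]

theorem isTopology_unitInterval :
    IsTopology (interval realZero realOne : M) (subTop (interval realZero realOne) realTop) :=
  isTopology_realTop.subTop (interval_sub _ _)

end Sentences

end InternalZF


theorem theorem4p2 {M : Type*} [InternalZF.setLang.Structure M] (hM : InternalZF.IsZFModel M) :
    List.TFAE
      [InternalZF.SecondCountableCompactHausdorffSequential M,
        InternalZF.HilbertCubeSequential M,
        InternalZF.UnitIntervalSequential M,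
        InternalZF.CantorCubeSequential M,
        InternalZF.RealLineSequential M] := by
  have : Fact (InternalZF.IsZFModel M) := ⟨hM⟩
  rw [InternalZF.hilbertCubeSequential_iff, InternalZF.unitIntervalSequential_iff,
    InternalZF.cantorCubeSequential_iff, InternalZF.realLineSequential_iff]
  tfae_have 1 → 4 := fun h => h _ _ InternalZF.isTopology_cantorTop
    InternalZF.isSecondCountable_cantorTop InternalZF.isCompactSpace_cantorTop
    InternalZF.isHausdorff_cantorTop
  tfae_have 4 → 1 := fun h X T hT hB hc hX => h.of_compact hT hB hc hX
  tfae_have 4 → 2 := fun h =>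
    InternalZF.powTop_interval h InternalZF.realZero_mem InternalZF.realOne_mem
  tfae_have 2 → 3 := fun h => h.of_powTop InternalZF.isTopology_unitInterval
  tfae_have 3 → 4 := InternalZF.cantor_of_unitInterval
  tfae_have 4 → 5 := fun h => InternalZF.realLine_of_intervals fun a b ha hb =>
    (InternalZF.powTop_interval h ha hb).of_powTop
      (InternalZF.isTopology_realTop.subTop (InternalZF.interval_sub a b))
  tfae_have 5 → 3 := fun h => h.closed_subspace
    (InternalZF.isClosedIn_interval InternalZF.realZero_mem InternalZF.realOne_mem)
  tfae_finish
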